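/- **Theorem 5.** For a finite simple graph $G=(V,E)$ with $n\ge 1$ vertices and $m$ edges and integers $k_1,k_2$, the problem 2-Load Coloring asks whether there is a coloring $f:V\to\{r,b\}$ such that at least $k_1$ edges of $G$ have both end vertices colored $r$ and at least $k_2$ edges have both end vertices colored $b$. A threshold graph is a graph that can be constructed from the one-vertex graph by repeatedly adding an isolated vertex or a universal vertex, and the distance of $G$ to threshold graphs is the minimum number of vertices that have to be deleted from $G$ in order to obtain a threshold graph. Running times are numbers of steps on a random access machine (integer registers and memory, indirect addressing, addition, subtraction and conditional jumps at unit cost), with graphs given by their adjacency matrices. (a) 2-Load Coloring is fixed-parameter tractable parameterized by the distance to threshold graphs: there are an algorithm, a computable function $g:\mathbb N\to\mathbb N$ and a constant $c$ such that the algorithm decides every instance $(G,k_1,k_2)$ in at most $g(k)\,n^{c}$ steps, where $k$ is the distance of $G$ to threshold graphs. (b) There are an algorithm and a constant $C$ such that, given $(G,X,k_1,k_2)$ with $X\subseteq V$, $|X|=k$ and $G-X$ a threshold graph, the algorithm decides the instance $(G,k_1,k_2)$ of 2-Load Coloring in at most $C\cdot 2^{k}n^{3}\max\{1,m\}$ steps,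 that is, in time $O(2^k n^3 m)$ if $G$ has an edge. -/

import Mathlib

/-! ### Random access machines

A machine has registers, addressed directly by its instructions, and a memory that is accessed
through `load` and `store` at an address held in a register. Registers and memory cells hold
integers. The only arithmetic is addition and subtraction, and every instruction costs one step.
(Without multiplication, this unit-cost model is polynomially equivalent to Turing machines.) -/

namespace RAM

/-- Instructions. `d`, `a`, `b` are register numbers and `l` is a line of the program. -/
inductive Instr : Type
  /-- `reg d := z` -/
  | const (d : ℕ) (z : ℤ)
  /-- `reg d := reg a` -/
  | move (d a : ℕ)
  /-- `reg d := reg a + reg b` -/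
  | add (d a b : ℕ)
  /-- `reg d := reg a - reg b` -/
  | sub (d a b : ℕ)
  /-- `reg d := mem[reg a]` -/
  | load (d a : ℕ)
  /-- `mem[reg a] := reg b` -/
  | store (a b : ℕ)
  /-- go to line `l` -/
  | jump (l : ℕ)
  /-- go to line `l` if `reg a > 0`, and to the next line otherwise -/
  | jpos (a l : ℕ)

/-- A program is a finite list of instructions (lines `0, 1, 2, …`). -/
abbrev Program : Type := List Instr

/-- A configuration: the current line, the registers and the memory. -/
structure Config : Type where
  pc : ℕ
  reg : ℕ → ℤ
  mem : ℕ → ℤ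

/-- The effect of one instruction. A negative address is read as the address `0`. -/
def Instr.exec : Instr → Config → Config
  | .const d z, c => ⟨c.pc + 1, Function.update c.reg d z, c.mem⟩
  | .move d a, c => ⟨c.pc + 1, Function.update c.reg d (c.reg a), c.mem⟩
  | .add d a b, c => ⟨c.pc + 1, Function.update c.reg d (c.reg a + c.reg b), c.mem⟩
  | .sub d a b, c => ⟨c.pc + 1, Function.update c.reg d (c.reg a - c.reg b), c.mem⟩
  | .load d a, c => ⟨c.pc + 1, Function.update c.reg d (c.mem (c.reg a).toNat), c.mem⟩
  | .store a b, c => ⟨c.pc + 1, c.reg, Function.update c.mem (c.reg a).toNat (c.reg b)⟩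
  | .jump l, c => ⟨l, c.reg, c.mem⟩
  | .jpos a l, c => ⟨if 0 < c.reg a then l else c.pc + 1, c.reg, c.mem⟩

/-- The machine has halted when the current line lies beyond the end of the program. -/
def Halted (p : Program) (c : Config) : Prop := p.length ≤ c.pc

/-- One step of the machine; a halted machine does not move. -/
def step (p : Program) (c : Config) : Config :=
  match p[c.pc]? with
  | none => c
  | some i => i.exec c

/-- Start at line `0`, all registers `0`, the input in the cells `0, 1, 2, …` of the memory
and `0` in all other cells. -/
def init (input : List ℤ) : Config := ⟨0, fun _ => 0, fun a => input.getD a 0⟩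

open Classical in
/-- On `input`, the program `p` halts after at most `T` steps, and then register `0` holds `1`
if `Q` is true and `0` if `Q` is false. -/
def DecidesWithin (p : Program) (input : List ℤ) (Q : Prop) (T : ℕ) : Prop :=
  ∃ t ≤ T, Halted p ((step p)^[t] (init input)) ∧
    ((step p)^[t] (init input)).reg 0 = if Q then 1 else 0

end RAM

namespace LoadColoring

/-- `Constructible G S`: the induced subgraph `G[S]` can be constructed from a one-vertex graph by
repeatedly adding an isolated vertex or a universal vertex. -/
inductive Constructible {V : Type*} (G : SimpleGraph V) : Set V → Prop
  | single (v : V) : Constructible G {v}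
  | isolated (S : Set V) (v : V) (hS : Constructible G S) (hv : v ∉ S)
      (h : ∀ u ∈ S, ¬ G.Adj v u) : Constructible G (insert v S)
  | universal (S : Set V) (v : V) (hS : Constructible G S) (hv : v ∉ S)
      (h : ∀ u ∈ S, G.Adj v u) : Constructible G (insert v S)

/-- Threshold graphs. -/
def IsThreshold {V : Type*} (G : SimpleGraph V) : Prop := Constructible G Set.univ

/-- `X` is a set of vertices such that `G - X` is a threshold graph. -/
def IsThresholdDeletionSet {V : Type*} (G : SimpleGraph V) (X : Finset V) : Prop :=
  IsThreshold (G.induce {v | v ∉ X})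

/-- The distance of `G` to threshold graphs: the minimum number of vertices that have to be
deleted from `G` in order to obtain a threshold graph. -/
noncomputable def distToThreshold {V : Type*} (G : SimpleGraph V) : ℕ :=
  sInf {k | ∃ X : Finset V, IsThresholdDeletionSet G X ∧ X.card = k}

/-- The two colors. -/
inductive Color : Type
  | red
  | blue

/-- The number of edges of `G` both of whose end vertices have color `c` in the coloring `f`. -/
noncomputable def monoEdges {V : Type*} (G : SimpleGraph V) (f : V → Color) (c : Color) : ℕ :=
  {e ∈ G.edgeSet | ∀ v ∈ e, f v = c}.ncard

/-- The question of the 2-Load Coloring problem. -/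
def HasLoadColoring {V : Type*} (G : SimpleGraph V) (k₁ k₂ : ℤ) : Prop :=
  ∃ f : V → Color, k₁ ≤ (monoEdges G f .red : ℤ) ∧ k₂ ≤ (monoEdges G f .blue : ℤ)

open Classical in
/-- The encoding of an instance `(G, k₁, k₂)`: the number `n` of vertices, `k₁`, `k₂`, and the
adjacency matrix of `G`, row by row. -/
noncomputable def encode {n : ℕ} (G : SimpleGraph (Fin n)) (k₁ k₂ : ℤ) : List ℤ :=
  [(n : ℤ), k₁, k₂] ++
    List.ofFn (fun a : Fin (n * n) => if G.Adj a.divNat a.modNat then (1 : ℤ) else 0)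

open Classical in
/-- The encoding of an instance `(G, X, k₁, k₂)`: that of `(G, k₁, k₂)`, followed by the
indicator vector of `X`. -/
noncomputable def encodeWithSet {n : ℕ} (G : SimpleGraph (Fin n)) (X : Finset (Fin n))
    (k₁ k₂ : ℤ) : List ℤ :=
  encode G k₁ k₂ ++ List.ofFn (fun v : Fin n => if v ∈ X then (1 : ℤ) else 0)

end LoadColoring

/-! ### A structured language and its compilation to random access machines -/

namespace Prog

/-! Given a deletion set `X` with `k` vertices, try all `2 ^ k` ways to split `X` into red and blue.
The rest of the graph is built by adding vertices `w 0, w 1, …`, each adjacent to all or to none of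
the earlier ones. When `w i` gets a color, the number of new monochromatic edges therefore depends
only on that color, on the neighbors of `w i` of that color in `X`, and on the number `j` of red
vertices among the `i` earlier ones (`IsConstruction.card_neighbors`,
`IsConstruction.reachable_succ`). So a table indexed by `j` and by the number `e` of red edges,
which stores the largest possible number of blue edges, can be updated vertex by vertex with
constant work per entry (`IsTable.succ`). The order `w` is found by peeling: every nonempty induced
subgraph of a threshold graph has an isolated or a universal vertex
(`Constructible.exists_extremal`), and such a vertex can be placed last.

Without a given deletion set, one is approximated. The property that peeling needs, `Peelable`,
holds exactly when there is no alternating 4-cycle, that is, no induced `2K₂`, `P₄` or `C₄`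
(`Peelable.not_alternatingCycle`, `peelable_of_forall_not_alternatingCycle`). A greedily chosen
family of disjoint alternating 4-cycles has a peelable complement, and every deletion set meets each
of its members, so its union has at most `4 * k` vertices (`exec_greedySet`). The same dynamic
program then handles at most `2 ^ (4 * k) = 16 ^ k` colorings. The greedy set may consist of all
vertices, and the empty graph is not constructible; this is why the later steps ask for `Peelable`
and not for a threshold graph.

To obtain machine programs, the algorithms are written in a small language of assignments,
conditionals and counting loops. `Stmt.reaches_code` shows that the compiled code simulates the
semantics within the stated cost, `Stmt.exec_loop` is the invariant rule behind all correctness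
proofs, and `Stmt.cost_le_bound` turns running times into polynomials in the loop bounds. As the
machine cannot multiply or divide, row addresses are accumulated by addition and colorings are
decoded by doubling. -/

/-- Program variables. -/
inductive Var : Type
  | n | n1 | k1 | k2 | m | pw | rest | cnt | t | u | v | w | d | c | r | er | eb
  | i | j | e | vi | ar | ab | rg | bg | val | ans | rnd | a | b
  deriving DecidableEq

/-- Program arrays. -/
inductive Arr : Type
  | row | x | al | ord | typ | cr | cb | full | tab | new | tr
  deriving DecidableEq

/-- The number of a variable. -/
def Var.idx (z : Var) : ℕ := z.ctorIdx

/-- The number of an array. -/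
def Arr.idx (A : Arr) : ℕ := A.ctorIdx

theorem Var.idx_injective : Function.Injective Var.idx := by
  intro x y h
  rw [← Var.ofNat_ctorIdx x, ← Var.ofNat_ctorIdx y]
  exact congrArg _ h

theorem Arr.idx_injective : Function.Injective Arr.idx := by
  intro A B h
  rw [← Arr.ofNat_ctorIdx A, ← Arr.ofNat_ctorIdx B]
  exact congrArg _ h

theorem Arr.idx_lt (A : Arr) : A.idx < 16 := by
  cases A <;> decide

/-- Expressions; `pos e` is `1` if `e > 0` and `0` otherwise, `get A e` is a cell of an array and
`inp e` a cell of the input. Negative indices are read as `0`. -/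
inductive Expr : Type
  | lit (z : ℤ)
  | var (x : Var)
  | add (a b : Expr)
  | sub (a b : Expr)
  | pos (a : Expr)
  | get (A : Arr) (a : Expr)
  | inp (a : Expr)

/-- Statements; `loop x y s` executes `s` for `x = 0, …, y - 1`. -/
inductive Stmt : Type
  | skip
  | set (x : Var) (e : Expr)
  | put (A : Arr) (a e : Expr)
  | seq (s₁ s₂ : Stmt)
  | ite (e : Expr) (s₁ s₂ : Stmt)
  | loop (x y : Var) (s : Stmt)

/-- The values of the variables and arrays. -/
structure State : Type where
  var : Var → ℤ
  arr : Arr → ℕ → ℤ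

/-- Assignment to a variable. -/
def State.set (s : State) (x : Var) (z : ℤ) : State := ⟨Function.update s.var x z, s.arr⟩

/-- Assignment to a cell of an array. -/
def State.put (s : State) (A : Arr) (i : ℕ) (z : ℤ) : State :=
  ⟨s.var, Function.update s.arr A (Function.update (s.arr A) i z)⟩

/-- The value of an expression. -/
def Expr.eval (I : List ℤ) (s : State) : Expr → ℤ
  | lit z => z
  | var x => s.var x
  | add a b => a.eval I s + b.eval I s
  | sub a b => a.eval I s - b.eval I s
  | pos a => if 0 < a.eval I s then 1 else 0
  | get A a => s.arr A (a.eval I s).toNat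
  | inp a => I.getD (a.eval I s).toNat 0

/-- `f (k - 1) (… (f 0 s))`. -/
def iter {α : Type*} (f : ℕ → α → α) : ℕ → α → α
  | 0, s => s
  | k + 1, s => f k (iter f k s)

/-- The effect of a statement. -/
def Stmt.exec (I : List ℤ) : Stmt → State → State
  | skip, s => s
  | set x e, s => s.set x (e.eval I s)
  | put A a e, s => s.put A (a.eval I s).toNat (e.eval I s)
  | seq s₁ s₂, s => s₂.exec I (s₁.exec I s)
  | ite e s₁ s₂, s => if 0 < e.eval I s then s₁.exec I s else s₂.exec I s
  | loop x y b, s => iter (fun k s => b.exec I (s.set x k)) (s.var y).toNat s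

/-- A bound for the number of steps that the evaluation of an expression takes. -/
def Expr.cost : Expr → ℕ
  | lit _ => 1
  | var _ => 1
  | add a b => a.cost + (b.cost + 1)
  | sub a b => a.cost + (b.cost + 1)
  | pos a => a.cost + 3
  | get _ a => a.cost + 10
  | inp a => a.cost + 6

/-- A bound for the number of steps that the execution of a statement takes. -/
def Stmt.cost (I : List ℤ) : Stmt → State → ℕ
  | skip, _ => 0
  | set _ e, _ => e.cost + 1
  | put _ a e, _ => a.cost + (e.cost + 10)
  | seq s₁ s₂, s => s₁.cost I s + s₂.cost I (s₁.exec I s)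
  | ite e s₁ s₂, s =>
      e.cost + (if 0 < e.eval I s then s₁.cost I s + 1 else s₂.cost I s + 2)
  | loop x y b, s => 5 + ∑ k ∈ Finset.range (s.var y).toNat,
      (6 + b.cost I ((iter (fun k s => b.exec I (s.set x k)) k s).set x k))

open RAM

/-- Replace the content of register `a` by its positive part. -/
def clampCode (q a : ℕ) : Program := [.jpos a (q + 2), .const a 0]

/-- From the index in register `2 * t + 1`, compute the address of a cell of an array. -/
def addrCode (t : ℕ) (A : Arr) : Program :=
  [.add (2 * t + 1) (2 * t + 1) (2 * t + 1), .add (2 * t + 1) (2 * t + 1) (2 * t + 1),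
   .add (2 * t + 1) (2 * t + 1) (2 * t + 1), .add (2 * t + 1) (2 * t + 1) (2 * t + 1),
   .add (2 * t + 1) (2 * t + 1) 0, .const (2 * t + 3) (A.idx + 1),
   .add (2 * t + 1) (2 * t + 1) (2 * t + 3)]

/-- Code from line `q` on that puts the value of an expression into register `2 * t + 1`, without
writing to the registers `2 * t' + 1` for `t' < t`. -/
def Expr.code (q t : ℕ) : Expr → Program
  | lit z => [.const (2 * t + 1) z]
  | var x => [.move (2 * t + 1) (2 * x.idx + 2)]
  | add a b => a.code q t ++ (b.code (q + (a.code q t).length) (t + 1) ++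
      [.add (2 * t + 1) (2 * t + 1) (2 * t + 3)])
  | sub a b => a.code q t ++ (b.code (q + (a.code q t).length) (t + 1) ++
      [.sub (2 * t + 1) (2 * t + 1) (2 * t + 3)])
  | pos a => a.code q t ++
      [.jpos (2 * t + 1) (q + (a.code q t).length + 3), .const (2 * t + 1) 0,
       .jump (q + (a.code q t).length + 4), .const (2 * t + 1) 1]
  | get A a => a.code q t ++ (clampCode (q + (a.code q t).length) (2 * t + 1) ++
      (addrCode t A ++ [.load (2 * t + 1) (2 * t + 1)]))
  | inp a => a.code q t ++ (clampCode (q + (a.code q t).length) (2 * t + 1) ++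
      [.sub (2 * t + 3) 0 (2 * t + 1), .jpos (2 * t + 3) (q + (a.code q t).length + 5),
       .move (2 * t + 1) 0, .load (2 * t + 1) (2 * t + 1)])

/-- Code from line `q` on for a statement; it does not write to the registers `2 * t' + 1` for
`t' < t`. -/
def Stmt.code (q t : ℕ) : Stmt → Program
  | skip => []
  | set x e => e.code q t ++ [.move (2 * x.idx + 2) (2 * t + 1)]
  | put A a e => e.code q t ++ (a.code (q + (e.code q t).length) (t + 1) ++
      (clampCode (q + (e.code q t).length +
        (a.code (q + (e.code q t).length) (t + 1)).length) (2 * (t + 1) + 1) ++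
      (addrCode (t + 1) A ++ [.store (2 * (t + 1) + 1) (2 * t + 1)])))
  | seq s₁ s₂ => s₁.code q t ++ s₂.code (q + (s₁.code q t).length) t
  | ite e s₁ s₂ =>
      let q₁ := q + (e.code q t).length + 1
      let q₂ := q₁ + (s₂.code q₁ t).length + 1
      e.code q t ++ ([.jpos (2 * t + 1) q₂] ++ (s₂.code q₁ t ++
        ([.jump (q₂ + (s₁.code q₂ t).length)] ++ s₁.code q₂ t)))
  | loop x y b =>
      [.move (2 * t + 1) (2 * y.idx + 2), .const (2 * t + 3) 0,
       .sub (2 * t + 5) (2 * t + 1) (2 * t + 3), .jpos (2 * t + 5) (q + 5),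
       .jump (q + 9 + (b.code (q + 6) (t + 2)).length), .move (2 * x.idx + 2) (2 * t + 3)] ++
      (b.code (q + 6) (t + 2) ++
      [.const (2 * t + 5) 1, .add (2 * t + 3) (2 * t + 3) (2 * t + 5), .jump (q + 2)])

/-- The program `p` contains the list `l` from line `q` on. -/
def CodeAt (p : Program) (q : ℕ) (l : Program) : Prop :=
  ∀ i, i < l.length → p[q + i]? = l[i]?

theorem codeAt_cons {p : Program} {q : ℕ} {i : Instr} {l : Program} :
    CodeAt p q (i :: l) ↔ p[q]? = some i ∧ CodeAt p (q + 1) l := by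
  constructor
  · intro h
    refine ⟨by simpa using h 0 (by simp), fun k hk => ?_⟩
    have := h (k + 1) (by simpa using hk)
    rw [show q + 1 + k = q + (k + 1) by ring, this]
    simp
  · rintro ⟨h0, h⟩ k hk
    cases k with
    | zero => simpa using h0
    | succ k =>
      have := h k (by simpa using hk)
      rw [show q + (k + 1) = q + 1 + k by ring, this]
      simp

theorem codeAt_nil {p : Program} {q : ℕ} : CodeAt p q [] := by
  intro k hk
  simp at hk

theorem codeAt_append {p : Program} {q : ℕ} {l₁ l₂ : Program} :
    CodeAt p q (l₁ ++ l₂) ↔ CodeAt p q l₁ ∧ CodeAt p (q + l₁.length) l₂ := by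
  induction l₁ generalizing q with
  | nil => simp [codeAt_nil]
  | cons i l ih =>
    rw [List.cons_append, codeAt_cons, codeAt_cons, ih, List.length_cons, and_assoc,
      show q + (l.length + 1) = q + 1 + l.length by ring]

/-- From `c`, the program `p` gets in at most `T` steps to a configuration that satisfies `Q`. -/
def Reaches (p : Program) (c : Config) (T : ℕ) (Q : Config → Prop) : Prop :=
  ∃ t ≤ T, Q ((step p)^[t] c)

theorem Reaches.done {p : Program} {c : Config} {T : ℕ} {Q : Config → Prop} (h : Q c) :
    Reaches p c T Q := ⟨0, Nat.zero_le _, h⟩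

theorem Reaches.mono {p : Program} {c : Config} {T T' : ℕ} {Q Q' : Config → Prop}
    (h : Reaches p c T Q) (hT : T ≤ T') (hQ : ∀ c', Q c' → Q' c') : Reaches p c T' Q' := by
  obtain ⟨t, ht, h⟩ := h
  exact ⟨t, ht.trans hT, hQ _ h⟩

theorem Reaches.bind {p : Program} {c : Config} {T T' : ℕ} {Q Q' : Config → Prop}
    (h : Reaches p c T Q) (h' : ∀ c', Q c' → Reaches p c' T' Q') : Reaches p c (T + T') Q' := by
  obtain ⟨t, ht, h⟩ := h
  obtain ⟨t', ht', h''⟩ := h' _ h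
  refine ⟨t' + t, by omega, ?_⟩
  rwa [Function.iterate_add_apply]

theorem Reaches.step {p : Program} {c : Config} {T : ℕ} {Q : Config → Prop} {i : Instr}
    (hi : p[c.pc]? = some i) (h : Reaches p (i.exec c) T Q) : Reaches p c (T + 1) Q := by
  obtain ⟨t, ht, h⟩ := h
  refine ⟨t + 1, by omega, ?_⟩
  rw [Function.iterate_succ_apply]
  simpa [RAM.step, hi] using h

/-- The configuration `c` represents the state `s`. -/
structure Sim (I : List ℤ) (s : State) (c : Config) : Prop where
  base : c.reg 0 = I.length
  var : ∀ x : Var, c.reg (2 * x.idx + 2) = s.var x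
  low : ∀ a ≤ I.length, c.mem a = I.getD a 0
  arr : ∀ A i, c.mem (I.length + 1 + 16 * i + Arr.idx A) = s.arr A i

/-- Register `0` holds the length of the input, the even registers from `2` on hold the variables,
and the odd ones are temporaries that represent nothing. -/
theorem Sim.temp {I : List ℤ} {s : State} {c : Config} (h : Sim I s c) (q t : ℕ) (z : ℤ) :
    Sim I s ⟨q, Function.update c.reg (2 * t + 1) z, c.mem⟩ := by
  refine ⟨?_, fun x => ?_, h.low, h.arr⟩
  · change Function.update c.reg (2 * t + 1) z 0 = _
    rw [Function.update_of_ne (by omega), h.base]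
  · exact (Function.update_of_ne (by omega) _ _).trans (h.var x)

theorem Sim.pc {I : List ℤ} {s : State} {c : Config} (h : Sim I s c) (q : ℕ) :
    Sim I s ⟨q, c.reg, c.mem⟩ := ⟨h.base, h.var, h.low, h.arr⟩

theorem Sim.set {I : List ℤ} {s : State} {c : Config} (h : Sim I s c) (q : ℕ) (x : Var) (z : ℤ) :
    Sim I (s.set x z) ⟨q, Function.update c.reg (2 * x.idx + 2) z, c.mem⟩ := by
  refine ⟨?_, fun y => ?_, h.low, h.arr⟩
  · change Function.update c.reg (2 * x.idx + 2) z 0 = _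
    rw [Function.update_of_ne (by omega), h.base]
  · by_cases hxy : y = x
    · subst hxy; simp [State.set]
    · have : y.idx ≠ x.idx := fun h => hxy (Var.idx_injective h)
      refine (Function.update_of_ne (by omega) _ _).trans ?_
      simp [State.set, hxy, h.var y]

/-- The arrays are interleaved behind the input with stride 16, so they need no declared lengths.
Array numbers are below 16, hence different cells have different addresses, and none of them is one
of the cells up to `I.length`. -/
theorem Sim.put {I : List ℤ} {s : State} {c : Config} (h : Sim I s c) (q : ℕ) (A : Arr) (i : ℕ)
    (z : ℤ) : Sim I (s.put A i z)
      ⟨q, c.reg, Function.update c.mem (I.length + 1 + 16 * i + A.idx) z⟩ := by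
  refine ⟨h.base, h.var, fun a ha => ?_, fun B j => ?_⟩
  · exact (Function.update_of_ne (by omega) _ _).trans (h.low a ha)
  · have hA := A.idx_lt
    have hB := B.idx_lt
    by_cases hBA : B = A
    · subst hBA
      by_cases hij : j = i
      · subst hij; simp [State.put]
      · refine (Function.update_of_ne (by omega) _ _).trans ?_
        simp [State.put, hij, h.arr]
    · have : B.idx ≠ A.idx := fun h => hBA (Arr.idx_injective h)
      refine (Function.update_of_ne (by omega) _ _).trans ?_
      simp [State.put, hBA, h.arr]

/-- What the code of an expression or statement guarantees: it ends at line `q`, and the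
registers `2 * t' + 1` for `t' < t` are unchanged. -/
structure Post (I : List ℤ) (s : State) (c : Config) (q t : ℕ) (c' : Config) : Prop where
  sim : Sim I s c'
  pc : c'.pc = q
  keep : ∀ t' < t, c'.reg (2 * t' + 1) = c.reg (2 * t' + 1)

theorem reaches_clamp {p : Program} {I : List ℤ} {s : State} {c : Config} {t : ℕ}
    (h : CodeAt p c.pc (clampCode c.pc (2 * t + 1))) (hs : Sim I s c) :
    Reaches p c 2 (fun c' => Post I s c (c.pc + 2) t c' ∧
      c'.reg (2 * t + 1) = ((c.reg (2 * t + 1)).toNat : ℤ)) := by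
  simp only [clampCode, codeAt_cons] at h
  refine .step h.1 ?_
  by_cases hc : 0 < c.reg (2 * t + 1)
  · refine .done ⟨⟨hs.pc _, by simp [Instr.exec, hc], fun _ _ => rfl⟩, ?_⟩
    simp [Instr.exec, hc.le]
  · refine .step (i := .const (2 * t + 1) 0) (by simpa [Instr.exec, hc] using h.2.1)
      (.done ⟨⟨hs.temp _ _ _, by simp [Instr.exec, hc], fun t' ht' => ?_⟩, ?_⟩)
    · simp only [Instr.exec]
      rw [Function.update_of_ne (by omega)]
    · simp [Instr.exec]
      omega

/-- Four doublings multiply the index by the stride 16. -/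
theorem reaches_addr {p : Program} {I : List ℤ} {s : State} {c : Config} {t : ℕ} {A : Arr}
    {i : ℕ} (h : CodeAt p c.pc (addrCode t A)) (hs : Sim I s c) (hi : c.reg (2 * t + 1) = i) :
    Reaches p c 7 (fun c' => Post I s c (c.pc + 7) t c' ∧
      c'.reg (2 * t + 1) = ((I.length + 1 + 16 * i + A.idx : ℕ) : ℤ)) := by
  simp only [addrCode, codeAt_cons] at h
  obtain ⟨h1, h2, h3, h4, h5, h6, h7, -⟩ := h
  refine .step h1 (.step h2 (.step h3 (.step h4 (.step h5 (.step h6 (.step h7 (.done ?_)))))))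
  refine ⟨⟨?_, rfl, fun t' ht' => ?_⟩, ?_⟩
  · exact ((((((hs.temp _ _ _).temp _ _ _).temp _ _ _).temp _ _ _).temp _ _ _).temp
      _ (t + 1) _).temp _ _ _
  · have e1 : 2 * t' + 1 ≠ 2 * t + 1 := by omega
    have e3 : 2 * t' + 1 ≠ 2 * t + 3 := by omega
    simp only [Instr.exec, Function.update_of_ne e1, Function.update_of_ne e3]
  · have hb := hs.base
    have e0 : (0 : ℕ) ≠ 2 * t + 1 := by omega
    have e3 : 2 * t + 1 ≠ 2 * t + 3 := by omega
    simp only [Instr.exec, Function.update_self, Function.update_of_ne e0,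
      Function.update_of_ne e3, hi, hb]
    push_cast
    ring

/-- The odd registers serve as an evaluation stack of current height `t`: a second operand is
evaluated at height `t + 1`, and `Post.keep` guarantees that the first operand survives. -/
theorem Expr.reaches_code {p : Program} {I : List ℤ} {s : State} (e : Expr) :
    ∀ {c : Config} {t : ℕ}, CodeAt p c.pc (e.code c.pc t) → Sim I s c →
    Reaches p c e.cost (fun c' => Post I s c (c.pc + (e.code c.pc t).length) t c' ∧
      c'.reg (2 * t + 1) = e.eval I s) := by
  have binary : ∀ (a b : Expr) (op : ℕ → ℕ → ℕ → Instr) (f : ℤ → ℤ → ℤ)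
      (_ : ∀ d x y c, (op d x y).exec c =
        ⟨c.pc + 1, Function.update c.reg d (f (c.reg x) (c.reg y)), c.mem⟩)
      (_ : ∀ {c : Config} {t : ℕ}, CodeAt p c.pc (a.code c.pc t) → Sim I s c →
        Reaches p c a.cost (fun c' => Post I s c (c.pc + (a.code c.pc t).length) t c' ∧
          c'.reg (2 * t + 1) = a.eval I s))
      (_ : ∀ {c : Config} {t : ℕ}, CodeAt p c.pc (b.code c.pc t) → Sim I s c →
        Reaches p c b.cost (fun c' => Post I s c (c.pc + (b.code c.pc t).length) t c' ∧
          c'.reg (2 * t + 1) = b.eval I s))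
      {c : Config} {t : ℕ}, CodeAt p c.pc (a.code c.pc t ++
        (b.code (c.pc + (a.code c.pc t).length) (t + 1) ++
          [op (2 * t + 1) (2 * t + 1) (2 * t + 3)])) → Sim I s c →
      Reaches p c (a.cost + (b.cost + 1)) (fun c' => Post I s c (c.pc +
        (a.code c.pc t ++ (b.code (c.pc + (a.code c.pc t).length) (t + 1) ++
          [op (2 * t + 1) (2 * t + 1) (2 * t + 3)])).length) t c' ∧
        c'.reg (2 * t + 1) = f (a.eval I s) (b.eval I s)) := by
    intro a b op f hop iha ihb c t h hs
    rw [codeAt_append, codeAt_append] at h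
    obtain ⟨ha, hb, ho⟩ := h
    refine (iha ha hs).bind ?_
    rintro c₁ ⟨⟨hs₁, hpc₁, hk₁⟩, hv₁⟩
    rw [← hpc₁] at hb ho ⊢
    refine (ihb hb hs₁).bind ?_
    rintro c₂ ⟨⟨hs₂, hpc₂, hk₂⟩, hv₂⟩
    rw [← hpc₂] at ho
    refine .step (codeAt_cons.1 ho).1 (.done ?_)
    rw [hop]
    refine ⟨⟨hs₂.temp _ _ _, ?_, fun t' ht' => ?_⟩, ?_⟩
    · simp [hpc₂, hpc₁]; ring
    · simp only
      rw [Function.update_of_ne (by omega), hk₂ _ (by omega), hk₁ _ ht']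
    · simp only [Function.update_self]
      rw [hk₂ _ (by omega), hv₁, show 2 * t + 3 = 2 * (t + 1) + 1 by ring, hv₂]
  induction e with
  | lit z =>
    intro c t h hs
    refine .step (codeAt_cons.1 h).1 (.done ⟨⟨hs.temp _ _ _, rfl, fun t' ht' => ?_⟩, ?_⟩)
    · simp only [Instr.exec]
      rw [Function.update_of_ne (by omega)]
    · simp [Instr.exec, Expr.eval]
  | var x =>
    intro c t h hs
    refine .step (codeAt_cons.1 h).1 (.done ⟨⟨hs.temp _ _ _, rfl, fun t' ht' => ?_⟩, ?_⟩)
    · simp only [Instr.exec]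
      rw [Function.update_of_ne (by omega)]
    · simp [Instr.exec, Expr.eval, hs.var]
  | add a b iha ihb => exact binary a b .add (· + ·) (fun _ _ _ _ => rfl) iha ihb
  | sub a b iha ihb => exact binary a b .sub (· - ·) (fun _ _ _ _ => rfl) iha ihb
  | pos a iha =>
    intro c t h hs
    rw [Expr.code, codeAt_append] at h
    obtain ⟨ha, h⟩ := h
    refine (iha ha hs).bind ?_
    rintro c₁ ⟨⟨hs₁, hpc₁, hk₁⟩, hv₁⟩
    simp only [codeAt_cons, ← hpc₁] at h
    obtain ⟨h1, h2, h3, h4, -⟩ := h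
    refine .step h1 ?_
    by_cases hc : 0 < a.eval I s
    · refine .step (i := .const (2 * t + 1) 1) ?_ (.done ⟨⟨hs₁.temp _ _ _, ?_, fun t' ht' => ?_⟩, ?_⟩)
      · simpa [Instr.exec, hv₁, hc] using h4
      · simp [Instr.exec, hv₁, hc, hpc₁, Expr.code]; ring
      · simp only [Instr.exec]
        rw [Function.update_of_ne (by omega), hk₁ _ ht']
      · simp [Instr.exec, Expr.eval, hc]
    · refine .step (i := .const (2 * t + 1) 0) ?_ (.step (i := .jump (c₁.pc + 4)) ?_
        (.done ⟨⟨hs₁.temp _ _ _, ?_, fun t' ht' => ?_⟩, ?_⟩))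
      · simpa [Instr.exec, hv₁, hc] using h2
      · simpa [Instr.exec, hv₁, hc] using h3
      · simp [Instr.exec, hpc₁, Expr.code]; ring
      · simp only [Instr.exec]
        rw [Function.update_of_ne (by omega), hk₁ _ ht']
      · simp [Instr.exec, Expr.eval, hc]
  | get A a iha =>
    intro c t h hs
    rw [Expr.code, codeAt_append, codeAt_append, codeAt_append] at h
    obtain ⟨ha, h, h', h''⟩ := h
    refine (iha ha hs).bind ?_
    rintro c₁ ⟨⟨hs₁, hpc₁, hk₁⟩, hv₁⟩
    rw [← hpc₁] at h h' h''
    refine ((reaches_clamp h hs₁).bind (T' := 8) ?_)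
    rintro c₂ ⟨⟨hs₂, hpc₂, hk₂⟩, hv₂⟩
    simp only [clampCode, List.length_cons, List.length_nil, zero_add, Nat.reduceAdd,
      ← hpc₂] at h' h''
    refine ((reaches_addr h' hs₂ hv₂).bind (T' := 1) ?_)
    rintro c₃ ⟨⟨hs₃, hpc₃, hk₃⟩, hv₃⟩
    simp only [addrCode, List.length_cons, List.length_nil, zero_add, Nat.reduceAdd,
      ← hpc₃] at h''
    refine .step (codeAt_cons.1 h'').1 (.done ⟨⟨hs₃.temp _ _ _, ?_, fun t' ht' => ?_⟩, ?_⟩)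
    · simp [Instr.exec, hpc₃, hpc₂, hpc₁, Expr.code, clampCode, addrCode]; ring
    · simp only [Instr.exec]
      rw [Function.update_of_ne (by omega), hk₃ _ ht', hk₂ _ ht', hk₁ _ ht']
    · simp only [Instr.exec, Function.update_self, hv₃, Int.toNat_natCast, hs₃.arr, hv₁, Expr.eval]
  | inp a iha =>
    intro c t h hs
    rw [Expr.code, codeAt_append, codeAt_append] at h
    obtain ⟨ha, h, h'⟩ := h
    refine (iha ha hs).bind ?_
    rintro c₁ ⟨⟨hs₁, hpc₁, hk₁⟩, hv₁⟩
    rw [← hpc₁] at h h'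
    refine ((reaches_clamp h hs₁).bind (T' := 4) ?_)
    rintro c₂ ⟨⟨hs₂, hpc₂, hk₂⟩, hv₂⟩
    simp only [clampCode, List.length_cons, List.length_nil, zero_add, Nat.reduceAdd,
      show c₁.pc + 5 = c₁.pc + 2 + 3 by ring, ← hpc₂, codeAt_cons] at h'
    obtain ⟨h1, h2, h3, h4, -⟩ := h'
    refine .step h1 (.step (i := .jpos (2 * t + 3) (c₂.pc + 3)) h2 ?_)
    have e3 : 2 * t + 1 ≠ 2 * t + 3 := by omega
    rw [hv₁] at hv₂
    have hb := hs₂.base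
    have hlen : c.pc + (Expr.code c.pc t (inp a)).length = c₂.pc + 4 := by
      simp [hpc₂, hpc₁, Expr.code, clampCode]; ring
    rw [hlen]
    have hcmp : 0 < c₂.reg 0 - c₂.reg (2 * t + 1) ↔ (a.eval I s).toNat < I.length := by
      rw [hv₂, hb, sub_pos]; exact Nat.cast_lt
    by_cases hc : (a.eval I s).toNat < I.length
    · have hpos := hcmp.2 hc
      refine .step (i := .load (2 * t + 1) (2 * t + 1)) ?_ (.done ⟨⟨?_, ?_, fun t' ht' => ?_⟩, ?_⟩)
      · simp only [Instr.exec, Function.update_self, if_pos hpos]; exact h4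
      · exact (hs₂.temp c₂.pc (t + 1) _).temp _ _ _
      · simp only [Instr.exec, Function.update_self, if_pos hpos]
      · simp only [Instr.exec]
        rw [Function.update_of_ne (by omega), Function.update_of_ne (by omega), hk₂ _ ht',
          hk₁ _ ht']
      · simp only [Instr.exec, Function.update_self, Function.update_of_ne e3, hv₂,
          Int.toNat_natCast, hs₂.low _ hc.le, Expr.eval]
    -- An index beyond the input is replaced by the length of the input. The cell at this address
    -- belongs to no array and stays `0`, which is the default value of `getD`.
    · have hpos := mt hcmp.1 hc
      refine .step (i := .move (2 * t + 1) 0) ?_ (.step (i := .load (2 * t + 1) (2 * t + 1)) ?_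
        (.done ⟨⟨?_, ?_, fun t' ht' => ?_⟩, ?_⟩))
      · simp only [Instr.exec, Function.update_self, if_neg hpos]; exact h3
      · simp only [Instr.exec, Function.update_self, if_neg hpos]; exact h4
      · exact ((hs₂.temp c₂.pc (t + 1) _).temp c₂.pc t _).temp _ _ _
      · simp only [Instr.exec, Function.update_self, if_neg hpos]
      · simp only [Instr.exec]
        rw [Function.update_of_ne (by omega), Function.update_of_ne (by omega),
          Function.update_of_ne (by omega), hk₂ _ ht', hk₁ _ ht']
      · have e0 : 0 ≠ 2 * t + 3 := by omega
        simp only [Instr.exec, Function.update_self, Function.update_of_ne e0, hb,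
          Int.toNat_natCast, hs₂.low _ le_rfl, Expr.eval]
        rw [List.getD_eq_default _ _ le_rfl, List.getD_eq_default _ _ (not_lt.1 hc)]

/-- Induction on the statement. A loop keeps its bound and its counter on the evaluation stack at
heights `t` and `t + 1` and runs its body at height `t + 2`, so the body can disturb neither of
them, even if it changes the variables `x` and `y`. -/
theorem Stmt.reaches_code {p : Program} {I : List ℤ} (b : Stmt) :
    ∀ {s : State} {c : Config} {t : ℕ}, CodeAt p c.pc (b.code c.pc t) → Sim I s c →
    Reaches p c (b.cost I s) (Post I (b.exec I s) c (c.pc + (b.code c.pc t).length) t) := by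
  induction b with
  | skip =>
    intro s c t h hs
    exact .done ⟨hs, by simp [Stmt.code], fun _ _ => rfl⟩
  | set x e =>
    intro s c t h hs
    rw [Stmt.code, codeAt_append] at h
    refine (e.reaches_code h.1 hs).bind ?_
    rintro c₁ ⟨⟨hs₁, hpc₁, hk₁⟩, hv₁⟩
    have h' := h.2
    rw [← hpc₁] at h'
    refine .step (codeAt_cons.1 h').1 (.done ⟨?_, ?_, fun t' ht' => ?_⟩)
    · simp only [Instr.exec, hv₁]
      exact hs₁.set _ _ _
    · simp [Instr.exec, hpc₁, Stmt.code]; ring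
    · simp only [Instr.exec]
      rw [Function.update_of_ne (by omega), hk₁ _ ht']
  | put A a e =>
    intro s c t h hs
    rw [Stmt.code, codeAt_append, codeAt_append, codeAt_append, codeAt_append] at h
    obtain ⟨he, ha, h, h', h''⟩ := h
    rw [Stmt.cost, show a.cost + (e.cost + 10) = e.cost + (a.cost + 10) by ring]
    refine (e.reaches_code he hs).bind ?_
    rintro c₀ ⟨⟨hs₀, hpc₀, hk₀⟩, hv₀⟩
    rw [← hpc₀] at ha h h' h''
    refine (a.reaches_code ha hs₀).bind ?_
    rintro c₁ ⟨⟨hs₁, hpc₁, hk₁⟩, hv₁⟩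
    rw [← hpc₁] at h h' h''
    refine ((reaches_clamp h hs₁).bind (T' := 8) ?_)
    rintro c₂ ⟨⟨hs₂, hpc₂, hk₂⟩, hv₂⟩
    simp only [clampCode, List.length_cons, List.length_nil, zero_add, Nat.reduceAdd,
      ← hpc₂] at h' h''
    refine ((reaches_addr h' hs₂ hv₂).bind (T' := 1) ?_)
    rintro c₃ ⟨⟨hs₃, hpc₃, hk₃⟩, hv₃⟩
    simp only [addrCode, List.length_cons, List.length_nil, zero_add, Nat.reduceAdd,
      ← hpc₃] at h''
    refine .step (codeAt_cons.1 h'').1 (.done ⟨?_, ?_, fun t' ht' => ?_⟩)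
    · simp only [Instr.exec, hv₃, Int.toNat_natCast]
      rw [hk₃ t (by omega), hk₂ t (by omega), hk₁ t (by omega), hv₀, hv₁]
      exact hs₃.put _ _ _ _
    · simp [Instr.exec, hpc₃, hpc₂, hpc₁, hpc₀, Stmt.code, clampCode, addrCode]; ring
    · simp only [Instr.exec]
      rw [hk₃ _ (by omega), hk₂ _ (by omega), hk₁ _ (by omega), hk₀ _ ht']
  | seq b₁ b₂ ih₁ ih₂ =>
    intro s c t h hs
    rw [Stmt.code, codeAt_append] at h
    refine (ih₁ h.1 hs).bind ?_
    rintro c₁ ⟨hs₁, hpc₁, hk₁⟩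
    have h' := h.2
    rw [← hpc₁] at h'
    refine (ih₂ h' hs₁).mono le_rfl ?_
    rintro c₂ ⟨hs₂, hpc₂, hk₂⟩
    refine ⟨hs₂, ?_, fun t' ht' => by rw [hk₂ _ ht', hk₁ _ ht']⟩
    rw [hpc₂, hpc₁, Stmt.code, List.length_append]; ring
  | ite e b₁ b₂ ih₁ ih₂ =>
    intro s c t h hs
    simp only [Stmt.code] at h ⊢
    rw [codeAt_append, codeAt_append, codeAt_append, codeAt_append] at h
    obtain ⟨he, hj, h₂, hj', h₁⟩ := h
    refine (e.reaches_code he hs).bind ?_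
    rintro c₀ ⟨⟨hs₀, hpc₀, hk₀⟩, hv₀⟩
    simp only [← hpc₀, List.length_append, List.length_cons, List.length_nil, zero_add] at hj h₂ hj' h₁ ⊢
    have hj0 := (codeAt_cons.1 hj).1
    by_cases hc : 0 < e.eval I s
    · simp only [Stmt.exec, hc, if_true]
      refine .step hj0 ((ih₁ (s := s) (t := t) ?_ (hs₀.pc _)).mono le_rfl ?_)
      · simpa [Instr.exec, hv₀, hc] using h₁
      · rintro c₂ ⟨hs₂, hpc₂, hk₂⟩
        refine ⟨hs₂, ?_, fun t' ht' => by rw [hk₂ _ ht']; exact hk₀ _ ht'⟩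
        rw [hpc₂]
        simp only [hv₀, hc, if_true]
        rw [← Nat.add_assoc c.pc, ← hpc₀]
        ring
    · simp only [Stmt.exec, hc, if_false]
      refine .step hj0 ((ih₂ (s := s) (t := t) ?_ (hs₀.pc _)).bind (T' := 1) ?_)
      · simpa [Instr.exec, hv₀, hc] using h₂
      · rintro c₂ ⟨hs₂, hpc₂, hk₂⟩
        simp only [hv₀, hc, if_false] at hpc₂
        rw [← hpc₂] at hj'
        refine .step (codeAt_cons.1 hj').1 (.done ⟨hs₂.pc _, ?_, fun t' ht' => ?_⟩)
        · simp only [Instr.exec]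
          rw [← Nat.add_assoc c.pc, ← hpc₀, hpc₂]
          ring
        · simp only [Instr.exec]
          rw [hk₂ _ ht']; exact hk₀ _ ht'
  | loop x y b ih =>
    intro s c t h hs
    rw [Stmt.code, codeAt_append, codeAt_append] at h
    obtain ⟨h, hb, h'⟩ := h
    simp only [codeAt_cons, List.length_cons, List.length_nil, zero_add, Nat.reduceAdd] at h hb h'
    obtain ⟨h0, h1, h2, h3, h4, h5, -⟩ := h
    obtain ⟨h6, h7, h8, -⟩ := h'
    simp only [add_assoc, Nat.reduceAdd] at h0 h1 h2 h3 h4 h5 h6 h7 h8 hb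
    set f : ℕ → State → State := fun k s => b.exec I (s.set x k) with hf
    set N := (s.var y).toNat with hN
    set lb := (b.code (c.pc + 6) (t + 2)).length with hlb
    have hlen : (Stmt.code c.pc t (loop x y b)).length = 9 + lb := by
      simp [Stmt.code, ← hlb]; omega
    rw [hlen]
    -- After `k` rounds the machine is at the loop test. Two steps initialize bound and counter;
    -- each round adds three steps before the body and three after it. The failing test and the exit
    -- account for the remaining three of the constant 5.
    have main : ∀ k ≤ N, Reaches p c (2 + ∑ k ∈ Finset.range k, (6 + b.cost I ((iter f k s).set x k)))
        (fun c' => Post I (iter f k s) c (c.pc + 2) t c' ∧ c'.reg (2 * t + 1) = s.var y ∧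
          c'.reg (2 * t + 3) = k) := by
      intro k
      induction k with
      | zero =>
        intro _
        refine .step h0 (.step (i := .const (2 * t + 3) 0) h1 (.done ⟨⟨?_, rfl, fun t' ht' => ?_⟩, ?_, ?_⟩))
        · exact (hs.temp _ t _).temp _ (t + 1) _
        · simp only [Instr.exec]
          rw [Function.update_of_ne (by omega), Function.update_of_ne (by omega)]
        · simp only [Instr.exec]
          rw [Function.update_of_ne (by omega), Function.update_self, hs.var]
        · simp [Instr.exec]
      | succ k ihk =>
        intro hk
        rw [Finset.sum_range_succ, ← add_assoc]
        refine (ihk (by omega)).bind ?_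
        rintro c₁ ⟨⟨hs₁, hpc₁, hk₁⟩, hv₁, hv₁'⟩
        have e1 : 2 * t + 1 ≠ 2 * t + 5 := by omega
        have e3 : 2 * t + 3 ≠ 2 * t + 5 := by omega
        have hpos : 0 < c₁.reg (2 * t + 1) - c₁.reg (2 * t + 3) := by
          rw [hv₁, hv₁']; omega
        rw [show ∀ z, 6 + z = (z + 3) + 1 + 1 + 1 by intro z; ring]
        refine .step (i := .sub (2 * t + 5) (2 * t + 1) (2 * t + 3)) (by rw [hpc₁]; exact h2)
          (.step (i := .jpos (2 * t + 5) (c.pc + 5)) (by simp only [Instr.exec, hpc₁]; exact h3)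
          (.step (i := .move (2 * x.idx + 2) (2 * t + 3)) ?_ ?_))
        · simp only [Instr.exec, Function.update_self, if_pos hpos]; exact h5
        · simp only [Instr.exec, Function.update_self, Function.update_of_ne e3, hv₁',
            add_assoc, Nat.reduceAdd]
          rw [hv₁'] at hpos
          simp only [if_pos hpos, add_assoc, Nat.reduceAdd]
          refine (ih (s := (iter f k s).set x k) (t := t + 2) hb ?_).bind ?_
          · exact (hs₁.temp c₁.pc (t + 2) _).set _ _ _
          rintro c₂ ⟨hs₂, hpc₂, hk₂⟩
          have hk₂a := hk₂ t (by omega)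
          have hk₂b := hk₂ (t + 1) (by omega)
          simp only at hk₂ hpc₂ hk₂a
          simp only [show 2 * (t + 1) + 1 = 2 * t + 3 by ring] at hk₂b
          rw [Function.update_of_ne (by omega), Function.update_of_ne (by omega)] at hk₂a hk₂b
          simp only [add_assoc, ← hlb] at hpc₂
          refine .step (i := .const (2 * t + 5) 1) (by rw [hpc₂]; exact h6)
            (.step (i := .add (2 * t + 3) (2 * t + 3) (2 * t + 5)) ?_
            (.step (i := .jump (c.pc + 2)) ?_ (.done ⟨⟨?_, rfl, fun t' ht' => ?_⟩, ?_, ?_⟩)))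
          · simp only [Instr.exec, hpc₂, add_assoc]; exact h7
          · simp only [Instr.exec, hpc₂, add_assoc]; exact h8
          · exact ((hs₂.temp _ (t + 2) _).temp _ (t + 1) _).pc _
          · simp only [Instr.exec]
            rw [Function.update_of_ne (by omega), Function.update_of_ne (by omega),
              hk₂ _ (by omega), Function.update_of_ne (by omega), Function.update_of_ne (by omega),
              hk₁ _ ht']
          · simp only [Instr.exec]
            rw [Function.update_of_ne (by omega), Function.update_of_ne (by omega), hk₂a, hv₁]
          · simp only [Instr.exec, Function.update_self, Function.update_of_ne e3, hk₂b, hv₁']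
            push_cast; ring
    rw [Stmt.cost, show ∀ z, 5 + z = 2 + z + 3 by intro z; ring]
    refine (main N le_rfl).bind ?_
    rintro c₁ ⟨⟨hs₁, hpc₁, hk₁⟩, hv₁, hv₁'⟩
    have hpos : ¬ 0 < c₁.reg (2 * t + 1) - c₁.reg (2 * t + 3) := by
      rw [hv₁, hv₁']; omega
    refine .step (i := .sub (2 * t + 5) (2 * t + 1) (2 * t + 3)) (by rw [hpc₁]; exact h2)
      (.step (i := .jpos (2 * t + 5) (c.pc + 5)) (by simp only [Instr.exec, hpc₁]; exact h3)
      (.step (i := .jump (c.pc + (9 + lb))) ?_ (.done ⟨?_, rfl, fun t' ht' => ?_⟩)))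
    · simp only [Instr.exec, Function.update_self, if_neg hpos, hpc₁]
      exact h4
    · exact (hs₁.temp c₁.pc (t + 2) _).pc _
    · simp only [Instr.exec]
      rw [Function.update_of_ne (by omega), hk₁ _ ht']

end Prog

/-! ### Notation for programs and rules for reasoning about their effect. -/

namespace Prog

open RAM

instance : Add Expr := ⟨Expr.add⟩
instance : Sub Expr := ⟨Expr.sub⟩
instance : Coe Var Expr := ⟨Expr.var⟩
instance (k : ℕ) : OfNat Expr k := ⟨Expr.lit k⟩

/-- `a ≤ b`, as an expression that is positive if and only if this is true. -/
def Expr.le (a b : Expr) : Expr := b - a + 1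

/-- `a < b`, as an expression that is positive if and only if this is true. -/
def Expr.lt (a b : Expr) : Expr := b - a

/-- An expression that is positive if and only if `a` and `b` are. -/
def Expr.and (a b : Expr) : Expr := .pos a + .pos b - 1

/-- An expression that is positive if and only if `a` is not. -/
def Expr.not (a : Expr) : Expr := 1 - .pos a

infixr:60 " ;; " => Stmt.seq

section eval

variable {I : List ℤ} {s : State} {a b : Expr}

@[simp] theorem Expr.eval_var (x : Var) : (Expr.var x).eval I s = s.var x := rfl
@[simp] theorem Expr.eval_add : (a + b).eval I s = a.eval I s + b.eval I s := rfl
@[simp] theorem Expr.eval_sub : (a - b).eval I s = a.eval I s - b.eval I s := rfl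
@[simp] theorem Expr.eval_zero : (0 : Expr).eval I s = 0 := rfl
@[simp] theorem Expr.eval_one : (1 : Expr).eval I s = 1 := rfl
@[simp] theorem Expr.eval_ofNat (k : ℕ) [k.AtLeastTwo] :
    (ofNat(k) : Expr).eval I s = OfNat.ofNat k := rfl
@[simp] theorem Expr.eval_pos : (Expr.pos a).eval I s = if 0 < a.eval I s then 1 else 0 := rfl
@[simp] theorem Expr.eval_get (A : Arr) :
    (Expr.get A a).eval I s = s.arr A (a.eval I s).toNat := rfl
@[simp] theorem Expr.eval_inp : (Expr.inp a).eval I s = I.getD (a.eval I s).toNat 0 := rfl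

@[simp] theorem Expr.le_pos : 0 < (Expr.le a b).eval I s ↔ a.eval I s ≤ b.eval I s := by
  simp only [Expr.le, eval_add, eval_sub, eval_one]; omega

@[simp] theorem Expr.lt_pos : 0 < (Expr.lt a b).eval I s ↔ a.eval I s < b.eval I s := by
  simp [Expr.lt]

@[simp] theorem Expr.and_pos :
    0 < (Expr.and a b).eval I s ↔ 0 < a.eval I s ∧ 0 < b.eval I s := by
  simp only [Expr.and, eval_add, eval_sub, eval_one, eval_pos]
  split_ifs <;> simp_all

@[simp] theorem Expr.not_pos : 0 < (Expr.not a).eval I s ↔ ¬ 0 < a.eval I s := by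
  simp only [Expr.not, eval_sub, eval_one, eval_pos]
  split_ifs <;> simp_all

end eval

section exec

variable {I : List ℤ} {s : State}

@[simp] theorem State.var_set (x y : Var) (z : ℤ) :
    (s.set x z).var y = if y = x then z else s.var y := by
  simp [State.set, Function.update_apply]

@[simp] theorem State.arr_set (x : Var) (z : ℤ) : (s.set x z).arr = s.arr := rfl

@[simp] theorem State.var_put (A : Arr) (i : ℕ) (z : ℤ) : (s.put A i z).var = s.var := rfl

@[simp] theorem State.arr_put (A B : Arr) (i j : ℕ) (z : ℤ) :
    (s.put A i z).arr B j = if B = A ∧ j = i then z else s.arr B j := by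
  by_cases h : B = A
  · subst h; simp [State.put, Function.update_apply]
  · simp [State.put, h]

@[simp] theorem Stmt.exec_set (x : Var) (e : Expr) :
    (Stmt.set x e).exec I s = s.set x (e.eval I s) := rfl

@[simp] theorem Stmt.exec_put (A : Arr) (a e : Expr) :
    (Stmt.put A a e).exec I s = s.put A (a.eval I s).toNat (e.eval I s) := rfl

@[simp] theorem Stmt.exec_seq (b₁ b₂ : Stmt) :
    (b₁ ;; b₂).exec I s = b₂.exec I (b₁.exec I s) := rfl

@[simp] theorem Stmt.exec_ite (e : Expr) (b₁ b₂ : Stmt) :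
    (Stmt.ite e b₁ b₂).exec I s = if 0 < e.eval I s then b₁.exec I s else b₂.exec I s := rfl

@[simp] theorem Stmt.exec_skip : Stmt.skip.exec I s = s := rfl

/-- Whether a statement contains an assignment to the variable `z`. -/
def Stmt.writes (z : Var) : Stmt → Bool
  | skip => false
  | set x _ => decide (z = x)
  | put _ _ _ => false
  | seq b₁ b₂ => b₁.writes z || b₂.writes z
  | ite _ b₁ b₂ => b₁.writes z || b₂.writes z
  | loop x _ b => decide (z = x) || b.writes z

/-- Whether a statement contains an assignment to cells of the array `A`. -/
def Stmt.writesArr (A : Arr) : Stmt → Bool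
  | skip => false
  | set _ _ => false
  | put B _ _ => decide (A = B)
  | seq b₁ b₂ => b₁.writesArr A || b₂.writesArr A
  | ite _ b₁ b₂ => b₁.writesArr A || b₂.writesArr A
  | loop _ _ b => b.writesArr A

theorem iter_induction {α : Type*} {f : ℕ → α → α} {N : ℕ} {s : α} (P : ℕ → α → Prop) (h0 : P 0 s)
    (h : ∀ k < N, ∀ t, P k t → P (k + 1) (f k t)) : P N (iter f N s) := by
  have : ∀ k ≤ N, P k (iter f k s) := by
    intro k
    induction k with
    | zero => intro _; exact h0
    | succ k ih => intro hk; exact h k hk _ (ih (by omega))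
  exact this N le_rfl

/-- A frame rule. `Stmt.writes` is computed from the syntax, so for a concrete program the
hypothesis is proved by `rfl`. -/
theorem Stmt.var_exec {z : Var} (b : Stmt) :
    ∀ {s : State}, b.writes z = false → (b.exec I s).var z = s.var z := by
  induction b with
  | skip => intro s _; rfl
  | set x e => intro s h; simp [writes] at h; simp [h]
  | put A a e => intro s _; rfl
  | seq b₁ b₂ ih₁ ih₂ =>
    intro s h
    simp [writes] at h
    rw [exec_seq, ih₂ h.2, ih₁ h.1]
  | ite e b₁ b₂ ih₁ ih₂ =>
    intro s h
    simp [writes] at h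
    rw [exec_ite]
    split_ifs
    · exact ih₁ h.1
    · exact ih₂ h.2
  | loop x y b ih =>
    intro s h
    simp [writes] at h
    refine iter_induction (fun _ (t : State) => t.var z = s.var z) rfl ?_
    intro k _ t ht
    simp [ih h.2, h.1, ht]

theorem Stmt.arr_exec {A : Arr} (b : Stmt) :
    ∀ {s : State}, b.writesArr A = false → (b.exec I s).arr A = s.arr A := by
  induction b with
  | skip => intro s _; rfl
  | set x e => intro s _; rfl
  | put B a e =>
    intro s h
    simp [writesArr] at h
    ext i
    simp [h]
  | seq b₁ b₂ ih₁ ih₂ =>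
    intro s h
    simp [writesArr] at h
    rw [exec_seq, ih₂ h.2, ih₁ h.1]
  | ite e b₁ b₂ ih₁ ih₂ =>
    intro s h
    simp [writesArr] at h
    rw [exec_ite]
    split_ifs
    · exact ih₁ h.1
    · exact ih₂ h.2
  | loop x y b ih =>
    intro s h
    simp [writesArr] at h
    refine iter_induction (fun _ (t : State) => t.arr A = s.arr A) rfl ?_
    intro k _ t ht
    simp [ih h, ht]

/-- The rule for loops: an invariant may be used together with the fact that variables and arrays
to which the loop does not write have their initial values. -/
theorem Stmt.exec_loop {x y : Var} {b : Stmt} (P : ℕ → State → Prop) (N : ℕ) (hN : s.var y = N)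
    (h0 : P 0 s)
    (h : ∀ k < N, ∀ t, (∀ z, (loop x y b).writes z = false → t.var z = s.var z) →
      (∀ A, (loop x y b).writesArr A = false → t.arr A = s.arr A) →
      P k t → P (k + 1) (b.exec I (t.set x k))) :
    P N ((loop x y b).exec I s) := by
  have hN' : (s.var y).toNat = N := by simp [hN]
  rw [Stmt.exec, hN']
  refine (iter_induction (fun k (t : State) => (∀ z, (loop x y b).writes z = false → t.var z = s.var z) ∧
    (∀ A, (loop x y b).writesArr A = false → t.arr A = s.arr A) ∧ P k t)
    ⟨fun _ _ => rfl, fun _ _ => rfl, h0⟩ ?_).2.2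
  rintro k hk t ⟨hv, hA, hP⟩
  refine ⟨fun z hz => ?_, fun A hA' => ?_, h k hk t hv hA hP⟩
  · have hz' := hz
    simp [writes] at hz'
    rw [var_exec _ hz'.2, State.var_set, if_neg hz'.1, hv z hz]
  · rw [arr_exec b hA', State.arr_set, hA A hA']

end exec

/-! ### Running time bounds from the syntax. -/

/-- Whether all loops of the statement are bounded by variables from `L`, to which it does not
write. -/
def Stmt.bounded (L : List Var) : Stmt → Bool
  | skip => true
  | set x _ => decide (x ∉ L)
  | put _ _ _ => true
  | seq b₁ b₂ => b₁.bounded L && b₂.bounded L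
  | ite _ b₁ b₂ => b₁.bounded L && b₂.bounded L
  | loop x y b => decide (x ∉ L) && decide (y ∈ L) && b.bounded L

/-- A bound for the cost of a statement with fixed values of the variables that bound its loops. -/
def Stmt.bound (v : Var → ℤ) : Stmt → ℕ
  | skip => 0
  | set _ e => e.cost + 1
  | put _ a e => a.cost + e.cost + 10
  | seq b₁ b₂ => b₁.bound v + b₂.bound v
  | ite e b₁ b₂ => e.cost + 2 + b₁.bound v + b₂.bound v
  | loop _ y b => 5 + (v y).toNat * (6 + b.bound v)

theorem Stmt.writes_of_bounded {L : List Var} (b : Stmt) (h : b.bounded L = true) :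
    ∀ y ∈ L, b.writes y = false := by
  intro z hz
  induction b with
  | skip => rfl
  | set x e =>
    simp [bounded] at h
    simp [writes]
    rintro rfl
    exact h hz
  | put A a e => rfl
  | seq b₁ b₂ ih₁ ih₂ =>
    simp [bounded] at h
    simp [writes, ih₁ h.1, ih₂ h.2]
  | ite e b₁ b₂ ih₁ ih₂ =>
    simp [bounded] at h
    simp [writes, ih₁ h.1, ih₂ h.2]
  | loop x y b ih =>
    simp [bounded] at h
    simp [writes, ih h.2]
    rintro rfl
    exact h.1.1 hz

/-- The exact cost depends on the intermediate states only through branches and loop bounds. Both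
branches are charged, and the loop bounds never change because the variables in `L` are not written.
-/
theorem Stmt.cost_le_bound {I : List ℤ} {L : List Var} {v : Var → ℤ} (b : Stmt) :
    ∀ {s : State}, b.bounded L = true → (∀ y ∈ L, s.var y = v y) → b.cost I s ≤ b.bound v := by
  induction b with
  | skip => intro s _ _; exact le_rfl
  | set x e => intro s _ _; exact le_rfl
  | put A a e => intro s _ _; simp [cost, bound]; omega
  | seq b₁ b₂ ih₁ ih₂ =>
    intro s h hv
    simp [bounded] at h
    refine add_le_add (ih₁ h.1 hv) (ih₂ h.2 fun y hy => ?_)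
    rw [var_exec _ (writes_of_bounded b₁ h.1 y hy), hv y hy]
  | ite e b₁ b₂ ih₁ ih₂ =>
    intro s h hv
    simp [bounded] at h
    have h₁ := ih₁ h.1 hv
    have h₂ := ih₂ h.2 hv
    simp only [cost, bound]
    split_ifs <;> omega
  | loop x y b ih =>
    intro s h hv
    have hb : (loop x y b).bounded L = true := h
    simp [bounded] at h
    simp only [cost, bound]
    rw [← hv y h.1.2]
    refine Nat.add_le_add_left ?_ 5
    have key : ∀ k, ∀ z ∈ L, (iter (fun k s => b.exec I (s.set x k)) k s).var z = v z := by
      intro k z hz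
      refine iter_induction (fun _ (t : State) => t.var z = v z) (hv z hz) fun k _ t ht => ?_
      rw [var_exec _ (writes_of_bounded b h.2 z hz), State.var_set, if_neg, ht]
      rintro rfl
      exact h.1.1 hz
    refine (Finset.sum_le_card_nsmul _ _ (6 + b.bound v) fun k _ => ?_).trans (by simp)
    refine Nat.add_le_add_left (ih h.2 fun z hz => ?_) 6
    rw [State.var_set, if_neg, key k z hz]
    rintro rfl
    exact h.1.1 hz

/-! ### Complete programs: the base address of the arrays, and the output. -/

/-- The state in which a program starts. -/
def State.zero : State := ⟨fun _ => 0, fun _ _ => 0⟩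

/-- The program that computes the length of its input, which is `3 + n * n + n` or `3 + n * n` for
the number `n` in its first cell, executes a statement, and outputs the variable `ans`. -/
def program (withSet : Bool) (b : Stmt) : Program :=
  [.load 3 1, .const 0 3, .add 0 0 (if withSet then 3 else 1), .move 5 3, .jpos 5 6, .jump 10,
    .add 0 0 3, .const 7 1, .sub 5 5 7, .jump 4] ++ (b.code 10 0 ++ [.move 0 (2 * Var.ans.idx + 2)])

/-- The compiled code needs the length of the input in register `0`, but the input does not contain
it. The prologue obtains `n * n` by `n` additions; apart from register `0` it writes only odd
registers, so that all variables still have the value `0`. -/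
theorem decidesWithin_program {withSet : Bool} {b : Stmt} {I : List ℤ} {Q : Prop} {T n : ℕ}
    (hn : I.getD 0 0 = n) (hI : I.length = 3 + n * n + if withSet then n else 0)
    (hQ : (b.exec I State.zero).var .ans = by classical exact if Q then 1 else 0)
    (hT : 6 * n + 7 + b.cost I State.zero ≤ T) :
    DecidesWithin (program withSet b) I Q T := by
  set p := program withSet b with hp
  have hcode : CodeAt p 0 (program withSet b) := fun i _ => by simp [hp]
  rw [program, codeAt_append, codeAt_append] at hcode
  obtain ⟨hpro, hb, hend⟩ := hcode
  simp only [List.length_cons, List.length_nil, zero_add, Nat.reduceAdd] at hb hend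
  simp only [codeAt_cons, zero_add, Nat.reduceAdd] at hpro
  obtain ⟨h0, h1, h2, h3, h4, h5, h6, h7, h8, h9, -⟩ := hpro
  set e : ℕ := if withSet then n else 0 with he
  -- Register `3` holds `n`, register `5` counts down the additions that remain, and register `0`
  -- accumulates the length. Register `1` is still `0` when it is used as the summand for an absent
  -- indicator vector.
  have loop : ∀ k ≤ n, Reaches p (init I) (4 + 5 * k) (fun c => c.pc = 4 ∧
      c.reg 0 = 3 + e + k * n ∧ c.reg 3 = n ∧ c.reg 5 = n - k ∧ (∀ x, c.reg (2 * x + 2) = 0) ∧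
      c.mem = (init I).mem) := by
    intro k
    induction k with
    | zero =>
      intro _
      refine .step (i := .load 3 1) h0 (.step (i := .const 0 3) h1 (.step
        (i := .add 0 0 (if withSet then 3 else 1)) h2 (.step (i := .move 5 3) h3 (.done
        ⟨rfl, ?_, ?_, ?_, fun x => ?_, rfl⟩))))
      · cases withSet <;>
          simp [Instr.exec, init, he]
        · simpa using hn
      · simp [Instr.exec, init, Function.update_apply]
        simpa using hn
      · simp [Instr.exec, init, Function.update_apply]
        simpa using hn
      · have e3 : 2 * x + 2 ≠ 3 := by omega
        have e5 : 2 * x + 2 ≠ 5 := by omega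
        simp [Instr.exec, init, Function.update_apply, e3, e5]
    | succ k ih =>
      intro hk
      rw [mul_add, ← add_assoc]
      refine (ih (by omega)).bind (T' := 5 * 1) ?_
      rintro c ⟨hpc, hr0, hr3, hr5, hrx, hm⟩
      have hpos : 0 < c.reg 5 := by rw [hr5]; omega
      refine .step (i := .jpos 5 6) (by rw [hpc]; exact h4) (.step (i := .add 0 0 3) ?_ (.step
        (i := .const 7 1) ?_ (.step (i := .sub 5 5 7) ?_ (.step (i := .jump 4) ?_ (.done
        ⟨rfl, ?_, ?_, ?_, fun x => ?_, ?_⟩)))))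
      · simpa [Instr.exec, hpos] using h6
      · simpa [Instr.exec, hpos] using h7
      · simpa [Instr.exec, hpos] using h8
      · simpa [Instr.exec, hpos] using h9
      · simp [Instr.exec, hr0, hr3]; ring
      · simp [Instr.exec, hr3]
      · simp [Instr.exec, hr5]; ring
      · have e7 : 2 * x + 2 ≠ 7 := by omega
        have e5 : 2 * x + 2 ≠ 5 := by omega
        simp [Instr.exec, e7, e5, hrx]
      · simpa [Instr.exec] using hm
  have main : Reaches p (init I) (4 + 5 * n + (2 + (b.cost I State.zero + 1)))
      (fun c => Halted p c ∧ c.reg 0 = (b.exec I State.zero).var .ans) := by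
    refine (loop n le_rfl).bind ?_
    rintro c ⟨hpc, hr0, hr3, hr5, hrx, hm⟩
    rw [show ∀ z, 2 + z = z + 1 + 1 by intro z; ring]
    refine .step (i := .jpos 5 6) (by rw [hpc]; exact h4) (.step (i := .jump 10) ?_ ?_)
    · simpa [Instr.exec, hr5, hpc] using h5
    · refine (b.reaches_code (s := State.zero) (t := 0) hb ?_).bind ?_
      · refine ⟨?_, fun x => hrx _, fun a _ => ?_, fun A i => ?_⟩
        · simp only [Instr.exec, hr0, hI]
          push_cast; ring
        · simp [Instr.exec, hm, init]
        · simp only [Instr.exec, hm, init]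
          rw [List.getD_eq_default _ _ (by omega)]
          rfl
      rintro c' ⟨hs', hpc', -⟩
      simp only [Instr.exec] at hpc'
      rw [← hpc'] at hend
      refine .step (codeAt_cons.1 hend).1 (.done ⟨?_, ?_⟩)
      · simp only [Halted, Instr.exec, hp, program, List.length_append, List.length_cons,
          List.length_nil, hpc']
        omega
      · simp [Instr.exec, hs'.var]
  obtain ⟨t, ht, hh, hr⟩ := main
  exact ⟨t, by omega, hh, by rw [hr, hQ]⟩

end Prog

/-! ### Counting edges inside vertex sets, and graphs on `ℕ`. -/

namespace LoadColoring

open Finset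

section edges

variable {V : Type*} (G : SimpleGraph V)

/-- The number of edges with both ends in `P`. -/
noncomputable def edgesIn (P : Finset V) : ℕ := {e ∈ G.edgeSet | ∀ v ∈ e, v ∈ P}.ncard

theorem edgesIn_finite (P : Finset V) : {e ∈ G.edgeSet | ∀ v ∈ e, v ∈ P}.Finite := by
  classical
  refine Set.Finite.subset (P.sym2.finite_toSet) fun e he => ?_
  exact mem_coe.2 (Finset.mem_sym2_iff.2 he.2)

theorem edgesIn_mono {P Q : Finset V} (h : P ⊆ Q) : edgesIn G P ≤ edgesIn G Q :=
  Set.ncard_le_ncard (fun _ he => ⟨he.1, fun v hv => h (he.2 v hv)⟩) (edgesIn_finite G Q)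

@[simp] theorem edgesIn_empty : edgesIn G ∅ = 0 := by
  rw [edgesIn, Set.ncard_eq_zero (edgesIn_finite G ∅)]
  ext e
  induction e with
  | h u v =>
    simp only [Set.mem_ofPred_eq, Sym2.mem_iff, forall_eq_or_imp, notMem_empty, false_and, and_false,
      Set.mem_empty_iff_false]

-- The new edges are exactly the pairs `s(v, u)` with `u` a neighbor of `v` in `P`. Both the edge
-- counting program and the dynamic program rest on this recursion.
open Classical in
theorem edgesIn_insert [DecidableEq V] {P : Finset V} {v : V} (hv : v ∉ P) :
    edgesIn G (insert v P) = edgesIn G P + #{u ∈ P | G.Adj v u} := by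
  have hset : {e ∈ G.edgeSet | ∀ u ∈ e, u ∈ insert v P} =
      {e ∈ G.edgeSet | ∀ u ∈ e, u ∈ P} ∪
        (fun u => s(v, u)) '' (({u ∈ P | G.Adj v u} : Finset V) : Set V) := by
    ext e
    induction e with
    | h a b =>
      simp only [Set.mem_ofPred_eq, SimpleGraph.mem_edgeSet, Sym2.mem_iff, forall_eq_or_imp,
        forall_eq, mem_insert, Set.mem_union, Set.mem_image, coe_filter, Sym2.eq_iff]
      constructor
      · rintro ⟨hab, rfl | ha, rfl | hb⟩
        · exact absurd hab (G.irrefl)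
        · exact Or.inr ⟨b, ⟨hb, hab⟩, by simp⟩
        · exact Or.inr ⟨a, ⟨ha, hab.symm⟩, by simp⟩
        · exact Or.inl ⟨hab, ha, hb⟩
      · rintro (⟨hab, ha, hb⟩ | ⟨u, ⟨hu, hvu⟩, ⟨rfl, rfl⟩ | ⟨rfl, rfl⟩⟩)
        · exact ⟨hab, Or.inr ha, Or.inr hb⟩
        · exact ⟨hvu, Or.inl rfl, Or.inr hu⟩
        · exact ⟨hvu.symm, Or.inr hu, Or.inl rfl⟩
  rw [edgesIn, hset, Set.ncard_union_eq ?_ (edgesIn_finite G P) (Set.toFinite _),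
    Set.ncard_image_of_injective, Set.ncard_coe_finset, edgesIn]
  · intro a b hab
    exact Sym2.congr_right.1 hab
  · rw [Set.disjoint_left]
    rintro e he ⟨u, -, rfl⟩
    exact hv (he.2 v (by simp))

theorem edgesIn_map {W : Type*} (f : V ↪ W) (P : Finset V) :
    edgesIn (G.map f) (P.map f) = edgesIn G P := by
  have : {e ∈ (G.map f).edgeSet | ∀ v ∈ e, v ∈ P.map f} =
      Sym2.map f '' {e ∈ G.edgeSet | ∀ v ∈ e, v ∈ P} := by
    ext e
    induction e with
    | h a b =>
      simp only [Set.mem_ofPred_eq, SimpleGraph.mem_edgeSet, Sym2.mem_iff, forall_eq_or_imp,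
        forall_eq, Set.mem_image, SimpleGraph.map_adj]
      constructor
      · rintro ⟨⟨x, y, hxy, rfl, rfl⟩, hx, hy⟩
        refine ⟨s(x, y), ⟨hxy, ?_⟩, rfl⟩
        simpa using And.intro hx hy
      · rintro ⟨e, he, h⟩
        induction e with
        | h x y =>
          simp only [SimpleGraph.mem_edgeSet, Sym2.mem_iff, forall_eq_or_imp, forall_eq] at he
          rw [Sym2.map_mk, Sym2.eq_iff] at h
          rcases h with ⟨rfl, rfl⟩ | ⟨rfl, rfl⟩
          · exact ⟨⟨x, y, he.1, rfl, rfl⟩, by simpa using he.2⟩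
          · exact ⟨⟨y, x, he.1.symm, rfl, rfl⟩, by simpa using he.2.symm⟩
  rw [edgesIn, this, Set.ncard_image_of_injective _ (Sym2.map.injective f.injective), edgesIn]

end edges

/-- The copy on `{0, …, n - 1} ⊆ ℕ` of a graph on `Fin n`. -/
def natGraph {n : ℕ} (G : SimpleGraph (Fin n)) : SimpleGraph ℕ := G.map Fin.valEmbedding

theorem natGraph_adj {n : ℕ} {G : SimpleGraph (Fin n)} {u v : Fin n} :
    (natGraph G).Adj u v ↔ G.Adj u v :=
  SimpleGraph.map_adj_apply

theorem map_univ_val (n : ℕ) : (univ : Finset (Fin n)).map Fin.valEmbedding = range n := by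
  ext i
  simp only [mem_map, mem_univ, true_and, Fin.valEmbedding_apply, mem_range]
  exact ⟨fun ⟨a, ha⟩ => ha ▸ a.2, fun h => ⟨⟨i, h⟩, rfl⟩⟩

theorem ncard_edgeSet {n : ℕ} (G : SimpleGraph (Fin n)) :
    G.edgeSet.ncard = edgesIn (natGraph G) (range n) := by
  rw [← map_univ_val, natGraph, edgesIn_map, edgesIn]
  simp

/-- A coloring is determined by its red class `R`. Passing to subsets of `ℕ` lets program values
serve directly as vertices. -/
theorem hasLoadColoring_iff {n : ℕ} (G : SimpleGraph (Fin n)) (k₁ k₂ : ℤ) :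
    HasLoadColoring G k₁ k₂ ↔ ∃ R ⊆ range n, k₁ ≤ edgesIn (natGraph G) R ∧
      k₂ ≤ edgesIn (natGraph G) (range n \ R) := by
  classical
  have key : ∀ (f : Fin n → Color) (c : Color), monoEdges G f c =
      edgesIn (natGraph G) (({v | f v = c} : Finset (Fin n)).map Fin.valEmbedding) := by
    intro f c
    rw [natGraph, edgesIn_map, edgesIn, monoEdges]
    simp
  constructor
  · rintro ⟨f, h₁, h₂⟩
    rw [key] at h₁ h₂
    refine ⟨_, ?_, h₁, ?_⟩
    · rw [← map_univ_val]
      exact map_subset_map.2 (subset_univ _)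
    · convert h₂ using 3
      rw [← map_univ_val, ← Finset.map_sdiff]
      congr 1
      ext v
      cases h : f v <;> simp [h]
  · rintro ⟨R, hR, h₁, h₂⟩
    refine ⟨fun v => if (v : ℕ) ∈ R then .red else .blue, ?_, ?_⟩
    · rw [key]
      convert h₁ using 3
      ext v
      simp only [mem_map, mem_filter, mem_univ, true_and, ite_eq_left_iff, reduceCtorEq, imp_false,
        not_not, Fin.valEmbedding_apply]
      exact ⟨fun ⟨a, ha, hav⟩ => hav ▸ ha, fun h => ⟨⟨v, mem_range.1 (hR h)⟩, h, rfl⟩⟩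
    · rw [key]
      convert h₂ using 3
      ext v
      simp only [mem_map, mem_filter, mem_univ, true_and, ite_eq_right_iff, reduceCtorEq, imp_false,
        Fin.valEmbedding_apply, mem_sdiff, mem_range]
      exact ⟨fun ⟨a, ha, hav⟩ => hav ▸ ⟨a.2, ha⟩, fun h => ⟨⟨v, h.1⟩, h.2, rfl⟩⟩

/-! ### Threshold graphs: extremal vertices and alternating 4-cycles. -/

section peel

variable {V : Type*} (G : SimpleGraph V)

/-- The vertex `v` is isolated or universal in `G[S]`. -/
def Extremal (S : Finset V) (v : V) : Prop :=
  (∀ u ∈ S, ¬ G.Adj v u) ∨ (∀ u ∈ S, u ≠ v → G.Adj v u)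

/-- Every nonempty induced subgraph of `G[S]` has an isolated or universal vertex. -/
def Peelable (S : Finset V) : Prop :=
  ∀ T ⊆ S, T.Nonempty → ∃ v ∈ T, Extremal G T v

/-- The vertices `a, b, c, d` induce a `2K₂`, a `P₄` or a `C₄`: the edges `ab` and `cd` alternate
with the non-edges `ad` and `cb`. -/
def AlternatingCycle (a b c d : V) : Prop :=
  G.Adj a b ∧ G.Adj c d ∧ ¬ G.Adj a d ∧ ¬ G.Adj c b ∧ a ≠ d ∧ b ≠ c

variable {G}

/-- The vertex of `T` that was added last in the construction was isolated or universal among the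
vertices present at that time, which include `T`. -/
theorem Constructible.exists_extremal {S : Set V} (h : Constructible G S) :
    ∀ T : Finset V, (T : Set V) ⊆ S → T.Nonempty → ∃ v ∈ T, Extremal G T v := by
  have step : ∀ (S : Set V) (v : V),
      (∀ T : Finset V, (T : Set V) ⊆ S → T.Nonempty → ∃ v ∈ T, Extremal G T v) →
      ((∀ u ∈ S, ¬ G.Adj v u) ∨ (∀ u ∈ S, G.Adj v u)) →
      ∀ T : Finset V, (T : Set V) ⊆ insert v S → T.Nonempty → ∃ v ∈ T, Extremal G T v := by
    intro S v ih h T hT hne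
    by_cases hv : v ∈ T
    · refine ⟨v, hv, ?_⟩
      rcases h with h | h
      · refine Or.inl fun u hu => ?_
        rcases hT hu with rfl | hu
        · exact G.irrefl
        · exact h u hu
      · refine Or.inr fun u hu huv => ?_
        rcases hT hu with rfl | hu
        · exact absurd rfl huv
        · exact h u hu
    · refine ih T (fun u hu => ?_) hne
      rcases hT hu with rfl | hu
      · exact absurd hu hv
      · exact hu
  induction h with
  | single v =>
    rw [← insert_empty_eq]
    refine step ∅ v (fun T hT hne => ?_) (by simp)
    obtain ⟨u, hu⟩ := hne
    exact absurd (hT hu) (Set.notMem_empty u)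
  | isolated S v _ _ h ih => exact step S v ih (Or.inl h)
  | universal S v _ _ h ih => exact step S v ih (Or.inr h)

/-- Each of the four vertices has a neighbor and a non-neighbor among the other three, so `{a, b, c,
d}` has no extremal vertex. -/
theorem Peelable.not_alternatingCycle {S : Finset V} (h : Peelable G S) {a b c d : V} (ha : a ∈ S)
    (hb : b ∈ S) (hc : c ∈ S) (hd : d ∈ S) : ¬ AlternatingCycle G a b c d := by
  classical
  rintro ⟨hab, hcd, had, hcb, h₁, h₂⟩
  obtain ⟨v, hv, he⟩ := h {a, b, c, d} (by simp [insert_subset_iff, *]) (by simp)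
  simp only [mem_insert, mem_singleton] at hv
  have hda : ¬ G.Adj d a := fun h => had h.symm
  have hbc : ¬ G.Adj b c := fun h => hcb h.symm
  rcases he with he | he
  · rcases hv with rfl | rfl | rfl | rfl
    · exact he b (by simp) hab
    · exact he a (by simp) hab.symm
    · exact he d (by simp) hcd
    · exact he c (by simp) hcd.symm
  · rcases hv with rfl | rfl | rfl | rfl
    · exact had (he d (by simp) h₁.symm)
    · exact hbc (he c (by simp) h₂.symm)
    · exact hcb (he b (by simp) h₂)
    · exact hda (he a (by simp) h₁)

/-- Take `u` of maximum degree in `G[T]`. If `u` is not universal, any vertex `w` that it misses is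
isolated: a neighbor `b` of `w` would either have larger degree than `u` or miss some neighbor `a`
of `u`, and in the second case `u, a, b, w` is an alternating 4-cycle. -/
theorem peelable_of_forall_not_alternatingCycle {S : Finset V}
    (h : ∀ a ∈ S, ∀ b ∈ S, ∀ c ∈ S, ∀ d ∈ S, ¬ AlternatingCycle G a b c d) : Peelable G S := by
  classical
  intro T hT hne
  obtain ⟨u, hu, hmax⟩ := exists_max_image T (fun v => #{w ∈ T | G.Adj v w}) hne
  by_cases huniv : ∀ w ∈ T, w ≠ u → G.Adj u w
  · exact ⟨u, hu, Or.inr huniv⟩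
  push Not at huniv
  obtain ⟨w, hw, hwu, huw⟩ := huniv
  refine ⟨w, hw, Or.inl fun b hb hwb => ?_⟩
  -- The inclusion would be strict because of `w`, contradicting the maximality of the degree of
  -- `u`. Removing `b` and `u` lowers both degrees equally: by one if `u` and `b` are adjacent, by
  -- zero otherwise.
  have hne : ¬ (({x ∈ T | G.Adj u x}.erase b) ⊆ ({x ∈ T | G.Adj b x}.erase u)) := by
    intro hsub
    have hssub : {x ∈ T | G.Adj u x}.erase b ⊂ {x ∈ T | G.Adj b x}.erase u := by
      refine (ssubset_iff_of_subset hsub).2 ⟨w, ?_, ?_⟩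
      · simp [hw, hwu, hwb.symm]
      · simp [huw]
    have hlt := card_lt_card hssub
    have hle := hmax b hb
    by_cases hub : G.Adj u b
    · rw [card_erase_of_mem (by simp [hub, hb]), card_erase_of_mem (by simp [hub.symm, hu])] at hlt
      omega
    · have hbu : ¬ G.Adj b u := fun h => hub h.symm
      rw [erase_eq_of_notMem (by simp [hub]), erase_eq_of_notMem (by simp [hbu])] at hlt
      omega
  rw [not_subset] at hne
  obtain ⟨a, ha, ha'⟩ := hne
  simp only [mem_erase, mem_filter, ne_eq, not_and] at ha ha'
  obtain ⟨hab, haT, hua⟩ := ha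
  have hba := ha' (by rintro rfl; exact G.irrefl hua) haT
  refine h u (hT hu) a (hT haT) b (hT hb) w (hT hw) ⟨hua, hwb.symm, huw, hba, hwu.symm, hab⟩

end peel

/-- `Constructible.exists_extremal`, transported from the subtype of vertices outside `X` to `ℕ`. -/
theorem IsThresholdDeletionSet.peelable {n : ℕ} {G : SimpleGraph (Fin n)} {X : Finset (Fin n)}
    (h : IsThresholdDeletionSet G X) :
    Peelable (natGraph G) (range n \ X.map Fin.valEmbedding) := by
  classical
  intro T hT hne
  have hT' : ∀ v ∈ T, ∃ hv : v < n, (⟨v, hv⟩ : Fin n) ∉ X := by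
    intro v hv
    have := hT hv
    simp only [mem_sdiff, mem_range, mem_map, Fin.valEmbedding_apply, not_exists, not_and] at this
    exact ⟨this.1, fun hX => this.2 _ hX rfl⟩
  obtain ⟨v₀, hv₀⟩ := hne
  set T' : Finset {v | v ∉ X} := univ.filter fun v => ((v : Fin n) : ℕ) ∈ T with hT'def
  have lift : ∀ v ∈ T, ∃ w ∈ T', ((w : Fin n) : ℕ) = v := by
    intro v hv
    obtain ⟨hvn, hvX⟩ := hT' v hv
    exact ⟨⟨⟨v, hvn⟩, hvX⟩, by simp [hT'def, hv], rfl⟩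
  obtain ⟨w₀, hw₀, -⟩ := lift v₀ hv₀
  obtain ⟨w, hw, he⟩ := h.exists_extremal T' (by simp) ⟨w₀, hw₀⟩
  refine ⟨((w : Fin n) : ℕ), by simpa [hT'def] using hw, ?_⟩
  rcases he with he | he
  · refine Or.inl fun u hu => ?_
    obtain ⟨u', hu', rfl⟩ := lift u hu
    rw [natGraph_adj]
    exact he u' hu'
  · refine Or.inr fun u hu huv => ?_
    obtain ⟨u', hu', rfl⟩ := lift u hu
    rw [natGraph_adj]
    exact he u' hu' fun h => huv (by rw [h])

/-! ### The recursion of the dynamic program, independent of any implementation. -/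

section dynamicProgram

variable {V : Type*} [DecidableEq V] (G : SimpleGraph V)

/-- `G[S]` is constructed by adding the vertices `w 0, …, w (N - 1)` one after the other, where
`w i` is universal if `ty i` is true, and isolated otherwise. -/
structure IsConstruction (S : Finset V) (N : ℕ) (w : ℕ → V) (ty : ℕ → Prop) : Prop where
  ne : ∀ p < N, ∀ q < p, w q ≠ w p
  image : (range N).image w = S
  adj : ∀ p < N, ∀ q < p, G.Adj (w p) (w q) ↔ ty p

/-- The coloring of `Xr` in red and of `Xb` in blue extends to `w 0, …, w (i - 1)` with `j` of
these vertices, `e` edges red and `b` edges blue. -/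
def Reachable (Xr Xb : Finset V) (w : ℕ → V) (i j e b : ℕ) : Prop :=
  ∃ D ⊆ (range i).image w, #D = j ∧ edgesIn G (Xr ∪ D) = e ∧
    edgesIn G (Xb ∪ ((range i).image w \ D)) = b

variable {G} {Xr Xb : Finset V} {S : Finset V} {N : ℕ} {w : ℕ → V} {ty : ℕ → Prop}

theorem reachable_zero {j e b : ℕ} : Reachable G Xr Xb w 0 j e b ↔
    j = 0 ∧ e = edgesIn G Xr ∧ b = edgesIn G Xb := by
  constructor
  · rintro ⟨D, hD, hj, he, hb⟩
    simp only [range_zero, image_empty, subset_empty] at hD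
    subst hD
    simp at hj he hb
    exact ⟨hj.symm, he.symm, hb.symm⟩
  · rintro ⟨rfl, rfl, rfl⟩
    exact ⟨∅, by simp⟩

theorem Reachable.le {i j e b : ℕ} (h : Reachable G Xr Xb w i j e b) : j ≤ i := by
  obtain ⟨D, hD, rfl, -⟩ := h
  exact (card_le_card hD).trans (card_image_le.trans (by simp))

theorem IsConstruction.card_image (h : IsConstruction G S N w ty) {i : ℕ} (hi : i ≤ N) :
    #((range i).image w) = i := by
  rw [card_image_of_injOn, card_range]
  intro p hp q hq hpq
  simp only [coe_range, Set.mem_Iio] at hp hq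
  rcases lt_trichotomy p q with hlt | heq | hlt
  · exact absurd hpq (h.ne q (by omega) p hlt)
  · exact heq
  · exact absurd hpq.symm (h.ne p (by omega) q hlt)

-- Here the threshold structure enters: `w i` sees all or none of the earlier vertices, so of the
-- set `D` only its size matters.
open Classical in
theorem IsConstruction.card_neighbors (h : IsConstruction G S N w ty) {i : ℕ} (hi : i < N)
    {X D : Finset V} (hX : Disjoint X S) (hD : D ⊆ (range i).image w) :
    #{u ∈ X ∪ D | G.Adj (w i) u} = #{u ∈ X | G.Adj (w i) u} + if ty i then #D else 0 := by
  have hDS : D ⊆ S := hD.trans (h.image ▸ image_subset_image (range_mono hi.le))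
  rw [filter_union, card_union_of_disjoint
    (disjoint_filter_filter (disjoint_of_subset_right hDS hX))]
  congr 1
  have hadj : ∀ u ∈ D, (G.Adj (w i) u ↔ ty i) := by
    intro u hu
    obtain ⟨q, hq, rfl⟩ := mem_image.1 (hD hu)
    exact h.adj i hi q (mem_range.1 hq)
  rw [filter_congr hadj]
  split_ifs with ht <;> simp [ht]

-- The vertex `w i` is either blue, and then sees `i - j` earlier blue vertices if it is universal,
-- or red, and then sees the `j'` earlier red ones. Its neighbors in `X` contribute a number that is
-- fixed once `X` is colored.
open Classical in
theorem IsConstruction.reachable_succ (h : IsConstruction G S N w ty) (hr : Disjoint Xr S)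
    (hb : Disjoint Xb S) {i : ℕ} (hi : i < N) {j e b : ℕ} :
    Reachable G Xr Xb w (i + 1) j e b ↔
      (∃ b', Reachable G Xr Xb w i j e b' ∧
        b = b' + (#{u ∈ Xb | G.Adj (w i) u} + if ty i then i - j else 0)) ∨
      (∃ j' e', j = j' + 1 ∧ Reachable G Xr Xb w i j' e' b ∧
        e = e' + (#{u ∈ Xr | G.Adj (w i) u} + if ty i then j' else 0)) := by
  set W := (range i).image w with hW
  have hWS : insert (w i) W ⊆ S := by
    rw [← h.image, hW, ← image_insert, ← range_add_one]
    exact image_subset_image (range_mono hi)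
  have hwS : w i ∈ S := hWS (mem_insert_self _ _)
  have hwW : w i ∉ W := by
    rw [hW, mem_image]
    rintro ⟨q, hq, hqi⟩
    exact h.ne i hi q (mem_range.1 hq) hqi
  have hwr : w i ∉ Xr := fun h' => disjoint_left.1 hr h' hwS
  have hwb : w i ∉ Xb := fun h' => disjoint_left.1 hb h' hwS
  have hcW : #W = i := h.card_image hi.le
  have hW1 : (range (i + 1)).image w = insert (w i) W := by
    rw [range_add_one, image_insert]
  have blue : ∀ D ⊆ W, edgesIn G (Xb ∪ (insert (w i) W \ D)) = edgesIn G (Xb ∪ (W \ D)) +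
      (#{u ∈ Xb | G.Adj (w i) u} + if ty i then i - #D else 0) := by
    intro D hD
    rw [insert_sdiff_of_notMem _ (fun h' => hwW (hD h')), union_insert,
      edgesIn_insert G (by simp [hwb, hwW]), h.card_neighbors hi hb sdiff_subset,
      card_sdiff_of_subset hD, hcW]
  have red : ∀ D ⊆ W, edgesIn G (Xr ∪ insert (w i) D) = edgesIn G (Xr ∪ D) +
      (#{u ∈ Xr | G.Adj (w i) u} + if ty i then #D else 0) := by
    intro D hD
    rw [union_insert, edgesIn_insert G (by simp [hwr]; exact fun h' => hwW (hD h')),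
      h.card_neighbors hi hr hD]
  have same : ∀ D ⊆ W, insert (w i) W \ insert (w i) D = W \ D := by
    intro D _
    rw [insert_sdiff_insert, sdiff_insert_of_notMem hwW]
  rw [Reachable, hW1]
  constructor
  · rintro ⟨D, hD, rfl, rfl, rfl⟩
    by_cases hwD : w i ∈ D
    · right
      have hD' : D.erase (w i) ⊆ W := by
        rwa [← subset_insert_iff]
      refine ⟨#(D.erase (w i)), edgesIn G (Xr ∪ D.erase (w i)), ?_, ⟨_, hD', rfl, rfl, ?_⟩, ?_⟩
      · rw [card_erase_add_one hwD]
      · rw [← same _ hD', insert_erase hwD]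
      · rw [← red _ hD', insert_erase hwD]
    · left
      have hD' : D ⊆ W := by rwa [subset_insert_iff_of_notMem hwD] at hD
      exact ⟨_, ⟨D, hD', rfl, rfl, rfl⟩, blue D hD'⟩
  · rintro (⟨b', ⟨D, hD, rfl, rfl, rfl⟩, rfl⟩ | ⟨j', e', rfl, ⟨D, hD, rfl, rfl, rfl⟩, rfl⟩)
    · exact ⟨D, hD.trans (subset_insert _ _), rfl, rfl, blue D hD⟩
    · refine ⟨insert (w i) D, insert_subset_insert _ hD, ?_, red D hD, ?_⟩
      · rw [card_insert_of_notMem fun h' => hwW (hD h')]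
      · rw [same D hD]

/-- A red class `R` splits into its part `R ∩ X` in the deletion set and its part `R \ X` among the
constructed vertices. -/
theorem IsConstruction.exists_reachable_iff {n : ℕ} {H : SimpleGraph ℕ} {X : Finset ℕ}
    {w : ℕ → ℕ} (h : IsConstruction H (range n \ X) N w ty) (hX : X ⊆ range n) (k₁ k₂ : ℤ) :
    (∃ R ⊆ range n, k₁ ≤ edgesIn H R ∧ k₂ ≤ edgesIn H (range n \ R)) ↔
      ∃ Xr ⊆ X, ∃ j e b, Reachable H Xr (X \ Xr) w N j e b ∧ k₁ ≤ e ∧ k₂ ≤ b := by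
  constructor
  · rintro ⟨R, hR, h₁, h₂⟩
    refine ⟨R ∩ X, inter_subset_right, _, _, _, ⟨R \ X, ?_, rfl, rfl, rfl⟩, ?_, ?_⟩
    · rw [h.image]; exact sdiff_subset_sdiff hR le_rfl
    · convert h₁ using 3
      ext v; simp only [mem_union, mem_inter, mem_sdiff]; tauto
    · convert h₂ using 3
      rw [h.image]
      ext v
      have := @hX v
      simp only [mem_union, mem_inter, mem_sdiff]; tauto
  · rintro ⟨Xr, hXr, j, e, b, ⟨D, hD, rfl, rfl, rfl⟩, h₁, h₂⟩
    rw [h.image] at hD h₂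
    refine ⟨Xr ∪ D, union_subset (hXr.trans hX) (hD.trans sdiff_subset), h₁, ?_⟩
    convert h₂ using 3
    ext v
    have hv₁ := @hX v
    have hv₂ := @hD v
    have hv₃ := @hXr v
    simp only [mem_union, mem_sdiff] at hv₂ ⊢; tauto

end dynamicProgram

end LoadColoring

/-! ### The programs, and tools to specify them. -/

namespace Prog

open Finset LoadColoring

/-- An expression that is positive if and only if `a ≠ b`. -/
def Expr.ne (a b : Expr) : Expr := .pos (a - b) + .pos (b - a)

@[simp] theorem Expr.ne_pos {I : List ℤ} {s : State} {a b : Expr} :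
    0 < (Expr.ne a b).eval I s ↔ a.eval I s ≠ b.eval I s := by
  simp only [Expr.ne, eval_add, eval_sub, eval_pos]
  split_ifs <;> omega

/-- The statement `if e > 0 then s`. -/
def Stmt.when (e : Expr) (s : Stmt) : Stmt := .ite e s .skip

@[simp] theorem Stmt.exec_when {I : List ℤ} {s : State} (e : Expr) (b : Stmt) :
    (Stmt.when e b).exec I s = if 0 < e.eval I s then b.exec I s else s := by
  simp [Stmt.when]

section programs

open Var

/-- The entry of the adjacency matrix for the vertices `x` and `y`. -/
def adj (x y : Var) : Expr := .inp (.get .row x + y)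

/-- Add to `acc` the number of values of `z < y` for which `e` is positive. -/
def count (z y acc : Var) (e : Expr) : Stmt := .loop z y (.when e (.set acc (acc + 1)))

/-- Read the numbers in the input and compute where the rows of the matrix start. -/
def readInput : Stmt :=
  .set n (.inp 0) ;; .set k1 (.inp 1) ;; .set k2 (.inp 2) ;; .set n1 (n + 1) ;; .set t 3 ;;
  .loop u n (.put .row u t ;; .set t (t + n))

/-- Read the deletion set from the input. -/
def readSet : Stmt := .loop u n (.put .x u (.inp (t + u)))

/-- Put disjoint alternating 4-cycles into the deletion set as long as there are any. -/
def greedySet : Stmt :=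
  .loop a n (.loop b n (.loop c n (.loop d n (.when
    (.and (.and (.and (adj a b) (adj c d)) (.and (.not (adj a d)) (.not (adj c b))))
      (.and (.and (.ne a d) (.ne b c))
        (.and (.and (.not (.get .x a)) (.not (.get .x b)))
          (.and (.not (.get .x c)) (.not (.get .x d))))))
    (.put .x a 1 ;; .put .x b 1 ;; .put .x c 1 ;; .put .x d 1)))))

/-- Compute `2 ^ k` for the size `k` of the deletion set, and the set of the other vertices. -/
def splitVertices : Stmt :=
  .set pw 1 ;; .set rest 0 ;;
  .loop u n (.put .full u 1 ;; .ite (.get .x u) (.set pw (pw + pw) ;; .put .al u 0)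
    (.set rest (rest + 1) ;; .put .al u 1))

/-- Add to `acc` the number of edges within the set that is marked by `A`. -/
def countEdges (A : Arr) (acc : Var) : Stmt :=
  .loop v n (count u n acc (.and (.and (.lt u v) (.and (.get A u) (.get A v))) (adj v u)))

/-- Find the last vertex of a construction of a threshold graph, repeatedly. -/
def peel : Stmt :=
  .set cnt rest ;; .loop rnd n (.loop v n (.when (.get .al v)
    (.set d 0 ;; count u n d (.and (.get .al u) (adj v u)) ;;
      .ite (.and (.lt 0 d) (.lt (d + 1) cnt)) .skip
        (.set cnt (cnt - 1) ;; .put .ord cnt v ;; .put .typ cnt (.pos d) ;; .put .al v 0))))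

/-- Compute where the rows of the table start. -/
def tableRows : Stmt := .set t 0 ;; .loop j n1 (.put .tr j t ;; .set t (t + m))

/-- Compute the coloring of the deletion set that is encoded by `c`. -/
def decode : Stmt :=
  .set r c ;; .loop v n (.put .cr v 0 ;; .put .cb v 0 ;; .when (.get .x v)
    (.set r (r + r) ;; .ite (.le pw r) (.put .cr v 1 ;; .set r (r - pw)) (.put .cb v 1)))

/-- Fill the table `A`, where `body` computes the entry `val` in row `j` and column `e`. -/
def fill (A : Arr) (body : Stmt) : Stmt :=
  .loop j n1 (.loop e m (body ;; .put A (.get .tr j + e) val))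

/-- Compute an entry of the table after adding vertex number `i`. -/
def newEntry : Stmt :=
  .set rg ar ;; .set bg ab ;;
  .when (.get .typ i) (.set rg (rg + j - 1) ;; .set bg (bg + i - j)) ;;
  .set val (0 - 1) ;; .set w (.get .tab (.get .tr j + e)) ;;
  .when (.le 0 w) (.set val (w + bg)) ;;
  .when (.and (.lt 0 j) (.le rg e))
    (.set w (.get .tab (.get .tr (j - 1) + e - rg)) ;; .when (.lt val w) (.set val w))

/-- Initialize the table. -/
def initTable : Stmt :=
  .set er 0 ;; countEdges .cr er ;; .set eb 0 ;; countEdges .cb eb ;;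
  fill .tab (.set val (0 - 1)) ;; .put .tab er eb

/-- Update the table for vertex number `i`. -/
def updateTable : Stmt :=
  .set vi (.get .ord i) ;;
  .set ar 0 ;; count u n ar (.and (.get .cr u) (adj vi u)) ;;
  .set ab 0 ;; count u n ab (.and (.get .cb u) (adj vi u)) ;;
  fill .new newEntry ;; fill .tab (.set val (.get .new (.get .tr j + e)))

/-- Look for a sufficient entry of the table. -/
def checkTable : Stmt :=
  .loop j n1 (.loop e m (.set val (.get .tab (.get .tr j + e)) ;;
    .when (.and (.le k1 e) (.and (.le k2 val) (.le 0 val))) (.set ans 1)))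

/-- The part of the algorithm that precedes the dynamic program. -/
def prepare : Stmt :=
  splitVertices ;; .set m 1 ;; countEdges .full m ;; peel

/-- The dynamic program for all colorings of the deletion set. -/
def search : Stmt :=
  tableRows ;; .loop c pw (decode ;; initTable ;; .loop i rest updateTable ;; checkTable)

end programs

/-- The positive entries of `f` are those in `X`. -/
def Marks (f : ℕ → ℤ) (X : Finset ℕ) (n : ℕ) : Prop := ∀ u < n, 0 < f u ↔ u ∈ X

open Classical in
/-- The matrix entries of the graph `H` can be accessed in the state `s`. -/
structure Ready (I : List ℤ) (H : SimpleGraph ℕ) (n : ℕ) (s : State) : Prop where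
  inp : ∀ u < n, ∀ v < n, I.getD (3 + u * n + v) 0 = if H.Adj u v then 1 else 0
  size : s.var .n = n
  row : ∀ u < n, s.arr .row u = 3 + u * n

section specs

variable {I : List ℤ} {H : SimpleGraph ℕ} {n : ℕ} {s t : State}

theorem Ready.congr (h : Ready I H n s) (hn : t.var .n = s.var .n)
    (hr : t.arr .row = s.arr .row) : Ready I H n t :=
  ⟨h.inp, hn.trans h.size, by rw [hr]; exact h.row⟩

theorem Ready.adj_pos (h : Ready I H n s) {x y : Var} {a b : ℕ} (hx : s.var x = a)
    (hy : s.var y = b) (ha : a < n) (hb : b < n) : 0 < (adj x y).eval I s ↔ H.Adj a b := by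
  have : (adj x y).eval I s = I.getD (3 + a * n + b) 0 := by
    simp only [adj, Expr.eval_inp, Expr.eval_add, Expr.eval_get, Expr.eval_var, hx, hy,
      Int.toNat_natCast, h.row a ha]
    congr 1
  rw [this, h.inp a ha b hb]
  split_ifs with hab <;> simp [hab]

/-- The condition `e` is evaluated in the states that occur during the loop; these differ from `s`
only in the loop variable and the accumulator. -/
theorem var_count {z y acc : Var} {e : Expr} {N : ℕ} (hacc : acc ≠ z) (hN : s.var y = N)
    (P : ℕ → Prop) [DecidablePred P]
    (he : ∀ k < N, ∀ t : State, (∀ x, x ≠ z → x ≠ acc → t.var x = s.var x) → t.arr = s.arr →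
      t.var z = k → (0 < e.eval I t ↔ P k)) :
    ((count z y acc e).exec I s).var acc = s.var acc + #{k ∈ range N | P k} := by
  refine Stmt.exec_loop (fun k t => t.var acc = s.var acc + #{k ∈ range k | P k}) N hN (by simp) ?_
  intro k hk t hv hA ht
  have hiff := he k hk (t.set z k) (fun x hx hx' => by
      rw [State.var_set, if_neg hx]; exact hv x (by simp [Stmt.writes, Stmt.when, hx, hx'])) (funext fun A => hA A rfl) (by simp)
  rw [range_add_one, filter_insert]
  by_cases hp : P k
  · simp [hiff.2 hp, hp, hacc, ht, add_assoc]
  · simp [mt hiff.1 hp, hp, hacc, ht]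

end specs

end Prog

/-! ### Correctness of reading the input, counting edges and peeling. -/

namespace Prog

open Finset LoadColoring

variable {I : List ℤ} {H : SimpleGraph ℕ} {n : ℕ} {s t : State}

-- The starts of the matrix rows are running sums. The last sum, left in `t`, is the address `3 + n
-- * n` just behind the matrix, where `readSet` finds the indicator vector.
open Classical in
theorem exec_readInput (hn : I.getD 0 0 = n)
    (hI : ∀ u < n, ∀ v < n, I.getD (3 + u * n + v) 0 = if H.Adj u v then 1 else 0) :
    Ready I H n (readInput.exec I s) ∧ (readInput.exec I s).var .k1 = I.getD 1 0 ∧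
      (readInput.exec I s).var .k2 = I.getD 2 0 ∧ (readInput.exec I s).var .n1 = n + 1 ∧
      (readInput.exec I s).var .t = 3 + n * n := by
  have hn' : I.getD 0 0 = (n : ℤ) := hn
  simp only [readInput, Stmt.exec_seq]
  generalize hs₁ : Stmt.exec I (.set .t 3) _ = s₁
  have h1 : s₁.var .n = n := by subst hs₁; simpa using hn'
  have h2 : s₁.var .k1 = I.getD 1 0 := by subst hs₁; simp
  have h3 : s₁.var .k2 = I.getD 2 0 := by subst hs₁; simp
  have h4 : s₁.var .n1 = n + 1 := by subst hs₁; simpa using hn'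
  have h5 : s₁.var .t = 3 := by subst hs₁; simp
  have key := Stmt.exec_loop (I := I) (s := s₁) (x := .u) (y := .n)
    (b := .put .row (.var .u) (.var .t) ;; .set .t (.var .t + .var .n))
    (fun k t => t.var .t = 3 + k * n ∧ ∀ u < k, t.arr .row u = 3 + u * n) n h1
    (by simp [h5]) (by
      rintro k hk t hv - ⟨ht, hrow⟩
      have hn := hv .n rfl
      refine ⟨?_, fun u hu => ?_⟩
      · simp [ht, hn, h1]; ring
      · by_cases huk : u = k
        · simp [huk, ht]
        · simp [huk, hrow u (by omega)])
  refine ⟨⟨hI, ?_, key.2⟩, ?_, ?_, ?_, key.1⟩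
  · rw [Stmt.var_exec _ rfl, h1]
  · rw [Stmt.var_exec _ rfl, h2]
  · rw [Stmt.var_exec _ rfl, h3]
  · rw [Stmt.var_exec _ rfl, h4]

theorem marks_readSet {X : Finset ℕ} (hn : s.var .n = n) (ht : s.var .t = 3 + n * n)
    (hX : ∀ u < n, I.getD (3 + n * n + u) 0 = if u ∈ X then 1 else 0) :
    Marks ((readSet.exec I s).arr .x) X n := by
  refine Stmt.exec_loop (fun k t => ∀ u < k, 0 < t.arr .x u ↔ u ∈ X) n hn (by simp) ?_
  intro k hk t hv _ h u hu
  have hz : (Expr.inp (.var .t + .var .u)).eval I (t.set .u k) = if k ∈ X then 1 else 0 := by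
    rw [← hX k hk]
    simp only [Expr.eval_inp, Expr.eval_add, Expr.eval_var, State.var_set, reduceCtorEq, if_true,
      if_false, hv .t rfl, ht]
    congr 1
  rw [Stmt.exec_put, hz]
  by_cases huk : u = k
  · by_cases hk : k ∈ X <;> simp [huk, hk]
  · simp [huk, h u (by omega)]

theorem card_sdiff_range_succ (X : Finset ℕ) (k : ℕ) :
    #(range (k + 1) \ X) = #(range k \ X) + if k ∈ X then 0 else 1 := by
  rw [range_add_one]
  split_ifs with h
  · rw [insert_sdiff_of_mem _ h, add_zero]
  · rw [insert_sdiff_of_notMem _ h, card_insert_of_notMem (by simp)]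

theorem exec_splitVertices {X : Finset ℕ} (hn : s.var .n = n) (hX : X ⊆ range n)
    (hx : Marks (s.arr .x) X n) :
    (splitVertices.exec I s).var .pw = 2 ^ #X ∧
      (splitVertices.exec I s).var .rest = #(range n \ X) ∧
      Marks ((splitVertices.exec I s).arr .al) (range n \ X) n ∧
      Marks ((splitVertices.exec I s).arr .full) (range n) n := by
  simp only [splitVertices, Stmt.exec_seq]
  generalize hs₁ : Stmt.exec I (.set .rest 0) _ = s₁
  have h1 : s₁.var .n = n := by subst hs₁; simpa using hn
  have h2 : s₁.var .pw = 1 := by subst hs₁; simp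
  have h3 : s₁.var .rest = 0 := by subst hs₁; simp
  have h4 : s₁.arr .x = s.arr .x := by subst hs₁; simp
  have key := Stmt.exec_loop (I := I) (s := s₁) (x := .u) (y := .n)
    (b := .put .full (.var .u) 1 ;; .ite (.get .x (.var .u))
      (.set .pw (.var .pw + .var .pw) ;; .put .al (.var .u) 0)
      (.set .rest (.var .rest + 1) ;; .put .al (.var .u) 1))
    (fun k t => t.var .pw = 2 ^ #{u ∈ range k | u ∈ X} ∧ t.var .rest = #(range k \ X) ∧
      (∀ u < k, 0 < t.arr .al u ↔ u ∉ X) ∧ ∀ u < k, 0 < t.arr .full u) n h1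
    (by simp [h2, h3]) (by
      rintro k hk t - hA ⟨hpw, hrest, hal, hfull⟩
      have hxk : 0 < t.arr .x k ↔ k ∈ X := by rw [hA .x rfl, h4, hx k hk]
      rw [card_sdiff_range_succ, range_add_one, filter_insert]
      by_cases hk : k ∈ X
      · simp [hxk.2 hk, hk, hpw, hrest]
        refine ⟨by ring, fun u hu => ?_, fun u hu => ?_⟩
        · by_cases huk : u = k
          · simp [huk, hk]
          · simp [huk, hal u (by omega)]
        · by_cases huk : u = k
          · simp [huk]
          · simp [huk, hfull u (by omega)]
      · simp [mt hxk.1 hk, hk, hpw, hrest]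
        refine ⟨fun u hu => ?_, fun u hu => ?_⟩
        · by_cases huk : u = k
          · simp [huk, hk]
          · simp [huk, hal u (by omega)]
        · by_cases huk : u = k
          · simp [huk]
          · simp [huk, hfull u (by omega)])
  obtain ⟨k1, k2, k3, k4⟩ := key
  refine ⟨?_, k2, fun u hu => ?_, fun u hu => ?_⟩
  · rw [k1, filter_mem_eq_inter, inter_eq_right.2 hX]
  · rw [k3 u hu]; simp [hu]
  · simp [hu, k4 u hu]

/-- Round `k` of the outer loop counts the edges from `k` to smaller vertices of `P`, which is the
increment in `edgesIn_insert`. -/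
theorem var_countEdges {A : Arr} {acc : Var} {P : Finset ℕ} (hs : Ready I H n s)
    (hP : P ⊆ range n) (hA : Marks (s.arr A) P n) (hu : acc ≠ .u) (hv : acc ≠ .v) (hn : acc ≠ .n) :
    ((countEdges A acc).exec I s).var acc = s.var acc + edgesIn H P := by
  classical
  have key : ((countEdges A acc).exec I s).var acc =
      s.var acc + edgesIn H {u ∈ range n | u ∈ P} := by
    refine Stmt.exec_loop (fun k t => t.var acc = s.var acc + edgesIn H {u ∈ range k | u ∈ P}) n
      hs.size (by simp) ?_
    intro k hk t hvar harr ht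
    have hrdy : Ready I H n t := hs.congr
      (hvar .n (by simp [Stmt.writes, count, Stmt.when, hn.symm])) (harr _ rfl)
    rw [var_count hu (N := n) (by simp [hrdy.size])
      (fun u => u < k ∧ (u ∈ P ∧ k ∈ P) ∧ H.Adj k u), State.var_set, if_neg hv, ht]
    · rw [range_add_one, filter_insert]
      split_ifs with hkP
      · rw [edgesIn_insert _ (by simp), Nat.cast_add, add_assoc]
        congr 3
        refine congrArg card ?_
        ext u
        simp only [mem_filter, mem_range, hkP, and_true]
        exact ⟨fun h => ⟨⟨h.2.1, h.2.2.1⟩, h.2.2.2⟩, fun h => ⟨by omega, h.1.1, h.1.2, h.2⟩⟩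
      · simp [hkP]
    · intro u hu' t' ht' hta htu
      have hr' : Ready I H n t' := hrdy.congr
        (by rw [ht' .n (by simp) hn.symm]; simp) (by rw [hta]; rfl)
      have hv' : t'.var .v = k := by rw [ht' .v (by simp) hv.symm]; simp
      have hA' : t'.arr A = s.arr A := by rw [hta, State.arr_set, harr A rfl]
      rw [Expr.and_pos, Expr.and_pos, Expr.and_pos, hr'.adj_pos hv' htu hk hu']
      simp only [Expr.lt_pos, Expr.eval_var, htu, hv', Expr.eval_get, Int.toNat_natCast, hA',
        hA u hu', hA k hk, Nat.cast_lt, and_assoc]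
  rw [key, filter_mem_eq_inter, inter_eq_right.2 hP]

/-- The state of the peeling algorithm when the vertices of `Y \ S` have been removed. -/
structure Peeled (H : SimpleGraph ℕ) (n : ℕ) (Y S : Finset ℕ) (s : State) : Prop where
  sub : S ⊆ Y
  al : Marks (s.arr .al) S n
  cnt : s.var .cnt = #S
  ord : ∀ p, #S ≤ p → p < #Y → s.arr .ord p = (s.arr .ord p).toNat
  image : (Ico #S #Y).image (fun p => (s.arr .ord p).toNat) = Y \ S
  adj : ∀ p, #S ≤ p → p < #Y → ∀ u ∈ S, H.Adj (s.arr .ord p).toNat u ↔ 0 < s.arr .typ p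
  ne : ∀ p, p < #Y → ∀ q, #S ≤ q → q < p → (s.arr .ord q).toNat ≠ (s.arr .ord p).toNat
  adj_ord : ∀ p, p < #Y → ∀ q, #S ≤ q → q < p →
    (H.Adj (s.arr .ord p).toNat (s.arr .ord q).toNat ↔ 0 < s.arr .typ p)

theorem Peeled.congr {Y S : Finset ℕ} (h : Peeled H n Y S s) (hv : t.var .cnt = s.var .cnt)
    (ha : t.arr = s.arr) : Peeled H n Y S t := by
  obtain ⟨h1, h2, h3, h4, h5, h6, h7, h8⟩ := h
  constructor <;> (try rw [ha]) <;> (try rw [hv]) <;> assumption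

/-- The order is filled from its end, so `v` gets position `#S - 1`. All vertices placed later in
the peeling, which come earlier in the construction, lie in `S`, where `v` is extremal; hence one
entry of `typ` describes all adjacencies to them. -/
theorem Peeled.erase {Y S : Finset ℕ} {v : ℕ} {z : ℤ} (h : Peeled H n Y S s) (hv : v ∈ S)
    (hz : ∀ u ∈ S, u ≠ v → (H.Adj v u ↔ 0 < z)) (hcnt : t.var .cnt = #S - 1)
    (hal : ∀ u, t.arr .al u = if u = v then 0 else s.arr .al u)
    (hord : ∀ p, t.arr .ord p = if p = #S - 1 then (v : ℤ) else s.arr .ord p)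
    (htyp : ∀ p, t.arr .typ p = if p = #S - 1 then z else s.arr .typ p) :
    Peeled H n Y (S.erase v) t := by
  have hpos : 0 < #S := card_pos.2 ⟨v, hv⟩
  have hle : #S ≤ #Y := card_le_card h.sub
  have hcard : #(S.erase v) = #S - 1 := card_erase_of_mem hv
  have hmem : ∀ p, #S ≤ p → p < #Y → (s.arr .ord p).toNat ∈ Y \ S := by
    intro p hp hp'
    rw [← h.image]
    exact mem_image_of_mem _ (mem_Ico.2 ⟨hp, hp'⟩)
  have hnew : ∀ p, #S ≤ p → t.arr .ord p = s.arr .ord p ∧ t.arr .typ p = s.arr .typ p := by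
    intro p hp
    rw [hord, htyp, if_neg (by omega), if_neg (by omega)]
    exact ⟨rfl, rfl⟩
  have hlast : t.arr .ord (#S - 1) = v ∧ t.arr .typ (#S - 1) = z := by
    rw [hord, htyp, if_pos rfl, if_pos rfl]
    exact ⟨rfl, rfl⟩
  have hcases : ∀ p, #(S.erase v) ≤ p → p = #S - 1 ∨ #S ≤ p := by
    intro p hp; omega
  constructor
  · exact (erase_subset _ _).trans h.sub
  · intro u hu
    rw [hal]
    split_ifs with huv
    · simp [huv]
    · rw [h.al u hu]; simp [huv]
  · rw [hcnt, hcard]; omega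
  · intro p hp hp'
    rcases hcases p hp with rfl | hp
    · rw [hlast.1]; simp
    · rw [(hnew p hp).1]; exact h.ord p hp hp'
  · have hIco : Ico #(S.erase v) #Y = insert (#S - 1) (Ico #S #Y) := by
      ext p; simp only [mem_Ico, mem_insert]; omega
    rw [hIco, image_insert, hlast.1, Int.toNat_natCast]
    have : (Ico #S #Y).image (fun p => (t.arr .ord p).toNat) = Y \ S := by
      rw [← h.image]
      refine image_congr fun p hp => ?_
      simp only [(hnew p (mem_Ico.1 hp).1).1]
    rw [this, sdiff_erase (h.sub hv)]
  · intro p hp hp' u hu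
    rw [mem_erase] at hu
    rcases hcases p hp with rfl | hp
    · rw [hlast.1, hlast.2, Int.toNat_natCast]; exact hz u hu.2 hu.1
    · rw [(hnew p hp).1, (hnew p hp).2]; exact h.adj p hp hp' u hu.2
  · intro p hp q hq hqp
    rw [(hnew p (by omega)).1]
    rcases hcases q hq with rfl | hq
    · rw [hlast.1, Int.toNat_natCast]
      rintro rfl
      exact (mem_sdiff.1 (hmem p (by omega) hp)).2 hv
    · rw [(hnew q hq).1]; exact h.ne p hp q hq hqp
  · intro p hp q hq hqp
    rw [(hnew p (by omega)).1, (hnew p (by omega)).2]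
    rcases hcases q hq with rfl | hq
    · rw [hlast.1, Int.toNat_natCast]; exact h.adj p (by omega) hp v hv
    · rw [(hnew q hq).1]; exact h.adj_ord p hp q hq hqp

/-- A round that removes no vertex has tested every remaining vertex against the same set `S` and
found none extremal, which `Peelable` excludes unless `S` is empty. So each round makes progress and
`n` rounds suffice. -/
theorem exec_peel {Y : Finset ℕ} (hs : Ready I H n s) (hY : Y ⊆ range n) (hpeel : Peelable H Y)
    (hal : Marks (s.arr .al) Y n) (hrest : s.var .rest = #Y) :
    ∃ w : ℕ → ℕ, IsConstruction H Y #Y w (fun p => 0 < (peel.exec I s).arr .typ p) ∧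
      ∀ p < #Y, (peel.exec I s).arr .ord p = w p := by
  classical
  have hcardY : #Y ≤ n := by simpa using card_le_card hY
  suffices hfin : Peeled H n Y ∅ (peel.exec I s) by
    refine ⟨fun p => ((peel.exec I s).arr .ord p).toNat, ⟨?_, ?_, ?_⟩, ?_⟩
    · intro p hp q hq
      exact hfin.ne p hp q (by simp) hq
    · rw [range_eq_Ico]; simpa using hfin.image
    · intro p hp q hq
      exact hfin.adj_ord p hp q (by simp) hq
    · intro p hp
      exact hfin.ord p (by simp) hp
  simp only [peel, Stmt.exec_seq]
  generalize hs₁ : Stmt.exec I (.set .cnt (.var .rest)) s = s₁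
  have hr₁ : Ready I H n s₁ := by subst hs₁; exact hs.congr (by simp) rfl
  have h0 : Peeled H n Y Y s₁ := by
    subst hs₁
    refine ⟨Subset.rfl, by simpa using hal, by simpa using hrest, ?_, by simp, ?_, ?_, ?_⟩ <;>
      intros <;> omega
  have hrounds := Stmt.exec_loop (I := I) (s := s₁) (x := .rnd) (y := .n)
    (fun k t => ∃ S, Peeled H n Y S t ∧ (#S + k ≤ #Y ∨ S = ∅)) n hr₁.size ⟨Y, h0, by simp⟩ (b :=
      .loop .v .n (.when (.get .al (.var .v))
    (.set .d 0 ;; count .u .n .d (.and (.get .al (.var .u)) (Prog.adj .v .u)) ;;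
      .ite (.and (.lt 0 (.var .d)) (.lt (.var .d + 1) (.var .cnt))) .skip
        (.set .cnt (.var .cnt - 1) ;; .put .ord (.var .cnt) (.var .v) ;;
          .put .typ (.var .cnt) (.pos (.var .d)) ;; .put .al (.var .v) 0)))) (by
      rintro k hk t hv hA ⟨S₀, hS₀, hk'⟩
      have hrt : Ready I H n (t.set .rnd k) :=
        hr₁.congr (by simp [hv .n rfl]) (by rw [State.arr_set, hA .row rfl])
      have hS₀' : Peeled H n Y S₀ (t.set .rnd k) := hS₀.congr (by simp) rfl
      generalize t.set .rnd k = t' at hrt hS₀'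
      have := Stmt.exec_loop (I := I) (s := t') (x := .v) (y := .n) (b := .when (.get .al (.var .v))
        (.set .d 0 ;; count .u .n .d (.and (.get .al (.var .u)) (Prog.adj .v .u)) ;;
          .ite (.and (.lt 0 (.var .d)) (.lt (.var .d + 1) (.var .cnt))) .skip
            (.set .cnt (.var .cnt - 1) ;; .put .ord (.var .cnt) (.var .v) ;;
              .put .typ (.var .cnt) (.pos (.var .d)) ;; .put .al (.var .v) 0)))
        -- Within a round, either some vertex of the initial set `S₀` is already gone, or nothing
        -- has changed and the vertices tested so far are not extremal in `S₀`.
        (fun k t => ∃ S, Peeled H n Y S t ∧ (#S < #S₀ ∨ S = S₀ ∧ ∀ u < k, u ∈ S₀ →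
          ¬ Extremal H S₀ u)) n hrt.size ⟨S₀, hS₀', by simp⟩ (by
          rintro v hvn r hv hA ⟨S, hS, hdec⟩
          have hrr : Ready I H n (r.set .v v) :=
            hrt.congr (by simp [hv .n rfl]) (by rw [State.arr_set, hA .row rfl])
          have hSr : Peeled H n Y S (r.set .v v) := hS.congr (by simp) rfl
          have hvv : (r.set .v v).var .v = v := by simp
          generalize r.set .v v = r at hrr hSr hvv
          have halv := hSr.al v hvn
          rw [Stmt.exec_when, Expr.eval_get, Expr.eval_var, hvv, Int.toNat_natCast]
          by_cases hvS : v ∈ S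
          · rw [if_pos (halv.2 hvS)]
            simp only [Stmt.exec_seq, Stmt.exec_set]
            generalize hr₁ : r.set .d (Expr.eval I r 0) = r₁
            have hd := var_count (I := I) (s := r₁) (z := .u) (y := .n) (acc := .d) (N := n)
              (e := .and (.get .al (.var .u)) (Prog.adj .v .u)) (by simp)
              (by subst hr₁; simp [hrr.size]) (fun u => u ∈ S ∧ H.Adj v u) (by
                intro u hu q hq hqa hqu
                subst hr₁
                have hrq : Ready I H n q :=
                  hrr.congr (by rw [hq .n (by simp) (by simp)]; simp) (by rw [hqa]; rfl)
                rw [Expr.and_pos, hrq.adj_pos (a := v) (by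
                  rw [hq .v (by simp) (by simp)]; simpa using hvv) hqu hvn hu]
                simp [hqu, hqa, hSr.al u hu])
            have hd0 : r₁.var .d = 0 := by subst hr₁; simp
            have hSd : Peeled H n Y S ((count .u .n .d
                (.and (.get .al (.var .u)) (Prog.adj .v .u))).exec I r₁) := by
              refine hSr.congr ?_ ?_
              · rw [Stmt.var_exec _ rfl]; subst hr₁; simp
              · ext A
                rw [Stmt.arr_exec _ rfl]; subst hr₁; simp
            have hvd : ((count .u .n .d
                (.and (.get .al (.var .u)) (Prog.adj .v .u))).exec I r₁).var .v = v := by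
              rw [Stmt.var_exec _ rfl]; subst hr₁; simpa using hvv
            generalize (count .u .n .d
                (.and (.get .al (.var .u)) (Prog.adj .v .u))).exec I r₁ = r₂ at hd hSd hvd
            have hfilter : ({u ∈ range n | u ∈ S ∧ H.Adj v u} : Finset ℕ) = {u ∈ S | H.Adj v u} := by
              ext u
              simp only [mem_filter, mem_range]
              exact ⟨fun h => h.2, fun h => ⟨mem_range.1 (hY (hS.sub h.1)), h⟩⟩
            rw [hd0, zero_add, hfilter] at hd
            have hsubv : ({u ∈ S | H.Adj v u} : Finset ℕ) ⊆ S.erase v := by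
              intro u hu
              rw [mem_filter] at hu
              rw [mem_erase]
              exact ⟨fun h => H.irrefl (h ▸ hu.2), hu.1⟩
            have hcard1 : #(S.erase v) + 1 = #S := card_erase_add_one hvS
            rw [Stmt.exec_ite]
            by_cases hc : 0 < #{u ∈ S | H.Adj v u} ∧ #{u ∈ S | H.Adj v u} + 1 < #S
            · rw [if_pos (by simp [hd, hSd.cnt]; exact ⟨card_pos.1 hc.1, by exact_mod_cast hc.2⟩)]
              refine ⟨S, hSd, hdec.imp_right fun ⟨hSS, h⟩ => ⟨hSS, fun u hu huS => ?_⟩⟩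
              rcases (Nat.lt_succ_iff_lt_or_eq.1 hu) with hu | rfl
              · exact h u hu huS
              · subst hSS
                rintro (he | he)
                · rw [filter_eq_empty_iff.2 (fun {x} hx => he x hx)] at hc
                  simp at hc
                · have : S.erase u ⊆ ({x ∈ S | H.Adj u x} : Finset ℕ) := by
                    intro x hx
                    rw [mem_erase] at hx
                    exact mem_filter.2 ⟨hx.2, he x hx.2 hx.1⟩
                  have := card_le_card this
                  omega
            · rw [if_neg (by
                rw [Expr.and_pos, Expr.lt_pos, Expr.lt_pos]
                simp only [Expr.eval_zero, Expr.eval_var, Expr.eval_add, Expr.eval_one, hd, hSd.cnt]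
                exact_mod_cast hc)]
              -- The degree of `v` in `S` is `0` or `#S - 1`, and its sign tells which type `v` has.
              -- For `#S = 1` the two cases coincide and the type is irrelevant.
              refine ⟨S.erase v, hSd.erase (z := if 0 < #{u ∈ S | H.Adj v u} then 1 else 0)
                hvS ?_ ?_ ?_ ?_ ?_, Or.inl ?_⟩
              · intro u hu huv
                by_cases hpos : 0 < #{u ∈ S | H.Adj v u}
                · have heq : ({u ∈ S | H.Adj v u} : Finset ℕ) = S.erase v :=
                    eq_of_subset_of_card_le hsubv (by omega)
                  have : u ∈ ({u ∈ S | H.Adj v u} : Finset ℕ) := by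
                    rw [heq]; exact mem_erase.2 ⟨huv, hu⟩
                  simp [hpos, (mem_filter.1 this).2]
                · have heq : ({u ∈ S | H.Adj v u} : Finset ℕ) = ∅ := by
                    rw [← card_eq_zero]; omega
                  have := filter_eq_empty_iff.1 heq hu
                  simp [hpos, this]
              · simp [hSd.cnt]
              · intro u
                simp [hvd]
              · intro p
                have : ((#S : ℤ) - 1).toNat = #S - 1 := by omega
                simp [hSd.cnt, hvd, this]
              · intro p
                have : ((#S : ℤ) - 1).toNat = #S - 1 := by omega
                simp [hSd.cnt, hd, this]
              · rcases hdec with h | ⟨rfl, -⟩ <;> omega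
          · rw [if_neg (mt halv.1 hvS)]
            refine ⟨S, hSr, hdec.imp_right fun ⟨hSS, h⟩ => ⟨hSS, fun u hu huS => ?_⟩⟩
            rcases (Nat.lt_succ_iff_lt_or_eq.1 hu) with hu | rfl
            · exact h u hu huS
            · exact absurd (hSS ▸ huS) hvS)
      obtain ⟨S, hS, hdec⟩ := this
      refine ⟨S, hS, ?_⟩
      rcases hdec with hdec | ⟨rfl, hdec⟩
      · rcases hk' with hk' | rfl
        · left; omega
        · simp at hdec
      · right
        by_contra hne
        obtain ⟨v, hv, he⟩ := hpeel S hS.sub (nonempty_iff_ne_empty.2 hne)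
        exact hdec v (mem_range.1 (hY (hS.sub hv))) hv he)
  obtain ⟨S, hS, hdec⟩ := hrounds
  have : S = ∅ := by
    rcases hdec with hdec | hdec
    · rw [← card_eq_zero]; omega
    · exact hdec
  rwa [this] at hS

end Prog

/-! ### Decoding colorings of the deletion set, and tables. -/

namespace Prog

open Finset LoadColoring

variable {I : List ℤ} {H : SimpleGraph ℕ} {n : ℕ} {s t : State}

/-- The number that is left of `c` after reading the colors of the vertices of `X` below `v`. -/
def remainder (X : Finset ℕ) (K c : ℕ) : ℕ → ℕ
  | 0 => c
  | v + 1 => if v ∈ X then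
      (if K ≤ 2 * remainder X K c v then 2 * remainder X K c v - K else 2 * remainder X K c v)
    else remainder X K c v

/-- The red vertices of the coloring of `X` with number `c`. -/
def decoded (X : Finset ℕ) (c : ℕ) : Finset ℕ := {v ∈ X | 2 ^ #X ≤ 2 * remainder X (2 ^ #X) c v}

/-- Decoding reads the binary digits of `c` from the top: double the remainder, compare it with `2 ^
k`, and subtract if possible. After `a` digits the remainder can be any `2 ^ a * s` with `s < 2 ^ (k
- a)`, whatever digits have been prescribed so far. -/
theorem exists_decoded_eq {X : Finset ℕ} (hX : X ⊆ range n) {R : Finset ℕ} (hR : R ⊆ X) :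
    ∃ c < 2 ^ #X, decoded X c = R := by
  set k := #X with hk
  have key : ∀ v a : ℕ, #{u ∈ range v | u ∈ X} = a → ∀ s, s < 2 ^ (k - a) → ∃ c < 2 ^ k,
      remainder X (2 ^ k) c v = 2 ^ a * s ∧
        ∀ u < v, u ∈ X → (2 ^ k ≤ 2 * remainder X (2 ^ k) c u ↔ u ∈ R) := by
    intro v
    induction v with
    | zero =>
      rintro a rfl s hs
      exact ⟨s, by simpa using hs, by simp [remainder], by simp⟩
    | succ v ih =>
      intro a ha s hs
      rw [range_add_one, filter_insert] at ha
      by_cases hv : v ∈ X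
      · rw [if_pos hv, card_insert_of_notMem (by simp)] at ha
        set a' := #{u ∈ range v | u ∈ X} with ha'
        have hlt : a ≤ k := by
          rw [← ha, ha', ← card_insert_of_notMem (a := v) (by simp), hk]
          refine card_le_card fun u hu => ?_
          rcases mem_insert.1 hu with rfl | hu
          · exact hv
          · exact (mem_filter.1 hu).2
        have hpow : 2 ^ (k - a') = 2 * 2 ^ (k - a) := by
          rw [← pow_succ']; congr 1; omega
        have hpow' : 2 ^ k = 2 ^ a' * (2 * 2 ^ (k - a)) := by
          rw [← hpow, ← pow_add]; congr 1; omega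
        have hpowa : 2 ^ a = 2 * 2 ^ a' := by rw [← ha, pow_succ']
        have hapos : 0 < 2 ^ a' := by positivity
        -- The induction runs backwards through the digits: a target remainder after `v` comes from
        -- one before `v` whose leading digit is the desired color of `v`.
        obtain ⟨c, hc, hrem, hcol⟩ := ih a' rfl (s + if v ∈ R then 2 ^ (k - a) else 0) (by
          split_ifs <;> omega)
        have hiff : 2 ^ k ≤ 2 * remainder X (2 ^ k) c v ↔ v ∈ R := by
          rw [hrem, hpow', mul_left_comm 2, mul_le_mul_iff_right₀ hapos]
          split_ifs with hvR <;> simp only [hvR, iff_true, iff_false] <;> omega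
        refine ⟨c, hc, ?_, fun u hu huX => ?_⟩
        · rw [remainder, if_pos hv]
          by_cases hvR : v ∈ R
          · rw [if_pos (hiff.2 hvR), hrem, if_pos hvR, hpow', hpowa]
            have : 2 * (2 ^ a' * (s + 2 ^ (k - a))) =
              2 * 2 ^ a' * s + 2 ^ a' * (2 * 2 ^ (k - a)) := by ring
            omega
          · rw [if_neg (mt hiff.1 hvR), hrem, if_neg hvR, hpowa]
            ring
        · rcases Nat.lt_succ_iff_lt_or_eq.1 hu with hu | rfl
          · exact hcol u hu huX
          · exact hiff
      · rw [if_neg hv] at ha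
        obtain ⟨c, hc, hrem, hcol⟩ := ih a ha s hs
        refine ⟨c, hc, by rw [remainder, if_neg hv, hrem], fun u hu huX => ?_⟩
        rcases Nat.lt_succ_iff_lt_or_eq.1 hu with hu | rfl
        · exact hcol u hu huX
        · exact absurd huX hv
  obtain ⟨c, hc, -, hcol⟩ := key n k (by rw [filter_mem_eq_inter, inter_eq_right.2 hX]) 0
    (by positivity)
  refine ⟨c, hc, ?_⟩
  ext v
  rw [decoded, mem_filter]
  constructor
  · rintro ⟨hv, h⟩
    exact (hcol v (mem_range.1 (hX hv)) hv).1 h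
  · intro hv
    exact ⟨hR hv, (hcol v (mem_range.1 (hX (hR hv))) (hR hv)).2 hv⟩

theorem exec_decode {X : Finset ℕ} {c : ℕ} (hn : s.var .n = n) (hx : Marks (s.arr .x) X n)
    (hpw : s.var .pw = 2 ^ #X) (hc : s.var .c = c) :
    Marks ((decode.exec I s).arr .cr) (decoded X c) n ∧
      Marks ((decode.exec I s).arr .cb) (X \ decoded X c) n := by
  simp only [decode, Stmt.exec_seq]
  generalize hs₁ : Stmt.exec I (.set .r (.var .c)) s = s₁
  have h1 : s₁.var .n = n := by subst hs₁; simpa using hn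
  have h2 : s₁.var .pw = (2 ^ #X : ℕ) := by subst hs₁; simpa using hpw
  have h3 : s₁.var .r = c := by subst hs₁; simpa using hc
  have h4 : s₁.arr .x = s.arr .x := by subst hs₁; simp
  set K := 2 ^ #X with hK
  have key := Stmt.exec_loop (I := I) (s := s₁) (x := .v) (y := .n)
    (b := .put .cr (.var .v) 0 ;; .put .cb (.var .v) 0 ;; .when (.get .x (.var .v))
      (.set .r (.var .r + .var .r) ;; .ite (.le (.var .pw) (.var .r))
        (.put .cr (.var .v) 1 ;; .set .r (.var .r - .var .pw)) (.put .cb (.var .v) 1)))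
    (fun k t => t.var .r = remainder X K c k ∧
      (∀ u < k, 0 < t.arr .cr u ↔ u ∈ X ∧ K ≤ 2 * remainder X K c u) ∧
      ∀ u < k, 0 < t.arr .cb u ↔ u ∈ X ∧ ¬ K ≤ 2 * remainder X K c u) n h1
    (by simp [h3, remainder]) (by
      rintro k hk t hv hA ⟨hr, hcr, hcb⟩
      have hpw := hv .pw rfl
      rw [h2] at hpw
      have hxk : 0 < t.arr .x k ↔ k ∈ X := by rw [hA .x rfl, h4, hx k hk]
      rw [remainder]
      have hlt : ∀ u < k + 1, u = k ∨ (u < k ∧ u ≠ k) := by intro u hu; omega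
      by_cases hkX : k ∈ X
      · by_cases hle : K ≤ 2 * remainder X K c k
        · have hle' : (K : ℤ) ≤ remainder X K c k + remainder X K c k := by omega
          simp [hxk.2 hkX, hkX, hr, hpw, hle, hle']
          refine ⟨by ring, fun u hu => ?_, fun u hu => ?_⟩ <;>
          rcases hlt u (Nat.lt_succ_of_le hu) with rfl | ⟨hu, hne⟩
          · simp [hkX, hle]
          · simpa [hne] using hcr u hu
          · simp [hle]
          · simpa [hne] using hcb u hu
        · have hle' : ¬ (K : ℤ) ≤ remainder X K c k + remainder X K c k := by omega
          simp [hxk.2 hkX, hkX, hr, hpw, hle, hle']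
          refine ⟨by ring, fun u hu => ?_, fun u hu => ?_⟩ <;>
          rcases hlt u (Nat.lt_succ_of_le hu) with rfl | ⟨hu, hne⟩
          · simp [hle]
          · simpa [hne] using hcr u hu
          · simp [hkX]; omega
          · simpa [hne] using hcb u hu
      · simp [mt hxk.1 hkX, hkX, hr]
        refine ⟨fun u hu => ?_, fun u hu => ?_⟩ <;>
        rcases hlt u (Nat.lt_succ_of_le hu) with rfl | ⟨hu, hne⟩
        · simp [hkX]
        · simpa [hne] using hcr u hu
        · simp [hkX]
        · simpa [hne] using hcb u hu)
  refine ⟨fun u hu => ?_, fun u hu => ?_⟩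
  · rw [key.2.1 u hu, decoded, mem_filter]
  · rw [key.2.2 u hu, decoded, mem_sdiff, mem_filter]
    tauto

theorem exec_tableRows {M N : ℕ} (hm : s.var .m = M) (hn : s.var .n1 = N) :
    ∀ j < N, (tableRows.exec I s).arr .tr j = j * M := by
  simp only [tableRows, Stmt.exec_seq]
  generalize hs₁ : Stmt.exec I (.set .t 0) s = s₁
  have h1 : s₁.var .m = M := by subst hs₁; simpa using hm
  have h2 : s₁.var .n1 = N := by subst hs₁; simpa using hn
  have h3 : s₁.var .t = 0 := by subst hs₁; simp
  refine (Stmt.exec_loop (I := I) (s := s₁) (x := .j) (y := .n1)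
    (b := .put .tr (.var .j) (.var .t) ;; .set .t (.var .t + .var .m))
    (fun k t => t.var .t = k * M ∧ ∀ j < k, t.arr .tr j = j * M) N h2
    (by simp [h3]) ?_).2
  rintro k hk t hv - ⟨ht, htr⟩
  have hm := hv .m rfl
  refine ⟨?_, fun j hj => ?_⟩
  · simp [ht, hm, h1]; ring
  · by_cases hjk : j = k
    · simp [hjk, ht]
    · simp [hjk, htr j (by omega)]

theorem table_index_inj {M j e j' e' : ℕ} (he : e < M) (he' : e' < M)
    (h : j * M + e = j' * M + e') : j = j' ∧ e = e' := by
  have h1 : j = j' := by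
    rcases lt_trichotomy j j' with hlt | heq | hlt
    · nlinarith
    · exact heq
    · nlinarith
  subst h1
  exact ⟨rfl, by omega⟩

/-- The table with rows of length `M` in the array `f`. -/
def table (M : ℕ) (f : ℕ → ℤ) (j e : ℕ) : ℤ := f (j * M + e)

/-- The value `F j e` must be right whatever the current content of `A` is, as `A` is being
overwritten. This is why `updateTable` fills a second array and copies it back. -/
theorem exec_fill {A : Arr} {body : Stmt} {M N : ℕ} (F : ℕ → ℕ → ℤ) (hm : s.var .m = M)
    (hn : s.var .n1 = N) (htr : ∀ j < N, s.arr .tr j = j * M) (hA : A ≠ .tr)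
    (hbm : body.writes .m = false) (hbj : body.writes .j = false) (hbe : body.writes .e = false)
    (hbA : ∀ B, body.writesArr B = false)
    (hF : ∀ j < N, ∀ e < M, ∀ t : State, (∀ z, (fill A body).writes z = false → t.var z = s.var z) →
      (∀ B, B ≠ A → t.arr B = s.arr B) → t.var .j = j → t.var .e = e →
      (body.exec I t).var .val = F j e) :
    ∀ j < N, ∀ e < M, table M ((fill A body).exec I s |>.arr A) j e = F j e := by
  have hw : ∀ B, B ≠ A → (fill A body).writesArr B = false := by
    intro B hB
    simp [fill, Stmt.writesArr, hbA, hB]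
  refine Stmt.exec_loop (fun k t => ∀ j < k, ∀ e < M, table M (t.arr A) j e = F j e) N hn
    (by simp) ?_
  intro k hk t hv hAt hold
  have hwv : ∀ z, (fill A body).writes z = false →
      z ≠ .j ∧ z ≠ .e ∧ body.writes z = false := by
    intro z hz
    simp [fill, Stmt.writes] at hz
    exact hz
  have := Stmt.exec_loop (I := I) (s := t.set .j k) (x := .e) (y := .m)
    (b := body ;; .put A (.get .tr (.var .j) + .var .e) (.var .val))
    (fun l r => (∀ j < k, ∀ e < M, table M (r.arr A) j e = F j e) ∧
      ∀ e < l, table M (r.arr A) k e = F k e) M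
    (by simpa [hm] using hv .m (by simp [Stmt.writes, hbm])) ⟨hold, by simp⟩ (by
      rintro l hl r hrv hrA ⟨hr1, hr2⟩
      have hj : r.var .j = k := by rw [hrv .j (by simp [Stmt.writes, hbj])]; simp
      have hval := hF k hk l hl (r.set .e l) (fun z hz => by
          obtain ⟨h1, h2, h3⟩ := hwv z hz
          rw [State.var_set, if_neg h2, hrv z (by simp [Stmt.writes, h2, h3]), State.var_set,
            if_neg h1, hv z hz])
        (fun B hB => by
          rw [State.arr_set, hrA B (by simp [Stmt.writesArr, hbA, hB]), State.arr_set,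
            hAt B (hw B hB)])
        (by simpa using hj) (by simp)
      have hidx : ((Expr.get .tr (.var .j) + .var .e).eval I (body.exec I (r.set .e l))).toNat =
          k * M + l := by
        simp only [Expr.eval_add, Expr.eval_get, Expr.eval_var]
        rw [Stmt.arr_exec body (hbA _), Stmt.var_exec body hbj, Stmt.var_exec body hbe]
        simp only [State.arr_set, State.var_set, reduceCtorEq, if_true, if_false, hj,
          Int.toNat_natCast]
        rw [hrA .tr (by simp [Stmt.writesArr, hbA, hA.symm]), State.arr_set,
          hAt .tr (hw .tr hA.symm), htr k hk]
        exact Int.toNat_natCast (k * M + l)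
      have hentry : ∀ j, ∀ e < M, table M (((body ;; .put A (.get .tr (.var .j) + .var .e)
          (.var .val)).exec I (r.set .e l)).arr A) j e =
          if j = k ∧ e = l then F k l else table M (r.arr A) j e := by
        intro j e he
        rw [Stmt.exec_seq, Stmt.exec_put, hidx, Expr.eval_var, hval, table, State.arr_put]
        by_cases hje : j = k ∧ e = l
        · simp [hje.1, hje.2]
        · rw [if_neg, if_neg hje, Stmt.arr_exec body (hbA _), State.arr_set, table]
          rintro ⟨-, h⟩
          exact hje (table_index_inj he hl h)
      refine ⟨fun j hj e he => ?_, fun e he => ?_⟩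
      · rw [hentry j e he, if_neg (by omega), hr1 j hj e he]
      · rw [hentry k e (by omega)]
        split_ifs with h
        · rw [h.2]
        · exact hr2 e (by omega))
  intro j hj e he
  rcases Nat.lt_succ_iff_lt_or_eq.1 hj with hj | rfl
  · exact this.1 j hj e he
  · exact this.2 e he

/-- The entry of the table `T` in row `j` and column `e` is the maximal number of blue edges in a
coloring of the deletion set and of `i` other vertices with `j` of the latter and `e` edges red;
it is negative if there are none. -/
def IsTable (H : SimpleGraph ℕ) (Xr Xb : Finset ℕ) (w : ℕ → ℕ) (n M i : ℕ) (T : ℕ → ℕ → ℤ) : Prop :=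
  ∀ j ≤ n, ∀ e < M, (0 ≤ T j e → ∃ b : ℕ, Reachable H Xr Xb w i j e b ∧ T j e ≤ b) ∧
    ∀ b : ℕ, Reachable H Xr Xb w i j e b → (b : ℤ) ≤ T j e

/-- The entry of the table after adding a vertex, where `rg` and `bg` are the numbers of additional
edges if this vertex is red and blue, respectively. -/
def nextEntry (T : ℕ → ℕ → ℤ) (rg bg : ℤ) (j e : ℕ) : ℤ :=
  max (if 0 ≤ T j e then T j e + bg else -1)
    (if 0 < j ∧ rg ≤ e then T (j - 1) (e - rg).toNat else -1)

-- The two arguments of the maximum in `nextEntry` are the two cases of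
-- `IsConstruction.reachable_succ`. Keeping only the largest number of blue edges loses nothing,
-- since the increments do not depend on it.
open Classical in
theorem IsTable.succ {Y Xr Xb : Finset ℕ} {w : ℕ → ℕ} {ty : ℕ → Prop} {N M i : ℕ}
    {T T' : ℕ → ℕ → ℤ} (hT : IsTable H Xr Xb w n M i T) (h : IsConstruction H Y N w ty)
    (hr : Disjoint Xr Y) (hb : Disjoint Xb Y) (hi : i < N)
    (hT' : ∀ j ≤ n, ∀ e < M, T' j e = nextEntry T
      (#{u ∈ Xr | H.Adj (w i) u} + if ty i then (j : ℤ) - 1 else 0)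
      (#{u ∈ Xb | H.Adj (w i) u} + if ty i then (i : ℤ) - j else 0) j e) :
    IsTable H Xr Xb w n M (i + 1) T' := by
  intro j hj e he
  rw [hT' j hj e he, nextEntry]
  set ar := #{u ∈ Xr | H.Adj (w i) u} with har
  set ab := #{u ∈ Xb | H.Adj (w i) u} with hab
  have hsucc := fun b => h.reachable_succ hr hb hi (j := j) (e := e) (b := b)
  simp only [← har, ← hab] at hsucc
  constructor
  · intro hpos
    rcases max_choice (if 0 ≤ T j e then T j e + ((ab : ℤ) + if ty i then (i : ℤ) - j else 0) else -1)
      (if 0 < j ∧ (ar : ℤ) + (if ty i then (j : ℤ) - 1 else 0) ≤ e then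
        T (j - 1) ((e : ℤ) - ((ar : ℤ) + if ty i then (j : ℤ) - 1 else 0)).toNat else -1) with hm | hm
    · rw [hm] at hpos ⊢
      by_cases h0 : 0 ≤ T j e
      · rw [if_pos h0]
        obtain ⟨b, hb, hle⟩ := (hT j hj e he).1 h0
        refine ⟨_, (hsucc _).2 (Or.inl ⟨b, hb, rfl⟩), ?_⟩
        -- Reachability gives `j ≤ i`, so the truncated difference `i - j` of natural numbers agrees
        -- with the integer one that the program computes.
        have := hb.le
        split_ifs <;> push_cast [this] <;> omega
      · rw [if_neg h0] at hpos
        omega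
    · rw [hm] at hpos ⊢
      by_cases h0 : 0 < j ∧ (ar : ℤ) + (if ty i then (j : ℤ) - 1 else 0) ≤ e
      · rw [if_pos h0] at hpos ⊢
        obtain ⟨h1, h2⟩ := h0
        obtain ⟨b, hb, hle⟩ := (hT (j - 1) (by omega) _ (by split_ifs <;> omega)).1 hpos
        refine ⟨b, (hsucc _).2 (Or.inr ⟨j - 1, _, by omega, hb, ?_⟩), hle⟩
        split_ifs at h2 ⊢ <;> omega
      · rw [if_neg h0] at hpos
        omega
  · intro b hb
    rcases (hsucc b).1 hb with ⟨b', hb', rfl⟩ | ⟨j', e', rfl, hb', he'⟩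
    · have hle := (hT j hj e he).2 b' hb'
      have := hb'.le
      rw [if_pos (show 0 ≤ T j e by omega)]
      refine le_trans ?_ (le_max_left _ _)
      split_ifs <;> push_cast [this] <;> omega
    · have hle := (hT j' (by omega) e' (by omega)).2 b hb'
      refine le_trans ?_ (le_max_right _ _)
      rw [if_pos (by constructor <;> split_ifs at he' ⊢ <;> push_cast <;> omega)]
      have : ((e : ℤ) - ((ar : ℤ) + if ty i then ((j' + 1 : ℕ) : ℤ) - 1 else 0)).toNat = e' := by
        split_ifs at he' ⊢ <;> push_cast <;> omega
      rw [this]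
      simpa using hle

end Prog

/-! ### Correctness of the dynamic program. -/

namespace Prog

open Finset LoadColoring

variable {I : List ℤ} {H : SimpleGraph ℕ} {n : ℕ} {s t : State}

/-- In the blue case the program stores the sum without comparing it with `-1`, whereas `nextEntry`
takes a maximum; `hpos` reconciles the two. It holds in the application because a nonnegative entry
is reachable and thus has `j ≤ i`. -/
theorem var_newEntry {M N i j e : ℕ} (htr : ∀ j < N, s.arr .tr j = j * M) (hi : s.var .i = i)
    (hj : s.var .j = j) (he : s.var .e = e) (hjN : j < N)
    (hpos : 0 ≤ table M (s.arr .tab) j e → 0 ≤ table M (s.arr .tab) j e +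
      (s.var .ab + if 0 < s.arr .typ i then (i : ℤ) - j else 0)) :
    (newEntry.exec I s).var .val = nextEntry (table M (s.arr .tab))
      (s.var .ar + if 0 < s.arr .typ i then (j : ℤ) - 1 else 0)
      (s.var .ab + if 0 < s.arr .typ i then (i : ℤ) - j else 0) j e := by
  simp only [newEntry, Stmt.exec_seq]
  generalize hs₁ : Stmt.exec I (.when (.get .typ (.var .i)) _) _ = s₁
  have hrg : s₁.var .rg = s.var .ar + if 0 < s.arr .typ i then (j : ℤ) - 1 else 0 := by
    subst hs₁
    by_cases h : 0 < s.arr .typ i <;> simp [hi, hj, h]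
    ring
  have hbg : s₁.var .bg = s.var .ab + if 0 < s.arr .typ i then (i : ℤ) - j else 0 := by
    subst hs₁
    by_cases h : 0 < s.arr .typ i <;> simp [hi, hj, h]
    ring
  have hj₁ : s₁.var .j = j := by
    subst hs₁
    rw [Stmt.var_exec _ rfl]; simpa using hj
  have he₁ : s₁.var .e = e := by
    subst hs₁
    rw [Stmt.var_exec _ rfl]; simpa using he
  have hA : ∀ A, s₁.arr A = s.arr A := by
    intro A
    subst hs₁
    rw [Stmt.arr_exec _ rfl]; simp
  clear hs₁
  rw [← hbg] at hpos
  rw [← hrg, ← hbg]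
  have h1 : s₁.arr .tab (s₁.arr .tr j + e).toNat = table M (s.arr .tab) j e := by
    rw [hA, hA, htr j hjN, table]
    exact congrArg _ (Int.toNat_natCast (j * M + e))
  have h2 : 0 < j → s₁.var .rg ≤ e → s₁.arr .tab (s₁.arr .tr (j - 1) + e - s₁.var .rg).toNat =
      table M (s.arr .tab) (j - 1) (e - s₁.var .rg).toNat := by
    intro hj0 hle
    rw [hA, hA, htr (j - 1) (by omega), table]
    congr 1
    have : (((j - 1 : ℕ) : ℤ) * M) = (((j - 1) * M : ℕ) : ℤ) := by push_cast; rfl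
    rw [this]
    omega
  have h3 : ((j : ℤ) - 1).toNat = j - 1 := by omega
  rw [nextEntry, max_def]
  by_cases c1 : 0 ≤ table M (s.arr .tab) j e
  · by_cases c2 : 0 < j ∧ s₁.var .rg ≤ e
    · simp [hj₁, he₁, h1, h2 c2.1 c2.2, c1, c2, h3]
      split_ifs <;> simp <;> omega
    · have := hpos c1
      simp [hj₁, he₁, h1, c1, c2]
      omega
  · by_cases c2 : 0 < j ∧ s₁.var .rg ≤ e
    · simp [hj₁, he₁, h1, h2 c2.1 c2.2, c1, c2, h3]
      split_ifs <;> simp <;> omega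
    · simp [hj₁, he₁, h1, c1, c2]

/-- The variables and arrays that the dynamic program reads have the right values. -/
structure Setup (I : List ℤ) (H : SimpleGraph ℕ) (n M N : ℕ) (w : ℕ → ℕ) (ty : ℕ → Prop)
    (s : State) : Prop where
  ready : Ready I H n s
  m : s.var .m = M
  n1 : s.var .n1 = (n + 1 : ℕ)
  rest : s.var .rest = N
  tr : ∀ j < n + 1, s.arr .tr j = j * M
  ord : ∀ i < N, s.arr .ord i = w i
  typ : ∀ i < N, 0 < s.arr .typ i ↔ ty i

theorem Setup.congr {M N : ℕ} {w : ℕ → ℕ} {ty : ℕ → Prop} (h : Setup I H n M N w ty s)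
    (hv : ∀ z, z ∈ [Var.n, .m, .n1, .rest] → t.var z = s.var z)
    (hA : ∀ A, A ∈ [Arr.row, .tr, .ord, .typ] → t.arr A = s.arr A) : Setup I H n M N w ty t := by
  obtain ⟨h1, h2, h3, h4, h5, h6, h7⟩ := h
  refine ⟨h1.congr (hv _ (by simp)) (hA _ (by simp)), ?_, ?_, ?_, ?_, ?_, ?_⟩
  · rw [hv _ (by simp), h2]
  · rw [hv _ (by simp), h3]
  · rw [hv _ (by simp), h4]
  · rwa [hA _ (by simp)]
  · rwa [hA _ (by simp)]
  · rwa [hA _ (by simp)]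

theorem Setup.exec {M N : ℕ} {w : ℕ → ℕ} {ty : ℕ → Prop} (h : Setup I H n M N w ty s) (b : Stmt)
    (hv : [Var.n, .m, .n1, .rest].all (fun z => !b.writes z) = true)
    (hA : [Arr.row, .tr, .ord, .typ].all (fun A => !b.writesArr A) = true) :
    Setup I H n M N w ty (b.exec I s) := by
  refine h.congr (fun z hz => Stmt.var_exec b ?_) (fun A hz => Stmt.arr_exec b ?_)
  · simpa using List.all_eq_true.1 hv z hz
  · simpa using List.all_eq_true.1 hA A hz

/-- Before any vertex is added only row `0`, column `edgesIn H Xr` is reachable, and `hM` ensures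
that this column exists. -/
theorem isTable_initTable {M N : ℕ} {w : ℕ → ℕ} {ty : ℕ → Prop} {Xr Xb : Finset ℕ}
    (h : Setup I H n M N w ty s) (hr : Marks (s.arr .cr) Xr n) (hb : Marks (s.arr .cb) Xb n)
    (hrn : Xr ⊆ range n) (hbn : Xb ⊆ range n) (hM : edgesIn H Xr < M) :
    IsTable H Xr Xb w n M 0 (table M ((initTable.exec I s).arr .tab)) := by
  simp only [initTable, Stmt.exec_seq]
  generalize hs₁ : Stmt.exec I (countEdges .cb .eb) _ = s₁
  have h₁ : Setup I H n M N w ty s₁ := by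
    subst hs₁
    exact (((h.exec (.set .er 0) rfl rfl).exec (countEdges .cr .er) rfl rfl).exec
      (.set .eb 0) rfl rfl).exec (countEdges .cb .eb) rfl rfl
  have her : s₁.var .er = edgesIn H Xr := by
    subst hs₁
    rw [Stmt.var_exec _ rfl, Stmt.var_exec _ rfl, var_countEdges
      (h.exec (.set .er 0) rfl rfl).ready hrn hr (by simp) (by simp) (by simp)]
    simp
  have heb : s₁.var .eb = edgesIn H Xb := by
    subst hs₁
    rw [var_countEdges (((h.exec (.set .er 0) rfl rfl).exec (countEdges .cr .er) rfl rfl).exec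
      (.set .eb 0) rfl rfl).ready hbn ?_ (by simp) (by simp) (by simp)]
    · simp
    · rw [Stmt.arr_exec _ rfl, Stmt.arr_exec _ rfl, Stmt.arr_exec _ rfl]
      exact hb
  clear hs₁
  have hfill := exec_fill (I := I) (A := .tab) (body := .set .val (0 - 1)) (fun _ _ => -1) h₁.m h₁.n1
    h₁.tr (by simp) rfl rfl rfl (fun _ => rfl) (by intros; simp)
  have her₂ : ((fill .tab (.set .val (0 - 1))).exec I s₁).var .er = edgesIn H Xr := by
    rw [Stmt.var_exec _ rfl, her]
  have heb₂ : ((fill .tab (.set .val (0 - 1))).exec I s₁).var .eb = edgesIn H Xb := by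
    rw [Stmt.var_exec _ rfl, heb]
  generalize (fill .tab (.set .val (0 - 1))).exec I s₁ = s₂ at hfill her₂ heb₂
  have hentry : ∀ j ≤ n, ∀ e < M, table M ((Stmt.exec I (.put .tab (.var .er) (.var .eb)) s₂).arr .tab)
      j e = if j = 0 ∧ e = edgesIn H Xr then (edgesIn H Xb : ℤ) else -1 := by
    intro j hj e he
    rw [Stmt.exec_put, Expr.eval_var, Expr.eval_var, her₂, heb₂, Int.toNat_natCast, table,
      State.arr_put]
    by_cases hje : j = 0 ∧ e = edgesIn H Xr
    · simp [hje.1, hje.2]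
    · rw [if_neg, if_neg hje, ← hfill j (by omega) e he, table]
      rintro ⟨-, h⟩
      exact hje (table_index_inj (j' := 0) he hM (by simpa using h))
  intro j hj e he
  rw [hentry j hj e he]
  constructor
  · intro hpos
    by_cases hje : j = 0 ∧ e = edgesIn H Xr
    · exact ⟨edgesIn H Xb, reachable_zero.2 ⟨hje.1, hje.2, rfl⟩, by rw [if_pos hje]⟩
    · rw [if_neg hje] at hpos
      omega
  · intro b hb
    obtain ⟨h1, h2, rfl⟩ := reachable_zero.1 hb
    rw [if_pos ⟨h1, h2⟩]

theorem isTable_updateTable {M N i : ℕ} {w : ℕ → ℕ} {ty : ℕ → Prop} {Y Xr Xb : Finset ℕ}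
    (h : Setup I H n M N w ty s) (hr : Marks (s.arr .cr) Xr n) (hb : Marks (s.arr .cb) Xb n)
    (hrn : Xr ⊆ range n) (hbn : Xb ⊆ range n) (hY : Y ⊆ range n) (hrY : Disjoint Xr Y)
    (hbY : Disjoint Xb Y) (hc : IsConstruction H Y N w ty) (hi : s.var .i = i) (hiN : i < N)
    (hT : IsTable H Xr Xb w n M i (table M (s.arr .tab))) :
    IsTable H Xr Xb w n M (i + 1) (table M ((updateTable.exec I s).arr .tab)) := by
  classical
  have hwi : w i < n := by
    have : w i ∈ Y := by
      rw [← hc.image]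
      exact mem_image_of_mem _ (mem_range.2 hiN)
    exact mem_range.1 (hY this)
  have counts : ∀ (acc : Var) (A : Arr) (P : Finset ℕ) (r : State), P ⊆ range n →
      Marks (r.arr A) P n → acc ≠ .u → acc ≠ .n → acc ≠ .vi → Ready I H n r → r.var .vi = w i →
      r.var acc = 0 → ((count .u .n acc (.and (.get A (.var .u)) (adj .vi .u))).exec I r).var acc =
        #{u ∈ P | H.Adj (w i) u} := by
    intro acc A P r hP hA hu hn hvi hready hrvi hacc
    rw [var_count hu hready.size (fun u => u ∈ P ∧ H.Adj (w i) u), hacc, zero_add]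
    · congr 2
      ext u
      simp only [mem_filter, mem_range]
      exact ⟨fun h => h.2, fun h => ⟨mem_range.1 (hP h.1), h⟩⟩
    · intro u hun q hq hqa hqu
      have hrq : Ready I H n q :=
        hready.congr (hq .n (by simp) hn.symm) (by rw [hqa])
      rw [Expr.and_pos, hrq.adj_pos (a := w i) (by rw [hq .vi (by simp) hvi.symm, hrvi]) hqu hwi hun]
      simp [hqu, hqa, hA u hun]
  simp only [updateTable, Stmt.exec_seq]
  generalize hs₁ : Stmt.exec I (.set .ar 0) _ = s₁
  have h₁ : Setup I H n M N w ty s₁ := by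
    subst hs₁
    exact (h.exec (.set .vi _) rfl rfl).exec (.set .ar 0) rfl rfl
  have hvi₁ : s₁.var .vi = w i := by
    subst hs₁
    simp [hi, h.ord i hiN]
  have har₁ : s₁.var .ar = 0 := by subst hs₁; simp
  have hi₁ : s₁.var .i = i := by subst hs₁; simpa using hi
  have hA₁ : ∀ A, s₁.arr A = s.arr A := by intro A; subst hs₁; simp
  clear hs₁
  have har := counts .ar .cr Xr s₁ hrn (by rw [hA₁]; exact hr) (by simp) (by simp) (by simp)
    h₁.ready hvi₁ har₁
  generalize hs₂ : Stmt.exec I (.set .ab 0) _ = s₂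
  have h₂ : Setup I H n M N w ty s₂ := by
    subst hs₂
    exact (h₁.exec (count _ _ _ _) rfl rfl).exec (.set .ab 0) rfl rfl
  have hvi₂ : s₂.var .vi = w i := by
    subst hs₂
    rw [Stmt.var_exec _ rfl, Stmt.var_exec _ rfl, hvi₁]
  have har₂ : s₂.var .ar = #{u ∈ Xr | H.Adj (w i) u} := by
    subst hs₂
    rw [Stmt.var_exec _ rfl, har]
  have hab₂ : s₂.var .ab = 0 := by subst hs₂; simp
  have hi₂ : s₂.var .i = i := by subst hs₂; rw [Stmt.var_exec _ rfl, Stmt.var_exec _ rfl, hi₁]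
  have hA₂ : ∀ A, s₂.arr A = s.arr A := by
    intro A; subst hs₂; rw [Stmt.arr_exec _ rfl, Stmt.arr_exec _ rfl, hA₁]
  clear hs₂
  have hab := counts .ab .cb Xb s₂ hbn (by rw [hA₂]; exact hb) (by simp) (by simp) (by simp)
    h₂.ready hvi₂ hab₂
  generalize hs₃ : Stmt.exec I (count .u .n .ab _) s₂ = s₃
  rw [hs₃] at hab
  have h₃ : Setup I H n M N w ty s₃ := by
    subst hs₃
    exact h₂.exec (count _ _ _ _) rfl rfl
  have har₃ : s₃.var .ar = #{u ∈ Xr | H.Adj (w i) u} := by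
    subst hs₃
    rw [Stmt.var_exec _ rfl, har₂]
  have hi₃ : s₃.var .i = i := by subst hs₃; rw [Stmt.var_exec _ rfl, hi₂]
  have hA₃ : ∀ A, s₃.arr A = s.arr A := by
    intro A; subst hs₃; rw [Stmt.arr_exec _ rfl, hA₂]
  clear hs₃
  have hnew := exec_fill (I := I) (A := .new) (body := newEntry)
    (fun j e => nextEntry (table M (s.arr .tab))
      (#{u ∈ Xr | H.Adj (w i) u} + if ty i then (j : ℤ) - 1 else 0)
      (#{u ∈ Xb | H.Adj (w i) u} + if ty i then (i : ℤ) - j else 0) j e) h₃.m h₃.n1 h₃.tr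
    (by simp) rfl rfl rfl (fun _ => rfl) (by
      intro j hj e he t htv htA hje hee
      have ht := h.typ i hiN
      have hab' : t.var .ab = #{u ∈ Xb | H.Adj (w i) u} := by rw [htv .ab rfl, hab]
      have har' : t.var .ar = #{u ∈ Xr | H.Adj (w i) u} := by rw [htv .ar rfl, har₃]
      have htab : t.arr .tab = s.arr .tab := by rw [htA .tab (by simp), hA₃]
      have htyp : 0 < t.arr .typ i ↔ ty i := by rw [htA .typ (by simp), hA₃, ht]
      rw [var_newEntry (N := n + 1) (i := i) (by rw [htA .tr (by simp)]; exact h₃.tr)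
        (by rw [htv .i rfl, hi₃]) hje hee hj]
      · simp only [hab', har', htab, htyp]
      · simp only [hab', htab, htyp]
        intro h0
        obtain ⟨b, hb, -⟩ := (hT j (by omega) e he).1 h0
        have := hb.le
        split_ifs <;> omega)
  have h₄ := h₃.exec (fill .new newEntry) rfl rfl
  generalize (fill .new newEntry).exec I s₃ = s₄ at hnew h₄
  have hcopy := exec_fill (I := I) (A := .tab)
    (body := .set .val (.get .new (.get .tr (.var .j) + .var .e)))
    (table M (s₄.arr .new)) h₄.m h₄.n1 h₄.tr (by simp) rfl rfl rfl (fun _ => rfl) (by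
      intro j hj e he t htv htA hje hee
      simp only [Stmt.exec_set, State.var_set, if_true, Expr.eval_get, Expr.eval_add, Expr.eval_var,
        hje, hee, Int.toNat_natCast, htA .tr (by simp), htA .new (by simp), h₄.tr j hj, table]
      exact congrArg _ (Int.toNat_natCast (j * M + e)))
  exact hT.succ hc hrY hbY hiN fun j hj e he => by
    rw [hcopy j (by omega) e he, hnew j (by omega) e he]

-- The test `0 ≤ val` is not redundant: `k₂` may be negative, and then an unreachable entry would
-- pass the test against `k₂`.
open Classical in
theorem var_checkTable {M N : ℕ} {w : ℕ → ℕ} {ty : ℕ → Prop} (h : Setup I H n M N w ty s) :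
    (checkTable.exec I s).var .ans = if ∃ j ≤ n, ∃ e < M, s.var .k1 ≤ e ∧
      s.var .k2 ≤ table M (s.arr .tab) j e ∧ 0 ≤ table M (s.arr .tab) j e then 1
      else s.var .ans := by
  set Good : ℕ → ℕ → Prop := fun j e => s.var .k1 ≤ e ∧
    s.var .k2 ≤ table M (s.arr .tab) j e ∧ 0 ≤ table M (s.arr .tab) j e with hGood
  have key : (checkTable.exec I s).var .ans = if ∃ j < n + 1, ∃ e < M, Good j e then 1
      else s.var .ans := by
    refine Stmt.exec_loop (fun k t => t.var .ans = if ∃ j < k, ∃ e < M, Good j e then 1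
      else s.var .ans) (n + 1) h.n1 (by simp) ?_
    intro k hk t hv hA ht
    refine (Stmt.exec_loop (I := I) (s := t.set .j k) (x := .e) (y := .m)
      (fun l r => r.var .ans = if (∃ j < k, ∃ e < M, Good j e) ∨ ∃ e < l, Good k e then 1
        else s.var .ans) M (by simp [hv .m rfl, h.m]) (by simpa using ht) ?_).trans ?_
    · intro l hl r hrv hrA hr
      have hval : (Expr.get .tab (.get .tr (.var .j) + .var .e)).eval I (r.set .e l) =
          table M (s.arr .tab) k l := by
        have h1 : r.var .j = k := by rw [hrv .j rfl]; simp
        simp only [Expr.eval_get, Expr.eval_add, Expr.eval_var, State.var_set, State.arr_set, h1,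
          hrA _ rfl, hA _ rfl, Int.toNat_natCast, h.tr k hk, if_true, reduceCtorEq, if_false, table]
        exact congrArg _ (Int.toNat_natCast (k * M + l))
      have hk1 : r.var .k1 = s.var .k1 := by rw [hrv .k1 rfl]; simp [hv .k1 rfl]
      have hk2 : r.var .k2 = s.var .k2 := by rw [hrv .k2 rfl]; simp [hv .k2 rfl]
      rw [Stmt.exec_seq, Stmt.exec_set, hval]
      have hex : (∃ e < l + 1, Good k e) ↔ (∃ e < l, Good k e) ∨ Good k l := by
        constructor
        · rintro ⟨e, he, hg⟩
          rcases Nat.lt_succ_iff_lt_or_eq.1 he with he | rfl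
          · exact Or.inl ⟨e, he, hg⟩
          · exact Or.inr hg
        · rintro (⟨e, he, hg⟩ | hg)
          · exact ⟨e, by omega, hg⟩
          · exact ⟨l, by omega, hg⟩
      refine Eq.trans ?_ (if_congr ((or_congr Iff.rfl hex).trans or_assoc.symm) rfl rfl).symm
      by_cases hg : Good k l
      · have hg' := hg
        simp only [hGood] at hg'
        simp [hk1, hk2, hg', hg]
      · have hg' := hg
        simp only [hGood] at hg'
        rw [Stmt.exec_when, if_neg (by simpa [hk1, hk2] using hg')]
        simp [hr, hg]
    · have hex : (∃ j < k + 1, ∃ e < M, Good j e) ↔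
          (∃ j < k, ∃ e < M, Good j e) ∨ ∃ e < M, Good k e := by
        constructor
        · rintro ⟨j, hj, hg⟩
          rcases Nat.lt_succ_iff_lt_or_eq.1 hj with hj | rfl
          · exact Or.inl ⟨j, hj, hg⟩
          · exact Or.inr hg
        · rintro (⟨j, hj, hg⟩ | hg)
          · exact ⟨j, by omega, hg⟩
          · exact ⟨k, by omega, hg⟩
      exact (if_congr hex rfl rfl).symm
  rw [key]
  refine if_congr ?_ rfl rfl
  simp only [Nat.lt_succ_iff, hGood]

-- The loop over `c` covers every coloring of `X` by `exists_decoded_eq`, and for each of them the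
-- final table has a sufficient entry if and only if the coloring extends to a solution.
open Classical in
theorem var_search {M N : ℕ} {w : ℕ → ℕ} {ty : ℕ → Prop} {X Y : Finset ℕ} (hX : X ⊆ range n)
    (hs : Ready I H n s) (hm : s.var .m = M) (hn1 : s.var .n1 = (n + 1 : ℕ))
    (hrest : s.var .rest = N) (hpw : s.var .pw = 2 ^ #X) (hx : Marks (s.arr .x) X n)
    (hord : ∀ i < N, s.arr .ord i = w i) (htyp : ∀ i < N, 0 < s.arr .typ i ↔ ty i)
    (hY : Y = range n \ X) (hc : IsConstruction H Y N w ty) (hM : edgesIn H (range n) < M)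
    (hN : N ≤ n) (hans : s.var .ans = 0) :
    (search.exec I s).var .ans = if ∃ R ⊆ range n, s.var .k1 ≤ edgesIn H R ∧
      s.var .k2 ≤ edgesIn H (range n \ R) then 1 else 0 := by
  subst hY
  set Sol : Finset ℕ → Prop := fun Xr => ∃ j e b, Reachable H Xr (X \ Xr) w N j e b ∧
    s.var .k1 ≤ e ∧ s.var .k2 ≤ b with hSol
  have hdec : ∀ c, decoded X c ⊆ X := fun c => filter_subset _ _
  have hsol : (∃ Xr ⊆ X, Sol Xr) ↔ ∃ c < 2 ^ #X, Sol (decoded X c) := by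
    constructor
    · rintro ⟨Xr, hXr, h⟩
      obtain ⟨c, hc, rfl⟩ := exists_decoded_eq hX hXr
      exact ⟨c, hc, h⟩
    · rintro ⟨c, -, h⟩
      exact ⟨_, hdec c, h⟩
  refine Eq.trans ?_ (if_congr ((hc.exists_reachable_iff hX _ _).trans hsol) rfl rfl).symm
  simp only [search, Stmt.exec_seq]
  have h₁ : Setup I H n M N w ty (tableRows.exec I s) := by
    refine ⟨hs.congr (Stmt.var_exec _ rfl) (Stmt.arr_exec _ rfl), ?_, ?_, ?_,
      exec_tableRows hm hn1, ?_, ?_⟩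
    · rw [Stmt.var_exec _ rfl, hm]
    · rw [Stmt.var_exec _ rfl, hn1]
    · rw [Stmt.var_exec _ rfl, hrest]
    · rwa [Stmt.arr_exec _ rfl]
    · rwa [Stmt.arr_exec _ rfl]
  have hpw₁ : (tableRows.exec I s).var .pw = (2 ^ #X : ℕ) := by
    rw [Stmt.var_exec _ rfl, hpw]; simp
  have hx₁ : Marks ((tableRows.exec I s).arr .x) X n := by rwa [Stmt.arr_exec _ rfl]
  have hk₁ : (tableRows.exec I s).var .k1 = s.var .k1 ∧
      (tableRows.exec I s).var .k2 = s.var .k2 := ⟨Stmt.var_exec _ rfl, Stmt.var_exec _ rfl⟩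
  have ha₁ : (tableRows.exec I s).var .ans = 0 := by rw [Stmt.var_exec _ rfl, hans]
  generalize tableRows.exec I s = s₁ at h₁ hpw₁ hx₁ hk₁ ha₁
  refine Stmt.exec_loop (fun k t => t.var .ans = if ∃ c < k, Sol (decoded X c) then 1 else 0)
    (2 ^ #X) hpw₁ (by simpa using ha₁) ?_
  intro c hcX t hv hA ht
  set Xr := decoded X c with hXr
  have hXrX : Xr ⊆ X := hdec c
  have hrn : Xr ⊆ range n := hXrX.trans hX
  have hbn : X \ Xr ⊆ range n := sdiff_subset.trans hX
  have hrY : Disjoint Xr (range n \ X) := disjoint_of_subset_left hXrX disjoint_sdiff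
  have hbY : Disjoint (X \ Xr) (range n \ X) := disjoint_of_subset_left sdiff_subset disjoint_sdiff
  simp only [Stmt.exec_seq]
  have ht₁ : Setup I H n M N w ty (t.set .c c) := by
    refine h₁.congr (fun z hz => ?_) (fun A hz => ?_)
    · rw [State.var_set, if_neg (by rintro rfl; simp at hz), hv z]
      revert hz; revert z; decide
    · rw [State.arr_set, hA A]
      revert hz; revert A; decide
  obtain ⟨hcr, hcb⟩ := exec_decode (I := I) (s := t.set .c c) (X := X) (c := c) ht₁.ready.size
    (by rw [State.arr_set, hA .x rfl]; exact hx₁) (by simp [hv .pw rfl, hpw₁]) (by simp)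
  have hk1 : (t.set .c c).var .k1 = s.var .k1 := by simp [hv .k1 rfl, hk₁.1]
  have hk2 : (t.set .c c).var .k2 = s.var .k2 := by simp [hv .k2 rfl, hk₁.2]
  have hans : (t.set .c c).var .ans = t.var .ans := by simp
  generalize t.set .c c = t₁ at ht₁ hcr hcb hk1 hk2 hans
  have ht₂ := ht₁.exec (I := I) decode rfl rfl
  have hk1₂ : (decode.exec I t₁).var .k1 = s.var .k1 := by rw [Stmt.var_exec _ rfl, hk1]
  have hk2₂ : (decode.exec I t₁).var .k2 = s.var .k2 := by rw [Stmt.var_exec _ rfl, hk2]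
  have hans₂ : (decode.exec I t₁).var .ans = t.var .ans := by rw [Stmt.var_exec _ rfl, hans]
  generalize decode.exec I t₁ = t₂ at ht₂ hk1₂ hk2₂ hans₂ hcr hcb
  have htab₃ := isTable_initTable ht₂ hcr hcb hrn hbn ((edgesIn_mono H hrn).trans_lt hM)
  have ht₃ := ht₂.exec (I := I) initTable rfl rfl
  have hk1₃ : (initTable.exec I t₂).var .k1 = s.var .k1 := by rw [Stmt.var_exec _ rfl, hk1₂]
  have hk2₃ : (initTable.exec I t₂).var .k2 = s.var .k2 := by rw [Stmt.var_exec _ rfl, hk2₂]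
  have hans₃ : (initTable.exec I t₂).var .ans = t.var .ans := by rw [Stmt.var_exec _ rfl, hans₂]
  have hcr₃ : Marks ((initTable.exec I t₂).arr .cr) Xr n := by rwa [Stmt.arr_exec _ rfl]
  have hcb₃ : Marks ((initTable.exec I t₂).arr .cb) (X \ Xr) n := by rwa [Stmt.arr_exec _ rfl]
  generalize initTable.exec I t₂ = t₃ at ht₃ hk1₃ hk2₃ hans₃ hcr₃ hcb₃ htab₃
  have htab₄ := Stmt.exec_loop (I := I) (s := t₃) (x := .i) (y := .rest) (b := updateTable)
    (fun k r => IsTable H Xr (X \ Xr) w n M k (table M (r.arr .tab))) N ht₃.rest htab₃ (by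
      intro k hk r hrv hrA hr
      have hrs : Setup I H n M N w ty (r.set .i k) := by
        refine ht₃.congr (fun z hz => ?_) (fun A hz => ?_)
        · rw [State.var_set, if_neg (by rintro rfl; simp at hz), hrv z]
          revert hz; revert z; decide
        · rw [State.arr_set, hrA A]
          revert hz; revert A; decide
      exact isTable_updateTable hrs (by rw [State.arr_set, hrA .cr rfl]; exact hcr₃)
        (by rw [State.arr_set, hrA .cb rfl]; exact hcb₃) hrn hbn sdiff_subset hrY hbY hc (by simp) hk
        hr)
  have ht₄ := ht₃.exec (I := I) (.loop .i .rest updateTable) rfl rfl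
  have hk1₄ : ((Stmt.loop .i .rest updateTable).exec I t₃).var .k1 = s.var .k1 := by
    rw [Stmt.var_exec _ rfl, hk1₃]
  have hk2₄ : ((Stmt.loop .i .rest updateTable).exec I t₃).var .k2 = s.var .k2 := by
    rw [Stmt.var_exec _ rfl, hk2₃]
  have hans₄ : ((Stmt.loop .i .rest updateTable).exec I t₃).var .ans = t.var .ans := by
    rw [Stmt.var_exec _ rfl, hans₃]
  generalize (Stmt.loop .i .rest updateTable).exec I t₃ = t₄ at ht₄ hk1₄ hk2₄ hans₄ htab₄
  rw [var_checkTable ht₄, hk1₄, hk2₄, hans₄, ht]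
  have hgood : (∃ j ≤ n, ∃ e < M, s.var .k1 ≤ e ∧ s.var .k2 ≤ table M (t₄.arr .tab) j e ∧
      0 ≤ table M (t₄.arr .tab) j e) ↔ Sol Xr := by
    constructor
    · rintro ⟨j, hj, e, he, h1, h2, h3⟩
      obtain ⟨b, hb, hle⟩ := (htab₄ j hj e he).1 h3
      exact ⟨j, e, b, hb, h1, h2.trans hle⟩
    · rintro ⟨j, e, b, hb, h1, h2⟩
      have hj : j ≤ n := hb.le.trans hN
      -- No column is missing: the red edges are among all edges of the graph, whose number is less
      -- than `M`.
      have he : e < M := by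
        obtain ⟨D, hD, -, rfl, -⟩ := hb
        refine (edgesIn_mono H (union_subset hrn (hD.trans ?_))).trans_lt hM
        rw [hc.image]
        exact sdiff_subset
      have hle := (htab₄ j hj e he).2 b hb
      exact ⟨j, hj, e, he, h1, h2.trans hle, le_trans (Int.natCast_nonneg b) hle⟩
  have hex : (∃ c' < c + 1, Sol (decoded X c')) ↔ Sol Xr ∨ ∃ c' < c, Sol (decoded X c') := by
    constructor
    · rintro ⟨c', hc', hg⟩
      rcases Nat.lt_succ_iff_lt_or_eq.1 hc' with hc' | rfl
      · exact Or.inr ⟨c', hc', hg⟩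
      · exact Or.inl hg
    · rintro (hg | ⟨c', hc', hg⟩)
      · exact ⟨c, by omega, hg⟩
      · exact ⟨c', by omega, hg⟩
  rw [if_congr hgood rfl rfl, if_congr hex rfl rfl, ← ite_or]

end Prog

/-! ### The greedy deletion set, running times, and the combined algorithm. -/

namespace Prog

open Finset LoadColoring RAM

variable {I : List ℤ} {H : SimpleGraph ℕ} {n : ℕ} {s : State}

section greedy

/-- The marked set only grows, so a monotone property achieved in round `k` persists to the end.
Each of the four nested loops of `greedySet` is an instance. -/
theorem exec_loop_grow {x : Var} {b : Stmt} (Good : (ℕ → ℤ) → Finset ℕ → Prop)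
    (Q : ℕ → Finset ℕ → Prop) (hQ : ∀ k X X', X ⊆ X' → Q k X → Q k X') (hn : s.var .n = n)
    {X : Finset ℕ} (hX : Good (s.arr .x) X)
    (h : ∀ k < n, ∀ t : State, (∀ z, (Stmt.loop x .n b).writes z = false → t.var z = s.var z) →
      (∀ A, (Stmt.loop x .n b).writesArr A = false → t.arr A = s.arr A) → ∀ X,
      Good (t.arr .x) X → ∃ X', X ⊆ X' ∧ Good ((b.exec I (t.set x k)).arr .x) X' ∧ Q k X') :
    ∃ X', X ⊆ X' ∧ Good (((Stmt.loop x .n b).exec I s).arr .x) X' ∧ ∀ k < n, Q k X' := by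
  refine Stmt.exec_loop (fun k t => ∃ X', X ⊆ X' ∧ Good (t.arr .x) X' ∧ ∀ l < k, Q l X') n hn
    ⟨X, Subset.rfl, hX, by simp⟩ ?_
  rintro k hk t hv hA ⟨X₁, hX₁, hG₁, hQ₁⟩
  obtain ⟨X₂, hX₂, hG₂, hQ₂⟩ := h k hk t hv hA X₁ hG₁
  refine ⟨X₂, hX₁.trans hX₂, hG₂, fun l hl => ?_⟩
  rcases Nat.lt_succ_iff_lt_or_eq.1 hl with hl | rfl
  · exact hQ l _ _ hX₂ (hQ₁ l hl)
  · exact hQ₂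

/-- Each chosen cycle adds at most four vertices, at least one of them a new element of `X ∩ Z`,
because no alternating 4-cycle avoids `Z`. One pass over all quadruples suffices, as a quadruple
that has been hit stays hit. -/
theorem exec_greedySet {Z : Finset ℕ} (hs : Ready I H n s) (hx : Marks (s.arr .x) ∅ n)
    (hZ : Peelable H (range n \ Z)) : ∃ X ⊆ range n, Marks ((greedySet.exec I s).arr .x) X n ∧
      #X ≤ 4 * #Z ∧ Peelable H (range n \ X) := by
  set Good : (ℕ → ℤ) → Finset ℕ → Prop := fun f X => X ⊆ range n ∧ Marks f X n ∧
    #X ≤ 4 * #(X ∩ Z) with hGood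
  set Hit : ℕ → ℕ → ℕ → ℕ → Finset ℕ → Prop := fun a b c d X =>
    AlternatingCycle H a b c d → a ∈ X ∨ b ∈ X ∨ c ∈ X ∨ d ∈ X with hHit
  have mono : ∀ a b c d X X', X ⊆ X' → Hit a b c d X → Hit a b c d X' := by
    intro a b c d X X' h h' hA
    rcases h' hA with h' | h' | h' | h'
    · exact Or.inl (h h')
    · exact Or.inr (Or.inl (h h'))
    · exact Or.inr (Or.inr (Or.inl (h h')))
    · exact Or.inr (Or.inr (Or.inr (h h')))
  have main : ∃ X, ∅ ⊆ X ∧ Good ((greedySet.exec I s).arr .x) X ∧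
      ∀ a < n, ∀ b < n, ∀ c < n, ∀ d < n, Hit a b c d X := by
    refine exec_loop_grow Good (fun a X => ∀ b < n, ∀ c < n, ∀ d < n, Hit a b c d X)
      (fun a X X' h h' b hb c hc d hd => mono _ _ _ _ _ _ h (h' b hb c hc d hd)) hs.size
      ⟨empty_subset _, hx, by simp⟩ ?_
    intro a ha s₁ hv₁ hA₁ X₁ hX₁
    refine exec_loop_grow Good (fun b X => ∀ c < n, ∀ d < n, Hit a b c d X)
      (fun b X X' h h' c hc d hd => mono _ _ _ _ _ _ h (h' c hc d hd))
      (by simp [hv₁ .n rfl, hs.size]) hX₁ ?_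
    intro b hb s₂ hv₂ hA₂ X₂ hX₂
    refine exec_loop_grow Good (fun c X => ∀ d < n, Hit a b c d X)
      (fun c X X' h h' d hd => mono _ _ _ _ _ _ h (h' d hd))
      (by simp [hv₁ .n rfl, hv₂ .n rfl, hs.size]) hX₂ ?_
    intro c hc s₃ hv₃ hA₃ X₃ hX₃
    refine exec_loop_grow Good (fun d X => Hit a b c d X) (fun d X X' h h' => mono _ _ _ _ _ _ h h')
      (by simp [hv₁ .n rfl, hv₂ .n rfl, hv₃ .n rfl, hs.size]) hX₃ ?_
    intro d hd s₄ hv₄ hA₄ X₄ hX₄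
    have hr : Ready I H n (s₄.set .d d) := by
      refine hs.congr ?_ ?_
      · simp [hv₄ .n rfl, hv₃ .n rfl, hv₂ .n rfl, hv₁ .n rfl]
      · simp [hA₄ .row rfl, hA₃ .row rfl, hA₂ .row rfl, hA₁ .row rfl]
    have va : (s₄.set .d d).var .a = a := by simp [hv₄ .a rfl, hv₃ .a rfl, hv₂ .a rfl]
    have vb : (s₄.set .d d).var .b = b := by simp [hv₄ .b rfl, hv₃ .b rfl]
    have vc : (s₄.set .d d).var .c = c := by simp [hv₄ .c rfl]
    have vd : (s₄.set .d d).var .d = d := by simp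
    have hX₅ : Good ((s₄.set .d d).arr .x) X₄ := hX₄
    generalize s₄.set .d d = s₅ at hr va vb vc vd hX₅
    obtain ⟨hXn, hmark, hcard⟩ := hX₅
    rw [Stmt.exec_when]
    set e : Expr := .and (.and (.and (adj .a .b) (adj .c .d)) (.and (.not (adj .a .d))
      (.not (adj .c .b)))) (.and (.and (.ne (.var .a) (.var .d)) (.ne (.var .b) (.var .c)))
        (.and (.and (.not (.get .x (.var .a))) (.not (.get .x (.var .b))))
          (.and (.not (.get .x (.var .c))) (.not (.get .x (.var .d)))))) with he
    have hiff : 0 < e.eval I s₅ ↔ ((H.Adj a b ∧ H.Adj c d) ∧ ¬ H.Adj a d ∧ ¬ H.Adj c b) ∧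
        (a ≠ d ∧ b ≠ c) ∧ (a ∉ X₄ ∧ b ∉ X₄) ∧ c ∉ X₄ ∧ d ∉ X₄ := by
      simp only [he, Expr.and_pos, Expr.not_pos, Expr.ne_pos, hr.adj_pos va vb ha hb,
        hr.adj_pos vc vd hc hd, hr.adj_pos va vd ha hd, hr.adj_pos vc vb hc hb, Expr.eval_var,
        Expr.eval_get, va, vb, vc, vd, Int.toNat_natCast, hmark a ha, hmark b hb, hmark c hc,
        hmark d hd, ne_eq, Nat.cast_inj]
    by_cases hcond : ((H.Adj a b ∧ H.Adj c d) ∧ ¬ H.Adj a d ∧ ¬ H.Adj c b) ∧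
        (a ≠ d ∧ b ≠ c) ∧ (a ∉ X₄ ∧ b ∉ X₄) ∧ c ∉ X₄ ∧ d ∉ X₄
    · rw [if_pos (hiff.2 hcond)]
      obtain ⟨⟨⟨h1, h2⟩, h3, h4⟩, ⟨h5, h6⟩, ⟨ha', hb'⟩, hc', hd'⟩ := hcond
      have hQn : ({a, b, c, d} : Finset ℕ) ⊆ range n := by
        simp [insert_subset_iff, ha, hb, hc, hd]
      have hQX : Disjoint X₄ {a, b, c, d} := by
        simp [ha', hb', hc', hd']
      refine ⟨X₄ ∪ {a, b, c, d}, subset_union_left, ⟨union_subset hXn hQn, fun u hu => ?_, ?_⟩,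
        fun _ => by simp⟩
      · simp only [Stmt.exec_seq, Stmt.exec_put, Expr.eval_var, State.var_put, va, vb, vc, vd,
          Int.toNat_natCast, State.arr_put, Expr.eval_one, true_and, mem_union, mem_insert,
          mem_singleton]
        split_ifs <;> simp_all [hmark u hu]
      · have hhit : ({a, b, c, d} ∩ Z : Finset ℕ).Nonempty := by
          by_contra hne
          rw [not_nonempty_iff_eq_empty, ← disjoint_iff_inter_eq_empty] at hne
          have hsub : ({a, b, c, d} : Finset ℕ) ⊆ range n \ Z := by
            rw [subset_sdiff]; exact ⟨hQn, hne⟩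
          simp only [insert_subset_iff, singleton_subset_iff] at hsub
          exact hZ.not_alternatingCycle hsub.1 hsub.2.1 hsub.2.2.1 hsub.2.2.2
            ⟨h1, h2, h3, h4, h5, h6⟩
        have h4 : #({a, b, c, d} : Finset ℕ) ≤ 4 := card_le_four
        have hu := card_union_of_disjoint hQX
        have hi : #((X₄ ∪ {a, b, c, d}) ∩ Z) = #(X₄ ∩ Z) + #({a, b, c, d} ∩ Z) := by
          rw [union_inter_distrib_right, card_union_of_disjoint]
          exact disjoint_of_subset_left inter_subset_left
            (disjoint_of_subset_right inter_subset_left hQX)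
        have := card_pos.2 hhit
        omega
    · rw [if_neg (mt hiff.1 hcond)]
      refine ⟨X₄, Subset.rfl, ⟨hXn, hmark, hcard⟩, ?_⟩
      rintro ⟨h1, h2, h3, h4, h5, h6⟩
      by_contra hne
      simp only [not_or] at hne
      exact hcond ⟨⟨⟨h1, h2⟩, h3, h4⟩, ⟨h5, h6⟩, ⟨hne.1, hne.2.1⟩, hne.2.2.1, hne.2.2.2⟩
  obtain ⟨X, -, ⟨hXn, hmark, hcard⟩, hhit⟩ := main
  refine ⟨X, hXn, hmark, hcard.trans ?_, peelable_of_forall_not_alternatingCycle ?_⟩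
  · exact Nat.mul_le_mul_left 4 (card_le_card inter_subset_right)
  · intro a ha b hb c hc d hd hA
    simp only [mem_sdiff, mem_range] at ha hb hc hd
    rcases hhit a ha.1 b hb.1 c hc.1 d hd.1 hA with h | h | h | h
    · exact ha.2 h
    · exact hb.2 h
    · exact hc.2 h
    · exact hd.2 h

end greedy

section cost

@[simp] theorem Expr.cost_var (x : Var) : (Expr.var x).cost = 1 := rfl
@[simp] theorem Expr.cost_add (a b : Expr) : (a + b).cost = a.cost + (b.cost + 1) := rfl
@[simp] theorem Expr.cost_sub (a b : Expr) : (a - b).cost = a.cost + (b.cost + 1) := rfl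
@[simp] theorem Expr.cost_zero : (0 : Expr).cost = 1 := rfl
@[simp] theorem Expr.cost_one : (1 : Expr).cost = 1 := rfl
@[simp] theorem Expr.cost_ofNat (k : ℕ) [k.AtLeastTwo] : (ofNat(k) : Expr).cost = 1 := rfl
@[simp] theorem Expr.cost_pos (a : Expr) : (Expr.pos a).cost = a.cost + 3 := rfl
@[simp] theorem Expr.cost_get (A : Arr) (a : Expr) : (Expr.get A a).cost = a.cost + 10 := rfl
@[simp] theorem Expr.cost_inp (a : Expr) : (Expr.inp a).cost = a.cost + 6 := rfl

theorem cost_readInput (hn : I.getD 0 0 = n) : readInput.cost I s ≤ 60 + 40 * n := by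
  have h : readInput.cost I s ≤ 8 + _ := Nat.add_le_add_left
    (Stmt.cost_le_bound (I := I) (L := [.n]) (v := ((Stmt.set .n (.inp 0)).exec I s).var)
    _ rfl fun _ _ => rfl) 8
  refine h.trans ?_
  have hv : ((Stmt.set .n (.inp 0)).exec I s).var .n = n := by simpa using hn
  simp only [Stmt.bound, hv, Int.toNat_natCast, Expr.cost_var, Expr.cost_add, Expr.cost_inp,
    Expr.cost_one, Expr.cost_ofNat]
  omega

theorem cost_readSet (hn : s.var .n = n) : readSet.cost I s ≤ 5 + 40 * n := by
  refine (Stmt.cost_le_bound (L := [.n]) (v := s.var) _ rfl fun _ _ => rfl).trans ?_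
  simp only [readSet, Stmt.bound, hn, Int.toNat_natCast, Expr.cost_var, Expr.cost_add,
    Expr.cost_inp]
  omega

theorem cost_greedySet (hn : s.var .n = n) (hpos : 0 < n) :
    greedySet.cost I s ≤ 400 * n ^ 4 := by
  refine (Stmt.cost_le_bound (L := [.n]) (v := s.var) _ rfl fun _ _ => rfl).trans ?_
  simp only [greedySet, Stmt.when, adj, Expr.and, Expr.not, Expr.ne, Stmt.bound, hn,
    Int.toNat_natCast, Expr.cost_var, Expr.cost_add, Expr.cost_sub, Expr.cost_inp, Expr.cost_get,
    Expr.cost_pos, Expr.cost_one]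
  have h0 : 1 ≤ n ^ 4 := Nat.one_le_pow _ _ hpos
  have h1 : n ≤ n ^ 4 := Nat.le_self_pow (by norm_num) n
  have h2 : n ^ 2 ≤ n ^ 4 := Nat.pow_le_pow_right hpos (by norm_num)
  have h3 : n ^ 3 ≤ n ^ 4 := Nat.pow_le_pow_right hpos (by norm_num)
  ring_nf
  omega

theorem cost_prepare (hn : s.var .n = n) (hpos : 0 < n) : prepare.cost I s ≤ 400 * n ^ 3 := by
  refine (Stmt.cost_le_bound (L := [.n]) (v := s.var) _ rfl fun _ _ => rfl).trans ?_
  simp only [prepare, splitVertices, countEdges, peel, count, Stmt.when, adj, Expr.and, Expr.lt,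
    Stmt.bound, hn, Int.toNat_natCast, Expr.cost_var, Expr.cost_add, Expr.cost_sub, Expr.cost_inp,
    Expr.cost_get, Expr.cost_pos, Expr.cost_one, Expr.cost_zero]
  have h0 : 1 ≤ n ^ 3 := Nat.one_le_pow _ _ hpos
  have h1 : n ≤ n ^ 3 := Nat.le_self_pow (by norm_num) n
  have h2 : n ^ 2 ≤ n ^ 3 := Nat.pow_le_pow_right hpos (by norm_num)
  ring_nf
  omega

/-- The dominant part fills `(n + 1) * M` entries for each of `N ≤ n` vertices and `K` colorings.
Each monomial of the expanded bound is at most `K * n ^ 3 * M`, and 2000 exceeds the sum of the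
coefficients. -/
theorem cost_search {M N K : ℕ} (hn : s.var .n = n) (hn1 : s.var .n1 = (n + 1 : ℕ))
    (hm : s.var .m = M) (hrest : s.var .rest = N) (hpw : s.var .pw = K) (hpos : 0 < n)
    (hN : N ≤ n) (hM : 0 < M) (hK : 0 < K) :
    search.cost I s ≤ 2000 * (K * n ^ 3 * M) := by
  refine (Stmt.cost_le_bound (L := [.n, .n1, .m, .rest, .pw]) (v := s.var) _ rfl
    fun _ _ => rfl).trans ?_
  simp only [search, tableRows, decode, initTable, fill, updateTable, newEntry, checkTable,
    countEdges, count, Stmt.when, adj, Expr.and, Expr.lt, Expr.le, Stmt.bound, hn, hn1, hm, hrest,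
    hpw, Int.toNat_natCast, Expr.cost_var, Expr.cost_add, Expr.cost_sub, Expr.cost_inp,
    Expr.cost_get, Expr.cost_pos, Expr.cost_one, Expr.cost_zero]
  have key : ∀ x y z, x ≤ n ^ 3 → y ≤ K → z ≤ M → y * x * z ≤ K * n ^ 3 * M :=
    fun x y z hx hy hz => Nat.mul_le_mul (Nat.mul_le_mul hy hx) hz
  have h0 : 1 ≤ n ^ 3 := Nat.one_le_pow _ _ hpos
  have h1 : n ≤ n ^ 3 := Nat.le_self_pow (by norm_num) n
  have h2 : n ^ 2 ≤ n ^ 3 := Nat.pow_le_pow_right hpos (by norm_num)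
  have hN1 : N ≤ n ^ 3 := hN.trans h1
  have hN2 : n * N ≤ n ^ 3 := (Nat.mul_le_mul_left n hN).trans (by rw [← sq]; exact h2)
  have m1 := key 1 1 1 h0 hK hM
  have m2 := key n 1 1 h1 hK hM
  have m3 := key 1 K 1 h0 le_rfl hM
  have m4 := key n K 1 h1 le_rfl hM
  have m5 := key (n ^ 2) K 1 h2 le_rfl hM
  have m6 := key n K M h1 le_rfl le_rfl
  have m7 := key 1 K M h0 le_rfl le_rfl
  have m8 := key N K 1 hN1 le_rfl hM
  have m9 := key (n * N) K 1 hN2 le_rfl hM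
  have m10 := key N K M hN1 le_rfl le_rfl
  have m11 := key (n * N) K M hN2 le_rfl le_rfl
  nlinarith only [m1, m2, m3, m4, m5, m6, m7, m8, m9, m10, m11]

end cost

open Classical in
/-- The correctness and the running time of the algorithm after the deletion set is known. -/
theorem exec_prepare_search {X : Finset ℕ} (hs : Ready I H n s) (hpos : 0 < n) (hX : X ⊆ range n)
    (hx : Marks (s.arr .x) X n) (hp : Peelable H (range n \ X)) (hn1 : s.var .n1 = n + 1)
    (hans : s.var .ans = 0) :
    ((prepare ;; search).exec I s).var .ans = (if ∃ R ⊆ range n, s.var .k1 ≤ edgesIn H R ∧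
      s.var .k2 ≤ edgesIn H (range n \ R) then 1 else 0) ∧
    (prepare ;; search).cost I s ≤
      400 * n ^ 3 + 2000 * (2 ^ #X * n ^ 3 * (edgesIn H (range n) + 1)) := by
  set Y := range n \ X with hY
  have hYn : Y ⊆ range n := sdiff_subset
  have hcY : #Y ≤ n := by simpa using card_le_card hYn
  obtain ⟨hpw, hrest, hal, hfull⟩ := exec_splitVertices (I := I) hs.size hX hx
  have hprep : prepare.exec I s = peel.exec I ((countEdges .full .m).exec I
      ((Stmt.set .m 1).exec I (splitVertices.exec I s))) := rfl
  -- Counting starts at `1`, because the columns run from `0` to the number of edges inclusive.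
  have hm : ((countEdges .full .m).exec I ((Stmt.set .m 1).exec I
      (splitVertices.exec I s))).var .m = (edgesIn H (range n) + 1 : ℕ) := by
    rw [var_countEdges (P := range n) (n := n) (H := H) ?_ Subset.rfl ?_ (by simp) (by simp)
      (by simp)]
    · simp [add_comm]
    · exact hs.congr (by rw [Stmt.var_exec _ rfl, Stmt.var_exec _ rfl])
        (by rw [Stmt.arr_exec _ rfl, Stmt.arr_exec _ rfl])
    · rwa [Stmt.arr_exec _ rfl]
  obtain ⟨w, hc, hord⟩ := exec_peel (I := I) (H := H) (n := n) (Y := Y) (s := (countEdges .full .m).exec I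
    ((Stmt.set .m 1).exec I (splitVertices.exec I s)))
    (hs.congr (by rw [Stmt.var_exec _ rfl, Stmt.var_exec _ rfl, Stmt.var_exec _ rfl])
      (by rw [Stmt.arr_exec _ rfl, Stmt.arr_exec _ rfl, Stmt.arr_exec _ rfl])) hYn hp
    (by rw [Stmt.arr_exec _ rfl, Stmt.arr_exec _ rfl]; exact hal)
    (by rw [Stmt.var_exec _ rfl, Stmt.var_exec _ rfl]; exact hrest)
  rw [← hprep] at hc hord
  have hs' : Ready I H n (prepare.exec I s) :=
    hs.congr (Stmt.var_exec _ rfl) (Stmt.arr_exec _ rfl)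
  have hm' : (prepare.exec I s).var .m = (edgesIn H (range n) + 1 : ℕ) := by
    rw [hprep, Stmt.var_exec _ rfl, hm]
  have hrest' : (prepare.exec I s).var .rest = #Y := by
    rw [hprep, Stmt.var_exec _ rfl, Stmt.var_exec _ rfl, Stmt.var_exec _ rfl, hrest]
  have hpw' : (prepare.exec I s).var .pw = 2 ^ #X := by
    rw [hprep, Stmt.var_exec _ rfl, Stmt.var_exec _ rfl, Stmt.var_exec _ rfl, hpw]
  have hn1' : (prepare.exec I s).var .n1 = (n + 1 : ℕ) := by
    rw [Stmt.var_exec _ rfl, hn1]; simp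
  refine ⟨?_, ?_⟩
  · rw [Stmt.exec_seq, var_search hX hs' hm' hn1' hrest' hpw' (by rwa [Stmt.arr_exec _ rfl]) hord
      (fun _ _ => Iff.rfl) hY hc (by omega) hcY (by rw [Stmt.var_exec _ rfl, hans]),
      Stmt.var_exec (z := .k1) _ rfl, Stmt.var_exec (z := .k2) _ rfl]
  · refine add_le_add (cost_prepare hs.size hpos) (cost_search hs'.size hn1' hm' hrest'
      (by rw [hpw']; simp) hpos hcY (by omega) (by positivity))

end Prog

/-! ### The encodings, and the two parts of the theorem. -/

namespace LoadColoring

open Finset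

open Classical in
theorem getD_matrix {n : ℕ} (G : SimpleGraph (Fin n)) (x y z : ℤ) (l : List ℤ) {u v : ℕ}
    (hu : u < n) (hv : v < n) :
    ([x, y, z] ++ (List.ofFn (fun a : Fin (n * n) =>
      if G.Adj a.divNat a.modNat then (1 : ℤ) else 0) ++ l)).getD (3 + u * n + v) 0 =
      if (natGraph G).Adj u v then 1 else 0 := by
  have hlt : u * n + v < n * n := by nlinarith
  have hpos : 0 < n := by omega
  rw [List.getD_eq_getElem?_getD, show 3 + u * n + v = u * n + v + 3 by ring]
  simp only [List.cons_append, List.nil_append, List.getElem?_cons_succ]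
  rw [List.getElem?_append_left (by simpa using hlt), List.getElem?_ofFn, dif_pos hlt,
    Option.getD_some]
  have hdiv : (⟨u * n + v, hlt⟩ : Fin (n * n)).divNat = ⟨u, hu⟩ := by
    ext
    simp only [Fin.coe_divNat]
    rw [add_comm, Nat.add_mul_div_right _ _ hpos, Nat.div_eq_of_lt hv, zero_add]
  have hmod : (⟨u * n + v, hlt⟩ : Fin (n * n)).modNat = ⟨v, hv⟩ := by
    ext
    simp only [Fin.coe_modNat]
    rw [add_comm, Nat.add_mul_mod_self_right, Nat.mod_eq_of_lt hv]
  rw [hdiv, hmod]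
  exact if_congr (natGraph_adj (u := ⟨u, hu⟩) (v := ⟨v, hv⟩)).symm rfl rfl

open Classical in
theorem getD_encodeWithSet {n : ℕ} (G : SimpleGraph (Fin n)) (X : Finset (Fin n)) (k₁ k₂ : ℤ)
    {u : ℕ} (hu : u < n) : (encodeWithSet G X k₁ k₂).getD (3 + n * n + u) 0 =
      if u ∈ X.map Fin.valEmbedding then 1 else 0 := by
  have hlen : (encode G k₁ k₂).length = 3 + n * n := by simp [encode]; ring
  rw [encodeWithSet, List.getD_append_right _ _ _ _ (by omega), hlen, Nat.add_sub_cancel_left,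
    List.getD_eq_getElem?_getD, List.getElem?_ofFn, dif_pos hu, Option.getD_some]
  refine if_congr ?_ rfl rfl
  simp only [mem_map, Fin.valEmbedding_apply]
  exact ⟨fun h => ⟨_, h, rfl⟩, fun ⟨a, ha, hau⟩ => by subst hau; exact ha⟩

/-- Constructions start from one vertex, so the empty graph is not a threshold graph. -/
theorem IsThresholdDeletionSet.pos {n : ℕ} {G : SimpleGraph (Fin n)} {X : Finset (Fin n)}
    (h : IsThresholdDeletionSet G X) : 0 < n := by
  have hne : ∀ {V : Type} {G : SimpleGraph V} {S : Set V}, Constructible G S → S.Nonempty := by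
    intro V G S h
    cases h with
    | single v => exact Set.singleton_nonempty v
    | isolated S v _ _ _ => exact Set.insert_nonempty v S
    | universal S v _ _ _ => exact Set.insert_nonempty v S
  obtain ⟨v, -⟩ := hne h
  exact v.1.pos

/-- Deleting all vertices but one leaves a threshold graph, so the infimum is attained and is not
the default value `0` of an empty set. -/
theorem exists_isThresholdDeletionSet {n : ℕ} (hn : 0 < n) (G : SimpleGraph (Fin n)) :
    ∃ X : Finset (Fin n), IsThresholdDeletionSet G X ∧ #X = distToThreshold G := by
  refine Nat.sInf_mem (s := {k | ∃ X : Finset (Fin n), IsThresholdDeletionSet G X ∧ #X = k})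
    ⟨_, {⟨0, hn⟩}ᶜ, ?_, rfl⟩
  have huniv : (Set.univ : Set {v : Fin n | v ∉ ({⟨0, hn⟩}ᶜ : Finset (Fin n))}) =
      {⟨⟨0, hn⟩, by simp⟩} := by
    ext ⟨v, hv⟩
    simpa using hv
  rw [IsThresholdDeletionSet, IsThreshold, huniv]
  exact Constructible.single _

theorem edgesIn_range_le {n : ℕ} (H : SimpleGraph ℕ) : edgesIn H (range n) ≤ n ^ 2 := by
  classical
  induction n with
  | zero => simp
  | succ n ih =>
    rw [range_add_one, edgesIn_insert H (by simp)]
    have := (card_filter_le (range n) (fun u => H.Adj n u)).trans_eq (card_range n)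
    nlinarith

open Prog in
theorem exists_program_with_deletionSet :
    ∃ (p : RAM.Program) (C : ℕ),
      ∀ (n : ℕ) (G : SimpleGraph (Fin n)) (X : Finset (Fin n)) (k₁ k₂ : ℤ),
        IsThresholdDeletionSet G X →
        RAM.DecidesWithin p (encodeWithSet G X k₁ k₂) (HasLoadColoring G k₁ k₂)
          (C * (2 ^ X.card * n ^ 3 * max 1 G.edgeSet.ncard)) := by
  classical
  -- The constant is a generous bound for the sum of the constants of the parts.
  refine ⟨program true (readInput ;; readSet ;; prepare ;; search), 10000, ?_⟩
  intro n G X k₁ k₂ hX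
  have hpos := hX.pos
  set I := encodeWithSet G X k₁ k₂ with hI
  have happ : I = [(n : ℤ), k₁, k₂] ++ (List.ofFn (fun a : Fin (n * n) =>
      if G.Adj a.divNat a.modNat then (1 : ℤ) else 0) ++
      List.ofFn (fun v : Fin n => if v ∈ X then (1 : ℤ) else 0)) := by
    rw [hI, encodeWithSet, encode, List.append_assoc]
  have hn : I.getD 0 0 = n := by rw [happ]; rfl
  have h1 : I.getD 1 0 = k₁ := by rw [happ]; rfl
  have h2 : I.getD 2 0 = k₂ := by rw [happ]; rfl
  obtain ⟨hr, hk1, hk2, hn1, ht⟩ := exec_readInput (I := I) (H := natGraph G) (s := .zero) hn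
    (fun u hu v hv => by rw [happ]; exact getD_matrix G _ _ _ _ hu hv)
  have hans : (readInput.exec I .zero).var .ans = 0 := Stmt.var_exec _ rfl
  have hc1 := cost_readInput (s := .zero) hn
  have hx := marks_readSet (I := I) (X := X.map Fin.valEmbedding) hr.size ht
    fun u hu => getD_encodeWithSet G X k₁ k₂ hu
  have hc2 := cost_readSet (I := I) hr.size
  have hXn : X.map Fin.valEmbedding ⊆ range n := by
    rw [← map_univ_val]; exact map_subset_map.2 (subset_univ X)
  obtain ⟨hcor, hc3⟩ := exec_prepare_search (I := I) (s := readSet.exec I (readInput.exec I .zero))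
    (hr.congr (Stmt.var_exec _ rfl) (Stmt.arr_exec _ rfl)) hpos hXn hx hX.peelable
    (by rw [Stmt.var_exec _ rfl, hn1]) (by rw [Stmt.var_exec _ rfl, hans])
  refine decidesWithin_program hn ?_ ?_ ?_
  · rw [happ]; simp; ring
  · rw [Stmt.exec_seq, Stmt.exec_seq, hcor]
    rw [Stmt.var_exec (z := .k1) _ rfl, Stmt.var_exec (z := .k2) _ rfl, hk1, hk2, h1, h2]
    exact if_congr (hasLoadColoring_iff G k₁ k₂).symm rfl rfl
  · change 6 * n + 7 + (readInput.cost I .zero + (readSet.cost I (readInput.exec I .zero) +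
      (prepare ;; search).cost I (readSet.exec I (readInput.exec I .zero)))) ≤ _
    rw [card_map] at hc3
    rw [ncard_edgeSet G]
    set K := 2 ^ #X with hK
    set m := edgesIn (natGraph G) (range n) with hm
    have hK1 : 1 ≤ K := Nat.one_le_two_pow
    have hm1 : m + 1 ≤ 2 * max 1 m := by omega
    have hm2 : 1 ≤ max 1 m := le_max_left _ _
    have hn3 : n ≤ n ^ 3 := Nat.le_self_pow (by norm_num) n
    have b1 : n ^ 3 ≤ K * n ^ 3 * max 1 m := by
      calc n ^ 3 = 1 * n ^ 3 * 1 := by ring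
        _ ≤ _ := Nat.mul_le_mul (Nat.mul_le_mul_right _ hK1) hm2
    have b2 : K * n ^ 3 * (m + 1) ≤ 2 * (K * n ^ 3 * max 1 m) := by
      calc K * n ^ 3 * (m + 1) ≤ K * n ^ 3 * (2 * max 1 m) := Nat.mul_le_mul_left _ hm1
        _ = _ := by ring
    omega

open Prog in
theorem exists_fpt_program :
    ∃ (p : RAM.Program) (f : ℕ → ℕ) (c : ℕ), Computable f ∧
      ∀ (n : ℕ) (_ : 0 < n) (G : SimpleGraph (Fin n)) (k₁ k₂ : ℤ),
        RAM.DecidesWithin p (encode G k₁ k₂) (HasLoadColoring G k₁ k₂)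
          (f (distToThreshold G) * n ^ c) := by
  classical
  have hcomp : Computable (fun k : ℕ => 10000 * 16 ^ k) := by
    have : Primrec (Nat.rec 10000 fun _ y => 16 * y : ℕ → ℕ) :=
      Primrec.nat_rec₁ _ (Primrec.nat_mul.comp (Primrec.const 16) Primrec.snd)
    refine (this.of_eq fun k => ?_).to_comp
    induction k with
    | zero => rfl
    | succ k ih => rw [pow_succ', mul_left_comm, ← ih]
  -- The exponent 5 comes from the factor `n ^ 3` of the search and from `m + 1 ≤ 2 * n ^ 2`; it
  -- also covers the `n ^ 4` steps of the greedy choice. The optimal deletion set `Z` below occurs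
  -- only in the analysis.
  refine ⟨program false (readInput ;; greedySet ;; prepare ;; search), _, 5, hcomp, ?_⟩
  intro n hpos G k₁ k₂
  obtain ⟨Z, hZ, hZk⟩ := exists_isThresholdDeletionSet hpos G
  rw [← hZk]
  set I := encode G k₁ k₂ with hI
  have happ : I = [(n : ℤ), k₁, k₂] ++ (List.ofFn (fun a : Fin (n * n) =>
      if G.Adj a.divNat a.modNat then (1 : ℤ) else 0) ++ []) := by
    rw [hI, encode, List.append_nil]
  have hn : I.getD 0 0 = n := by rw [happ]; rfl
  have h1 : I.getD 1 0 = k₁ := by rw [happ]; rfl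
  have h2 : I.getD 2 0 = k₂ := by rw [happ]; rfl
  obtain ⟨hr, hk1, hk2, hn1, ht⟩ := exec_readInput (I := I) (H := natGraph G) (s := .zero) hn
    (fun u hu v hv => by rw [happ]; exact getD_matrix G _ _ _ _ hu hv)
  have hans : (readInput.exec I .zero).var .ans = 0 := Stmt.var_exec _ rfl
  have hc1 := cost_readInput (s := .zero) hn
  obtain ⟨X, hXn, hx, hXZ, hpeel⟩ := exec_greedySet (I := I) hr (by
    intro u _
    rw [Stmt.arr_exec _ rfl]
    simp [State.zero]) hZ.peelable
  rw [card_map] at hXZ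
  have hc2 := cost_greedySet (I := I) hr.size hpos
  obtain ⟨hcor, hc3⟩ := exec_prepare_search (I := I) (s := greedySet.exec I (readInput.exec I .zero))
    (hr.congr (Stmt.var_exec _ rfl) (Stmt.arr_exec _ rfl)) hpos hXn hx hpeel
    (by rw [Stmt.var_exec _ rfl, hn1]) (by rw [Stmt.var_exec _ rfl, hans])
  refine decidesWithin_program hn ?_ ?_ ?_
  · rw [happ]; simp; ring
  · rw [Stmt.exec_seq, Stmt.exec_seq, hcor]
    rw [Stmt.var_exec (z := .k1) _ rfl, Stmt.var_exec (z := .k2) _ rfl, hk1, hk2, h1, h2]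
    exact if_congr (hasLoadColoring_iff G k₁ k₂).symm rfl rfl
  · change 6 * n + 7 + (readInput.cost I .zero + (greedySet.cost I (readInput.exec I .zero) +
      (prepare ;; search).cost I (greedySet.exec I (readInput.exec I .zero)))) ≤ _
    have hpow : 2 ^ #X ≤ 16 ^ #Z := by
      calc 2 ^ #X ≤ 2 ^ (4 * #Z) := Nat.pow_le_pow_right (by norm_num) hXZ
        _ = 16 ^ #Z := by rw [pow_mul]; norm_num
    set K := 16 ^ #Z with hK
    have hK1 : 1 ≤ K := Nat.one_le_pow _ _ (by norm_num)
    have hm1 : edgesIn (natGraph G) (range n) + 1 ≤ 2 * n ^ 2 := by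
      have := edgesIn_range_le (n := n) (natGraph G)
      have : 1 ≤ n ^ 2 := Nat.one_le_pow _ _ hpos
      omega
    have b0 : n ≤ n ^ 5 := Nat.le_self_pow (by norm_num) n
    have b3 : n ^ 3 ≤ n ^ 5 := Nat.pow_le_pow_right hpos (by norm_num)
    have b4 : n ^ 4 ≤ n ^ 5 := Nat.pow_le_pow_right hpos (by norm_num)
    have b5 : n ^ 5 ≤ K * n ^ 5 := Nat.le_mul_of_pos_left _ hK1
    have b6 : 2 ^ #X * n ^ 3 * (edgesIn (natGraph G) (range n) + 1) ≤ 2 * (K * n ^ 5) := by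
      calc _ ≤ K * n ^ 3 * (2 * n ^ 2) := Nat.mul_le_mul (Nat.mul_le_mul_right _ hpow) hm1
        _ = _ := by ring
    rw [mul_assoc]
    omega

end LoadColoring

theorem theorem5 :
    (∃ (p : RAM.Program) (f : ℕ → ℕ) (c : ℕ), Computable f ∧
      ∀ (n : ℕ) (_ : 0 < n) (G : SimpleGraph (Fin n)) (k₁ k₂ : ℤ),
        RAM.DecidesWithin p (LoadColoring.encode G k₁ k₂)
          (LoadColoring.HasLoadColoring G k₁ k₂)
          (f (LoadColoring.distToThreshold G) * n ^ c)) ∧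
    (∃ (p : RAM.Program) (C : ℕ),
      ∀ (n : ℕ) (G : SimpleGraph (Fin n)) (X : Finset (Fin n)) (k₁ k₂ : ℤ),
        LoadColoring.IsThresholdDeletionSet G X →
        RAM.DecidesWithin p (LoadColoring.encodeWithSet G X k₁ k₂)
          (LoadColoring.HasLoadColoring G k₁ k₂)
          (C * (2 ^ X.card * n ^ 3 * max 1 G.edgeSet.ncard))) :=
  ⟨LoadColoring.exists_fpt_program, LoadColoring.exists_program_with_deletionSet⟩
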